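/- Conventions. All Banach spaces are real. Let $\mathcal D$ be the set of dyadic intervals $[\frac{i}{2^j},\frac{i+1}{2^j})$, $j\ge 0$, $0\le i<2^j$, ordered by the bijection $\iota\colon\mathcal D\to\mathbb N$, $\iota([\frac{i}{2^j},\frac{i+1}{2^j}))=2^j+i$. Put $\mathcal D^+=\mathcal D\cup\{\varnothing\}$, $\iota(\varnothing)=0$, $h_\varnothing=\chi_{[0,1)}$, and for $I\in\mathcal D$ let $h_I=\chi_{I^+}-\chi_{I^-}$, where $I^+$ and $I^-$ are the left and right halves of $I$. Put $r_n=\sum_{|I|=2^{-n}}h_I$ for $n\ge 0$ (the Rademacher functions) and $H=\operatorname{span}\{h_I: I\in\mathcal D^+\}=\operatorname{span}\{\chi_I: I\in\mathcal D\}$. Haar system Hardy spaces. Let $\|\cdot\|_X$ be a norm on $H$ such that $\|x\|_X=\|y\|_X$ whenever $|x|$ and $|y|$ have the same distribution (with respect to Lebesgue measure on $[0,1)$), and $\|\chi_{[0,1)}\|_X=1$. Let $\mathbf r=(r_I)_{I\in\mathcal D^+}$ be either the family $r_I=r_{\iota(I)}$ or the constant family $r_I=r_0$. Let $X(\mathbf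 r)$ be the completion of $H$ under $$\Bigl\|\sum_{I\in\mathcal D^+}a_Ih_I\Bigr\|_{X(\mathbf r)}=\Bigl\|\,s\mapsto\int_0^1\Bigl|\sum_{I\in\mathcal D^+}r_I(u)a_Ih_I(s)\Bigr|\,du\Bigr\|_X ,$$ and let $Y=X_0(\mathbf r)$ be the closed linear span of $(h_I)_{I\in\mathcal D}$ in $X(\mathbf r)$. The game. Let $E$ be a Banach space with a normalized Schauder basis $(e_j)_{j=1}^\infty$ and biorthogonal functionals $(e_j^*)_{j=1}^\infty$, and let $C\ge 1$, $\eta>0$. First, player (I) chooses a partition $\mathbb N=N_1\cup N_2$. Then, in turn $k=1,2,\dots$: 1. player (I) chooses $\eta_k>0$, a closed subspace $W_k\subset E$ of finite codimension and a weak* closed subspace $G_k\subset E^*$ of finite codimension; 2. player (II) chooses $i_k\in\{1,2\}$, a finite set $E_k\subset N_{i_k}$ and non-negative reals $(\lambda^k_j)_{j\in E_k}$, $(\mu^k_j)_{j\in E_k}$ with $1-\eta<\sum_{j\in E_k}\lambda_j^k\mu_j^k<1+\eta$; 3. player (I) chooses signs $(\varepsilon^k_j)_{j\in E_k}\in\{\pm1\}^{E_k}$.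 Put $x_k=\sum_{j\in E_k}\varepsilon^k_j\lambda^k_je_j$ and $x_k^*=\sum_{j\in E_k}\varepsilon^k_j\mu^k_je_j^*$. The basis $(e_j)$ is called *$C$-strategically reproducible in $E$ with projectional factors* if for every $\eta>0$ player (II) has a strategy which guarantees that - $(x_k)$ and $(e_k)$ are impartially $(C+\eta)$-equivalent, i.e. $\frac{1}{\sqrt{C+\eta}}\bigl\|\sum_k a_ke_k\bigr\|\le\bigl\|\sum_k a_kx_k\bigr\|\le\sqrt{C+\eta}\,\bigl\|\sum_k a_ke_k\bigr\|$ for all finitely supported scalar sequences $(a_k)$; - $(x_k^*)$ and $(e_k^*)$ are impartially $(C+\eta)$-equivalent in $E^*$; - $\operatorname{dist}(x_k,W_k)<\eta_k$ and $\operatorname{dist}(x_k^*,G_k)<\eta_k$ for all $k$; - $(x_k^*)$ is biorthogonal to $(x_k)$, i.e. $\langle x_k^*,x_l\rangle=\delta_{kl}$ for all $k,l$. Theorem. Let $Y=X_0(\mathbf r)$ be as above and suppose that the sequence of Rademacher functions $(r_n)_{n=0}^\infty$ is weakly null in $Y$. Then $(h_I/\|h_I\|_Y)_{I\in\mathcal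 D}$, in the order given by $\iota$, is a normalized Schauder basis of $Y$, and it is $2$-strategically reproducible in $Y$ with projectional factors. -/

import Mathlib

open MeasureTheory ProbabilityTheory Filter Topology

noncomputable section

/-! ### Dyadic intervals, the Haar system and the Rademacher functions

Functions on `[0,1)` are modelled as functions `ℝ → ℝ` that vanish outside `[0,1)`.
The dyadic interval `I = [i/2^j, (i+1)/2^j)` has number `ι(I) = 2^j + i ≥ 1` and `ι(∅) = 0`. -/

/-- The interval `[i/2^j, (i+1)/2^j)`. -/
def dyadicInterval (j i : ℕ) : Set ℝ :=
  Set.Ico ((i : ℝ) / 2 ^ j) (((i : ℝ) + 1) / 2 ^ j)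

/-- The characteristic function of `[i/2^j, (i+1)/2^j)`. -/
def dyadicIndicator (j i : ℕ) : ℝ → ℝ := (dyadicInterval j i).indicator 1

/-- The Haar function `h_I = χ_{I⁺} - χ_{I⁻}` for `I = [i/2^j, (i+1)/2^j)`, where `I⁺` is the left
half and `I⁻` the right half of `I`. -/
def haarFunction (j i : ℕ) : ℝ → ℝ :=
  dyadicIndicator (j + 1) (2 * i) - dyadicIndicator (j + 1) (2 * i + 1)

/-- The Haar system `(h_I)`, `I ∈ 𝒟⁺`, in the linear order given by `ι`: number `0` is
`h_∅ = χ_[0,1)`, and number `2^j + i` with `i < 2^j` is `h_I` for `I = [i/2^j, (i+1)/2^j)`. -/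
def haarSystem (n : ℕ) : ℝ → ℝ :=
  if n = 0 then dyadicIndicator 0 0 else haarFunction (Nat.log 2 n) (n - 2 ^ Nat.log 2 n)

/-- The Rademacher function `r_n`, the sum of all `h_I` with `|I| = 2⁻ⁿ`. -/
def rademacher (n : ℕ) : ℝ → ℝ := ∑ i ∈ Finset.range (2 ^ n), haarFunction n i

/-- `H`, the linear span of the characteristic functions of the dyadic intervals in `[0,1)`. -/
def dyadicStep : Submodule ℝ (ℝ → ℝ) :=
  Submodule.span ℝ {f | ∃ j i : ℕ, i < 2 ^ j ∧ f = dyadicIndicator j i}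

/-- The norm of a Haar system space: a norm on `H` such that `x` and `y` have the same norm
whenever `|x|` and `|y|` have the same distribution with respect to the Lebesgue measure on
`[0,1)`, and such that `χ_[0,1)` has norm `1`. -/
structure HaarSystemNorm where
  norm : Seminorm ℝ dyadicStep
  eq_zero_of_norm_eq_zero : ∀ x : dyadicStep, norm x = 0 → x = 0
  norm_eq_of_equimeasurable : ∀ x y : dyadicStep,
    IdentDistrib (fun s => |(x : ℝ → ℝ) s|) (fun s => |(y : ℝ → ℝ) s|)
      (volume.restrict (Set.Ico (0 : ℝ) 1)) (volume.restrict (Set.Ico (0 : ℝ) 1)) →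
    norm x = norm y
  norm_unit : ∀ x : dyadicStep, (x : ℝ → ℝ) = (Set.Ico (0 : ℝ) 1).indicator 1 → norm x = 1

/-- The set `ℛ` of the two admissible families `(r_I)`, `I ∈ 𝒟⁺`, indexed through `ι`: the
independent family `r_I = r_{ι(I)}` and the constant family `r_I = r_0`. -/
def rademacherFamilies : Set (ℕ → ℝ → ℝ) :=
  {fun n => rademacher n, fun _ => rademacher 0}

/-! ### Membership in `H` -/

/-- `f` vanishes outside `[0,1)` and is constant on the dyadic intervals of length `2⁻ⁿ`. -/
def IsStepOfLevel (n : ℕ) (f : ℝ → ℝ) : Prop :=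
  (∀ s ∉ Set.Ico (0 : ℝ) 1, f s = 0) ∧
    ∀ s ∈ Set.Ico (0 : ℝ) 1, ∀ t ∈ Set.Ico (0 : ℝ) 1,
      ⌊(2 : ℝ) ^ n * s⌋₊ = ⌊(2 : ℝ) ^ n * t⌋₊ → f s = f t

theorem IsStepOfLevel.mono {n m : ℕ} (h : n ≤ m) {f : ℝ → ℝ} (hf : IsStepOfLevel n f) :
    IsStepOfLevel m f := by
  refine ⟨hf.1, fun s hs t ht hst => hf.2 s hs t ht ?_⟩
  have key : ∀ x : ℝ, (2 : ℝ) ^ n * x = (2 : ℝ) ^ m * x / ((2 ^ (m - n) : ℕ) : ℝ) := by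
    intro x
    have : (2 : ℝ) ^ m = 2 ^ n * 2 ^ (m - n) := by rw [← pow_add]; congr 1; omega
    rw [this]
    push_cast
    field_simp
  rw [key s, key t, Nat.floor_div_natCast, Nat.floor_div_natCast, hst]

theorem mem_dyadicInterval_iff {j i : ℕ} {s : ℝ} (hs : 0 ≤ s) :
    s ∈ dyadicInterval j i ↔ ⌊(2 : ℝ) ^ j * s⌋₊ = i := by
  have h2 : (0 : ℝ) < 2 ^ j := by positivity
  rw [Nat.floor_eq_iff (by positivity), dyadicInterval, Set.mem_Ico, div_le_iff₀ h2,
    lt_div_iff₀ h2, mul_comm s]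

theorem dyadicInterval_subset {j i : ℕ} (hi : i < 2 ^ j) :
    dyadicInterval j i ⊆ Set.Ico (0 : ℝ) 1 := by
  intro s hs
  have h2 : (0 : ℝ) < 2 ^ j := by positivity
  have hi' : (i : ℝ) + 1 ≤ 2 ^ j := by exact_mod_cast hi
  refine ⟨le_trans (by positivity) hs.1, lt_of_lt_of_le hs.2 ?_⟩
  rw [div_le_one h2]
  exact hi'

theorem isStepOfLevel_dyadicIndicator {j i : ℕ} (hi : i < 2 ^ j) :
    IsStepOfLevel j (dyadicIndicator j i) := by
  refine ⟨fun s hs => ?_, fun s hs t ht hst => ?_⟩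
  · exact Set.indicator_of_notMem (fun h => hs (dyadicInterval_subset hi h)) _
  · have : s ∈ dyadicInterval j i ↔ t ∈ dyadicInterval j i := by
      rw [mem_dyadicInterval_iff hs.1, mem_dyadicInterval_iff ht.1, hst]
    by_cases h : s ∈ dyadicInterval j i
    · simp [dyadicIndicator, Set.indicator_of_mem h, Set.indicator_of_mem (this.1 h)]
    · simp [dyadicIndicator, Set.indicator_of_notMem h,
        Set.indicator_of_notMem (fun h' => h (this.2 h'))]

theorem mem_dyadicStep_iff {f : ℝ → ℝ} : f ∈ dyadicStep ↔ ∃ n, IsStepOfLevel n f := by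
  constructor
  · intro hf
    induction hf using Submodule.span_induction with
    | mem f hf =>
      obtain ⟨j, i, hi, rfl⟩ := hf
      exact ⟨j, isStepOfLevel_dyadicIndicator hi⟩
    | zero => exact ⟨0, fun _ _ => rfl, fun _ _ _ _ _ => rfl⟩
    | add f g _ _ hf hg =>
      obtain ⟨n, hn⟩ := hf
      obtain ⟨m, hm⟩ := hg
      have h1 := hn.mono (le_max_left n m)
      have h2 := hm.mono (le_max_right n m)
      refine ⟨max n m, fun s hs => ?_, fun s hs t ht hst => ?_⟩
      · simp [h1.1 s hs, h2.1 s hs]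
      · simp [h1.2 s hs t ht hst, h2.2 s hs t ht hst]
    | smul c f _ hf =>
      obtain ⟨n, hn⟩ := hf
      refine ⟨n, fun s hs => ?_, fun s hs t ht hst => ?_⟩
      · simp [hn.1 s hs]
      · simp [hn.2 s hs t ht hst]
  · rintro ⟨n, hn⟩
    have h2 : (0 : ℝ) < 2 ^ n := by positivity
    have hf : f = ∑ i ∈ Finset.range (2 ^ n), f ((i : ℝ) / 2 ^ n) • dyadicIndicator n i := by
      funext s
      rw [Finset.sum_apply]
      by_cases hs : s ∈ Set.Ico (0 : ℝ) 1
      · have hlt : ⌊(2 : ℝ) ^ n * s⌋₊ < 2 ^ n := by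
          rw [Nat.floor_lt (mul_nonneg h2.le hs.1)]
          push_cast
          nlinarith [hs.2]
        rw [Finset.sum_eq_single_of_mem _ (Finset.mem_range.2 hlt)]
        · have hmem : s ∈ dyadicInterval n ⌊(2 : ℝ) ^ n * s⌋₊ :=
            (mem_dyadicInterval_iff hs.1).2 rfl
          have hlt' : ((⌊(2 : ℝ) ^ n * s⌋₊ : ℕ) : ℝ) < 2 ^ n := by exact_mod_cast hlt
          have hq : (⌊(2 : ℝ) ^ n * s⌋₊ : ℝ) / 2 ^ n ∈ Set.Ico (0 : ℝ) 1 :=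
            ⟨by positivity, by rw [div_lt_one h2]; exact hlt'⟩
          have : f s = f ((⌊(2 : ℝ) ^ n * s⌋₊ : ℝ) / 2 ^ n) := by
            refine hn.2 s hs _ hq ?_
            rw [mul_div_cancel₀ _ h2.ne', Nat.floor_natCast]
          simp [dyadicIndicator, Set.indicator_of_mem hmem, ← this]
        · intro i _ hi
          have : s ∉ dyadicInterval n i := fun h => hi ((mem_dyadicInterval_iff hs.1).1 h).symm
          simp [dyadicIndicator, Set.indicator_of_notMem this]
      · rw [hn.1 s hs]
        refine (Finset.sum_eq_zero fun i hi => ?_).symm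
        have : s ∉ dyadicInterval n i :=
          fun h => hs (dyadicInterval_subset (Finset.mem_range.1 hi) h)
        simp [dyadicIndicator, Set.indicator_of_notMem this]
    rw [hf]
    refine Submodule.sum_mem _ fun i hi => Submodule.smul_mem _ _ (Submodule.subset_span ?_)
    exact ⟨n, i, Finset.mem_range.1 hi, rfl⟩

theorem haarFunction_mem {j i : ℕ} (hi : i < 2 ^ j) : haarFunction j i ∈ dyadicStep := by
  refine Submodule.sub_mem _ (Submodule.subset_span ⟨j + 1, 2 * i, ?_, rfl⟩)
    (Submodule.subset_span ⟨j + 1, 2 * i + 1, ?_, rfl⟩) <;> rw [pow_succ] <;> omega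

theorem haarSystem_mem (n : ℕ) : haarSystem n ∈ dyadicStep := by
  unfold haarSystem
  split_ifs with h
  · exact Submodule.subset_span ⟨0, 0, by simp, rfl⟩
  · refine haarFunction_mem ?_
    have h1 := Nat.lt_pow_succ_log_self (b := 2) (by norm_num) n
    rw [Nat.succ_eq_add_one, pow_succ] at h1
    omega

theorem rademacher_mem (n : ℕ) : rademacher n ∈ dyadicStep :=
  Submodule.sum_mem _ fun _ hi => haarFunction_mem (Finset.mem_range.1 hi)

theorem intervalIntegrable_of_mem {f : ℝ → ℝ} (hf : f ∈ dyadicStep) :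
    IntervalIntegrable f volume 0 1 := by
  induction hf using Submodule.span_induction with
  | mem f hf =>
    obtain ⟨j, i, _, rfl⟩ := hf
    have : Integrable (dyadicIndicator j i) volume := by
      unfold dyadicIndicator dyadicInterval
      rw [integrable_indicator_iff measurableSet_Ico]
      simp only [Pi.one_def]
      exact integrableOn_const (by simp)
    exact this.intervalIntegrable
  | zero => exact _root_.intervalIntegrable_const (c := (0 : ℝ))
  | add f g _ _ hf hg => exact hf.add hg
  | smul c f _ hf => exact hf.smul c

/-! ### Monotonicity of Haar system norms -/

theorem HaarSystemNorm.norm_eq_of_abs_eq (X : HaarSystemNorm) (f g : dyadicStep)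
    (h : ∀ s, |(f : ℝ → ℝ) s| = |(g : ℝ → ℝ) s|) : X.norm f = X.norm g := by
  have haem : AEMeasurable (f : ℝ → ℝ) (volume.restrict (Set.Ico (0 : ℝ) 1)) := by
    have := (intervalIntegrable_of_mem f.2).1.aestronglyMeasurable.aemeasurable
    rwa [← restrict_Ico_eq_restrict_Ioc] at this
  have hfun : (fun s => |(f : ℝ → ℝ) s|) = fun s => |(g : ℝ → ℝ) s| := funext h
  apply X.norm_eq_of_equimeasurable
  rw [← hfun]
  exact IdentDistrib.refl haem.abs

theorem HaarSystemNorm.norm_mono (X : HaarSystemNorm) (f g : dyadicStep)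
    (h : ∀ s, |(f : ℝ → ℝ) s| ≤ |(g : ℝ → ℝ) s|) : X.norm f ≤ X.norm g := by
  obtain ⟨n₁, hn₁⟩ := mem_dyadicStep_iff.1 f.2
  obtain ⟨n₂, hn₂⟩ := mem_dyadicStep_iff.1 g.2
  obtain ⟨n, hf, hg⟩ : ∃ n, IsStepOfLevel n (f : ℝ → ℝ) ∧ IsStepOfLevel n (g : ℝ → ℝ) :=
    ⟨max n₁ n₂, hn₁.mono (le_max_left _ _), hn₂.mono (le_max_right _ _)⟩
  let p : ℕ → ℝ → ℝ := fun k s =>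
    if ⌊(2 : ℝ) ^ n * s⌋₊ < k then (f : ℝ → ℝ) s else (g : ℝ → ℝ) s
  have hp : ∀ k, p k ∈ dyadicStep := fun k => mem_dyadicStep_iff.2 ⟨n, fun s hs => by
    simp [p, hf.1 s hs, hg.1 s hs], fun s hs t ht hst => by
    simp [p, hst, hf.2 s hs t ht hst, hg.2 s hs t ht hst]⟩
  have step : ∀ k, X.norm ⟨p (k + 1), hp (k + 1)⟩ ≤ X.norm ⟨p k, hp k⟩ := by
    intro k
    let q : ℝ → ℝ := fun s => if ⌊(2 : ℝ) ^ n * s⌋₊ = k then -p k s else p k s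
    have hq : q ∈ dyadicStep := mem_dyadicStep_iff.2 ⟨n, fun s hs => by
      simp [q, p, hf.1 s hs, hg.1 s hs], fun s hs t ht hst => by
      simp [q, p, hst, hf.2 s hs t ht hst, hg.2 s hs t ht hst]⟩
    have hqp : X.norm ⟨q, hq⟩ = X.norm ⟨p k, hp k⟩ := by
      apply X.norm_eq_of_abs_eq
      intro s
      by_cases hs : ⌊(2 : ℝ) ^ n * s⌋₊ = k <;> simp [q, hs]
    obtain ⟨t, ht, hpt⟩ : ∃ t : ℝ, |t| ≤ 1 ∧
        ∀ s, ⌊(2 : ℝ) ^ n * s⌋₊ = k → (f : ℝ → ℝ) s = t * (g : ℝ → ℝ) s := by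
      by_cases hex : ∃ s₀ ∈ Set.Ico (0 : ℝ) 1, ⌊(2 : ℝ) ^ n * s₀⌋₊ = k
      · obtain ⟨s₀, hs₀, hk⟩ := hex
        refine ⟨(f : ℝ → ℝ) s₀ / (g : ℝ → ℝ) s₀, ?_, fun s hsk => ?_⟩
        · rw [abs_div]
          exact div_le_one_of_le₀ (h s₀) (abs_nonneg _)
        · by_cases hs : s ∈ Set.Ico (0 : ℝ) 1
          · rw [hf.2 s hs s₀ hs₀ (hsk.trans hk.symm), hg.2 s hs s₀ hs₀ (hsk.trans hk.symm)]
            by_cases hz : (g : ℝ → ℝ) s₀ = 0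
            · have := h s₀
              rw [hz, abs_zero] at this
              rw [hz, mul_zero]
              exact abs_eq_zero.1 (le_antisymm this (abs_nonneg _))
            · rw [div_mul_cancel₀ _ hz]
          · rw [hf.1 s hs, hg.1 s hs, mul_zero]
      · refine ⟨0, by simp, fun s hsk => ?_⟩
        have hs : s ∉ Set.Ico (0 : ℝ) 1 := fun hs => hex ⟨s, hs, hsk⟩
        rw [hf.1 s hs, zero_mul]
    have ht' := abs_le.1 ht
    have hconv : (⟨p (k + 1), hp (k + 1)⟩ : dyadicStep) =
        ((1 + t) / 2) • ⟨p k, hp k⟩ + ((1 - t) / 2) • ⟨q, hq⟩ := by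
      apply Subtype.ext
      funext s
      change p (k + 1) s = (1 + t) / 2 * p k s + (1 - t) / 2 * q s
      by_cases hsk : ⌊(2 : ℝ) ^ n * s⌋₊ = k
      · have h1 : p (k + 1) s = (f : ℝ → ℝ) s := by simp [p, hsk]
        have h2 : p k s = (g : ℝ → ℝ) s := by simp [p, hsk]
        have h3 : q s = -(g : ℝ → ℝ) s := by simp [q, hsk, h2]
        rw [h1, h2, h3, hpt s hsk]
        ring
      · have h1 : p (k + 1) s = p k s := by
          have : ⌊(2 : ℝ) ^ n * s⌋₊ < k + 1 ↔ ⌊(2 : ℝ) ^ n * s⌋₊ < k := by omega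
          simp only [p, this]
        have h3 : q s = p k s := by simp [q, hsk]
        rw [h1, h3]
        ring
    rw [hconv]
    refine (map_add_le_add X.norm _ _).trans ?_
    rw [map_smul_eq_mul, map_smul_eq_mul, hqp, Real.norm_of_nonneg (by linarith),
      Real.norm_of_nonneg (by linarith)]
    apply le_of_eq
    ring
  have all : ∀ k, X.norm ⟨p k, hp k⟩ ≤ X.norm ⟨p 0, hp 0⟩ := by
    intro k
    induction k with
    | zero => exact le_rfl
    | succ k ih => exact (step k).trans ih
  have e0 : (⟨p 0, hp 0⟩ : dyadicStep) = g := Subtype.ext (funext fun s => by simp [p])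
  have e1 : (⟨p (2 ^ n), hp (2 ^ n)⟩ : dyadicStep) = f := by
    apply Subtype.ext
    funext s
    change p (2 ^ n) s = (f : ℝ → ℝ) s
    by_cases hs : s ∈ Set.Ico (0 : ℝ) 1
    · have hlt : ⌊(2 : ℝ) ^ n * s⌋₊ < 2 ^ n := by
        have h2 : (0 : ℝ) < 2 ^ n := by positivity
        rw [Nat.floor_lt (mul_nonneg h2.le hs.1)]
        push_cast
        nlinarith [hs.2]
      simp only [p, if_pos hlt]
    · simp [p, hf.1 s hs, hg.1 s hs]
  have := all (2 ^ n)
  rwa [e0, e1] at this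

/-! ### Haar system Hardy spaces -/

/-- The function `s ↦ ∫₀¹ |∑_I r_I(u) a_I h_I(s)| du` for a finitely supported family `(a_I)`,
`I ∈ 𝒟⁺`, indexed through `ι`. -/
def hardyFunction (r : ℕ → ℝ → ℝ) (a : ℕ →₀ ℝ) (s : ℝ) : ℝ :=
  ∫ u in (0 : ℝ)..1, |a.sum fun n c => r n u * c * haarSystem n s|

theorem hardyFunction_mem (r : ℕ → ℝ → ℝ) (a : ℕ →₀ ℝ) : hardyFunction r a ∈ dyadicStep := by
  choose l hl using fun n => mem_dyadicStep_iff.1 (haarSystem_mem n)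
  have hl' : ∀ n ∈ a.support, IsStepOfLevel (a.support.sup l) (haarSystem n) :=
    fun n hn => (hl n).mono (Finset.le_sup hn)
  refine mem_dyadicStep_iff.2 ⟨a.support.sup l, fun s hs => ?_, fun s hs t ht hst => ?_⟩
  · have : ∀ u, (a.sum fun n c => r n u * c * haarSystem n s) = 0 := fun u =>
      Finset.sum_eq_zero fun n hn => by simp [(hl' n hn).1 s hs]
    simp [hardyFunction, this]
  · have : ∀ u, (a.sum fun n c => r n u * c * haarSystem n s) =
        a.sum fun n c => r n u * c * haarSystem n t := fun u =>
      Finset.sum_congr rfl fun n hn => by simp only [(hl' n hn).2 s hs t ht hst]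
    simp only [hardyFunction, this]

theorem rademacherFamilies_mem (r : rademacherFamilies) (n : ℕ) :
    (r : ℕ → ℝ → ℝ) n ∈ dyadicStep := by
  obtain ⟨r, hr⟩ := r
  rcases hr with rfl | rfl
  · exact rademacher_mem n
  · exact rademacher_mem 0

theorem hardyFunction_nonneg (r : ℕ → ℝ → ℝ) (a : ℕ →₀ ℝ) (s : ℝ) : 0 ≤ hardyFunction r a s :=
  intervalIntegral.integral_nonneg zero_le_one fun _ _ => abs_nonneg _

theorem hardyFunction_add_le (r : rademacherFamilies) (a b : ℕ →₀ ℝ) (s : ℝ) :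
    hardyFunction r (a + b) s ≤ hardyFunction r a s + hardyFunction r b s := by
  have hint : ∀ c : ℕ →₀ ℝ, IntervalIntegrable
      (fun u => |c.sum fun n c => (r : ℕ → ℝ → ℝ) n u * c * haarSystem n s|) volume 0 1 := by
    intro c
    refine IntervalIntegrable.abs ?_
    have := IntervalIntegrable.sum (μ := volume) (a := (0 : ℝ)) (b := 1) c.support
      (f := fun n u => (r : ℕ → ℝ → ℝ) n u * c n * haarSystem n s)
      (fun n _ => ((intervalIntegrable_of_mem (rademacherFamilies_mem r n)).mul_const _).mul_const _)
    have hfun : (fun u => c.sum fun n c => (r : ℕ → ℝ → ℝ) n u * c * haarSystem n s) =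
        ∑ n ∈ c.support, fun u => (r : ℕ → ℝ → ℝ) n u * c n * haarSystem n s := by
      funext u
      simp [Finsupp.sum]
    rw [hfun]
    exact this
  unfold hardyFunction
  rw [← intervalIntegral.integral_add (hint a) (hint b)]
  refine intervalIntegral.integral_mono_on zero_le_one (hint (a + b))
    ((hint a).add (hint b)) fun u _ => ?_
  rw [Finsupp.sum_add_index' (by simp) (by intros; ring)]
  exact abs_add_le _ _

theorem hardyFunction_smul (r : ℕ → ℝ → ℝ) (c : ℝ) (a : ℕ →₀ ℝ) :
    hardyFunction r (c • a) = |c| • hardyFunction r a := by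
  funext s
  simp only [hardyFunction, Pi.smul_apply, smul_eq_mul]
  rw [← intervalIntegral.integral_const_mul]
  congr 1
  funext u
  rw [← abs_mul, Finsupp.sum_smul_index (by simp), Finsupp.mul_sum]
  congr 2
  funext n d
  ring

/-- The norm of `X(𝐫)` on `H`, as a function of the finitely supported Haar coefficients
`(a_I)`, `I ∈ 𝒟⁺`: the `X`-norm of `s ↦ ∫₀¹ |∑_I r_I(u) a_I h_I(s)| du`. -/
def hardyNorm (X : HaarSystemNorm) (r : rademacherFamilies) : Seminorm ℝ (ℕ →₀ ℝ) :=
  Seminorm.of (fun a => X.norm ⟨hardyFunction r a, hardyFunction_mem r a⟩)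
    (fun a b => by
      refine (X.norm_mono _ (⟨hardyFunction r a, hardyFunction_mem r a⟩ +
        ⟨hardyFunction r b, hardyFunction_mem r b⟩) fun s => ?_).trans (map_add_le_add X.norm _ _)
      change |hardyFunction r (a + b) s| ≤ |hardyFunction r a s + hardyFunction r b s|
      rw [abs_of_nonneg (hardyFunction_nonneg _ _ _), abs_of_nonneg
        (add_nonneg (hardyFunction_nonneg _ _ _) (hardyFunction_nonneg _ _ _))]
      exact hardyFunction_add_le r a b s)
    (fun c a => by
      have : (⟨hardyFunction r (c • a), hardyFunction_mem r (c • a)⟩ : dyadicStep) =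
          |c| • ⟨hardyFunction r a, hardyFunction_mem r a⟩ :=
        Subtype.ext (hardyFunction_smul r c a)
      rw [this, map_smul_eq_mul, Real.norm_eq_abs, abs_abs, Real.norm_eq_abs])

/-- The space `H = span {h_I : I ∈ 𝒟⁺}`, whose elements are given by their Haar coefficients,
with the norm of `X(𝐫)`. -/
def HardyPre (_X : HaarSystemNorm) (_r : rademacherFamilies) : Type := ℕ →₀ ℝ

instance (X : HaarSystemNorm) (r : rademacherFamilies) : AddCommGroup (HardyPre X r) :=
  inferInstanceAs (AddCommGroup (ℕ →₀ ℝ))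

instance (X : HaarSystemNorm) (r : rademacherFamilies) : Module ℝ (HardyPre X r) :=
  inferInstanceAs (Module ℝ (ℕ →₀ ℝ))

/-- The linear combination of the Haar system with coefficients `a`, as an element of `H`. -/
def HardyPre.mk (X : HaarSystemNorm) (r : rademacherFamilies) (a : ℕ →₀ ℝ) : HardyPre X r := a

/-- `hardyNorm` as a seminorm on `HardyPre`. -/
def HardyPre.norm (X : HaarSystemNorm) (r : rademacherFamilies) : Seminorm ℝ (HardyPre X r) :=
  hardyNorm X r

instance (X : HaarSystemNorm) (r : rademacherFamilies) : SeminormedAddCommGroup (HardyPre X r) :=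
  (HardyPre.norm X r).toAddGroupSeminorm.toSeminormedAddCommGroup

instance (X : HaarSystemNorm) (r : rademacherFamilies) : NormedSpace ℝ (HardyPre X r) :=
  { (inferInstance : Module ℝ (HardyPre X r)) with
    norm_smul_le := fun c a => le_of_eq (map_smul_eq_mul (HardyPre.norm X r) c a) }

/-- The Haar system Hardy space `X(𝐫)`, the completion of `H` in the norm of `X(𝐫)`. -/
abbrev HardySpace (X : HaarSystemNorm) (r : rademacherFamilies) : Type :=
  UniformSpace.Completion (HardyPre X r)

/-- The Haar function with number `n` (so `h_∅` for `n = 0`) as an element of `X(𝐫)`. -/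
def haarVector (X : HaarSystemNorm) (r : rademacherFamilies) (n : ℕ) : HardySpace X r :=
  (HardyPre.mk X r (Finsupp.single n 1) : UniformSpace.Completion (HardyPre X r))

/-- The closed linear span of `h_I`, `I ∈ 𝒟` (that is, without `h_∅`), in `X(𝐫)`. -/
def hardySubspace (X : HaarSystemNorm) (r : rademacherFamilies) : Submodule ℝ (HardySpace X r) :=
  (Submodule.span ℝ (Set.range fun n : ℕ => haarVector X r (n + 1))).topologicalClosure

/-- The Haar system Hardy space `X₀(𝐫)`. -/
abbrev HardySpaceZero (X : HaarSystemNorm) (r : rademacherFamilies) : Type := hardySubspace X r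

instance (X : HaarSystemNorm) (r : rademacherFamilies) : CompleteSpace (HardySpaceZero X r) :=
  inferInstanceAs (CompleteSpace
    (Submodule.span ℝ (Set.range fun n : ℕ => haarVector X r (n + 1))).topologicalClosure)

/-- The Haar function `h_I ∈ X₀(𝐫)` for the interval `I ∈ 𝒟` with `ι(I) = n + 1`, so that
`n = 0, 1, 2, …` runs through `𝒟` in its linear order. -/
def haarBasisVector (X : HaarSystemNorm) (r : rademacherFamilies) (n : ℕ) : HardySpaceZero X r :=
  ⟨haarVector X r (n + 1),
    Submodule.le_topologicalClosure _ (Submodule.subset_span ⟨n, rfl⟩)⟩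

/-- The Rademacher function `r_n = ∑ h_I` as an element of `X₀(𝐫)`; the sum is over `I ∈ 𝒟` with
`|I| = 2⁻ⁿ`, that is, over `ι(I) = 2^n + i` with `i < 2^n`. -/
def rademacherVector (X : HaarSystemNorm) (r : rademacherFamilies) (n : ℕ) : HardySpaceZero X r :=
  ∑ i ∈ Finset.range (2 ^ n), haarBasisVector X r (2 ^ n - 1 + i)

/-! ### Strategically reproducible bases -/

/-- Two sequences in normed spaces are impartially `C`-equivalent. -/
def ImpartiallyEquivalent {E F : Type*} [NormedAddCommGroup E] [NormedSpace ℝ E]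
    [NormedAddCommGroup F] [NormedSpace ℝ F] (C : ℝ) (x : ℕ → E) (y : ℕ → F) : Prop :=
  ∀ a : ℕ →₀ ℝ,
    1 / √C * ‖a.sum fun j c => c • y j‖ ≤ ‖a.sum fun j c => c • x j‖ ∧
      ‖a.sum fun j c => c • x j‖ ≤ √C * ‖a.sum fun j c => c • y j‖

/-- A move of player (I) in Step 1 of a turn: a number `η_k > 0`, a closed subspace `W_k` of `E` of
finite codimension, and a weak* closed subspace `G_k` of `E*` of finite codimension. -/
structure Opening (E : Type*) [NormedAddCommGroup E] [NormedSpace ℝ E] where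
  tol : ℝ
  tol_pos : 0 < tol
  W : Submodule ℝ E
  W_closed : IsClosed (W : Set E)
  W_cofinite : FiniteDimensional ℝ (E ⧸ W)
  G : Submodule ℝ (StrongDual ℝ E)
  G_closed : IsClosed (WeakDual.toStrongDual ⁻¹' (G : Set (StrongDual ℝ E)))
  G_cofinite : FiniteDimensional ℝ (StrongDual ℝ E ⧸ G)

/-- A move of player (II) in Step 2 of a turn: an index `i_k`, a finite set `E_k`, and families
`λ^k` and `μ^k`, of which only the members with index in `E_k` matter. -/
structure Reply where
  side : Fin 2
  supp : Finset ℕ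
  lam : ℕ → ℝ
  mu : ℕ → ℝ

/-- The rules for a move of player (II), given the partition `N` and the parameter `η`. -/
structure Reply.Legal (m : Reply) (N : Fin 2 → Set ℕ) (η : ℝ) : Prop where
  subset : ↑m.supp ⊆ N m.side
  lam_nonneg : ∀ j ∈ m.supp, 0 ≤ m.lam j
  mu_nonneg : ∀ j ∈ m.supp, 0 ≤ m.mu j
  lower : 1 - η < ∑ j ∈ m.supp, m.lam j * m.mu j
  upper : ∑ j ∈ m.supp, m.lam j * m.mu j < 1 + η

/-- A strategy of player (II): his move in turn `k` as a function of what player (I) has played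
until then, namely the Step 1 moves of the turns `0, …, k` and the signs of the turns
`0, …, k - 1`. The signs are a family indexed by all of `ℕ`; those with index outside the set
chosen by player (II) have no bearing on the result of the game. -/
def Strategy (E : Type*) [NormedAddCommGroup E] [NormedSpace ℝ E] : Type _ :=
  (k : ℕ) → (Fin (k + 1) → Opening E) → (Fin k → ℕ → ℤˣ) → Reply

section Game

variable {E : Type*} [NormedAddCommGroup E] [NormedSpace ℝ E]

/-- The move of player (II) in turn `k` when he follows `σ` and player (I) plays `o` and `ε`. -/
def Strategy.reply (σ : Strategy E) (o : ℕ → Opening E) (ε : ℕ → ℕ → ℤˣ) (k : ℕ) : Reply :=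
  σ k (fun i => o i) (fun i => ε i)

/-- The linear combination `∑_{j ∈ A} ε_j c_j v_j`. -/
def signedSum {F : Type*} [AddCommGroup F] [Module ℝ F] (A : Finset ℕ) (ε : ℕ → ℤˣ) (c : ℕ → ℝ)
    (v : ℕ → F) : F :=
  ∑ j ∈ A, (((ε j : ℤ) : ℝ) * c j) • v j

/-- The vector `x_k` of the play. -/
def Strategy.vec (b : SchauderBasis ℝ E) (σ : Strategy E) (o : ℕ → Opening E) (ε : ℕ → ℕ → ℤˣ)
    (k : ℕ) : E :=
  signedSum (σ.reply o ε k).supp (ε k) (σ.reply o ε k).lam b.basis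

/-- The functional `x_k*` of the play. -/
def Strategy.func (b : SchauderBasis ℝ E) (σ : Strategy E) (o : ℕ → Opening E) (ε : ℕ → ℕ → ℤˣ)
    (k : ℕ) : StrongDual ℝ E :=
  signedSum (σ.reply o ε k).supp (ε k) (σ.reply o ε k).mu b.coord

/-- Player (II), following `σ`, wins the play of the game `Rep_{(E,(e_j))}(C, η)` with partition
`N` in which player (I) plays `o` and `ε`. -/
structure Strategy.Wins (b : SchauderBasis ℝ E) (C η : ℝ) (N : Fin 2 → Set ℕ) (σ : Strategy E)
    (o : ℕ → Opening E) (ε : ℕ → ℕ → ℤˣ) : Prop where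
  legal : ∀ k, (σ.reply o ε k).Legal N η
  equiv_basis : ImpartiallyEquivalent (C + η) (σ.vec b o ε) b.basis
  equiv_coord : ImpartiallyEquivalent (C + η) (σ.func b o ε) b.coord
  dist_W : ∀ k, Metric.infDist (σ.vec b o ε k) ((o k).W : Set E) < (o k).tol
  dist_G : ∀ k, Metric.infDist (σ.func b o ε k) ((o k).G : Set (StrongDual ℝ E)) < (o k).tol

/-- The basis `b` (with its biorthogonal functionals) is `C`-strategically reproducible *with
projectional factors*: for every `η > 0` and every partition of the index set chosen by
player (I), player (II) has a strategy that wins against all plays of player (I) and always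
yields a biorthogonal system `(x_k, x_k*)`. -/
def StrategicallyReproducibleWithProjectionalFactors (b : SchauderBasis ℝ E) (C : ℝ) : Prop :=
  ∀ η : ℝ, 0 < η → ∀ N : Fin 2 → Set ℕ, IsCompl (N 0) (N 1) →
    ∃ σ : Strategy E, ∀ (o : ℕ → Opening E) (ε : ℕ → ℕ → ℤˣ),
      σ.Wins b C η N o ε ∧
        ∀ k l, σ.func b o ε k (σ.vec b o ε l) = if k = l then 1 else 0

end Game

end

/-!
Let `ĥ_k = ∑_{K ∈ B k} ε_K h_K` be blocks of the Haar system with the tree structure of the Haar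
system: the intervals of a block are disjoint, and the support of `ĥ_k` lies in the set where the
block of the parent of `k` has the sign that the parent Haar function has on `I_k`. The blocks need
not fill this set. The kernel `∑_k ĥ_k(s) h_k(t) / |I_k|` is then non-negative with marginals `1`
(`IsHaarBlockSystem.blockMatrix_mem_doublyStochastic`), so by Birkhoff's theorem both the operator
`h_k ↦ ĥ_k` and its `L²`-adjoint are averages of rearrangements. As the Rademacher functions are
exchangeable, the two operators are contractions for the norm of `X(𝐫)` as well
(`IsHaarBlockSystem.hardyNorm_blockMap_le`, `IsHaarBlockSystem.hardyNorm_blockAdjoint_le`).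
The case in which the blocks are the first Haar functions shows that the Haar system is a monotone
basis.

Player (II) chooses the blocks by the method of Gamlen and Gaudet. One of the two sets `N 0`, `N 1`
covers a set `A` of measure at least `1 / 2` infinitely often, and inside a dyadic set that meets
`A` one finds arbitrarily fine disjoint intervals from this collection with a prescribed total
length (`exists_isDisjointFamily_of_limsupSet`). The total length of block number `k` is kept in
`(q (k + 1) |I_k|, q k |I_k|]`, where `q` decreases strictly from below `1 / 2` to a limit `p` close
to `1 / 2`; this leaves room for the successors, whatever the signs are.

The distance conditions involve finitely many functionals and vectors only
(`exists_finset_infDist_lt`, `exists_finset_infDist_lt_of_weakStar_closed`). For a vector, the dual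
sums over fine families tend to zero because they are bounded and vanish on finite combinations
of Haar functions (`eventually_abs_sum_coord_lt`). For a functional, suppose that it is large on
fine families of disjoint intervals; then one can complete such families to finer and finer
partitions, and glue these to a block system whose operator maps the Rademacher functions to the
corresponding sums, which contradicts that the Rademacher functions are weakly null
(`eventually_sum_abs_lt`).

Finally, let `U` be the block operator, and let `P` be the adjoint block operator followed by the
multiplier with the entries `m_k = |I_k| / ∑_{K ∈ B k} |K|`, scaled by `√(2 + η)` and by its
inverse respectively. Then `P U` is the identity, `x_k = U e_k` and `x_k* = e_k* ∘ P`. Because `m` increases from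
above `2` to at most `1 / p = 2 + η / 2`, the multiplier has norm at most `2 / p - 2 = 2 + η` on a
monotone basis (`norm_linearCombination_multiplier_le`), so that `U` and `P` both have norm at most
`√(2 + η)`. This gives the equivalence with constant `2 + η` for vectors and functionals, and the
biorthogonality.
-/

noncomputable section

/-! ### The Haar system as a binary tree -/

/-- The number `ι(I) = 2^j + i` of the dyadic interval `I` of length `2⁻ʲ` that contains `s`. -/
def dyadicNode (j : ℕ) (s : ℝ) : ℕ := 2 ^ j + ⌊(2 : ℝ) ^ j * s⌋₊

/-- The length of the dyadic interval with number `n`, and `1` for `n = 0`. -/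
def haarLength (n : ℕ) : ℝ := (2 ^ Nat.log 2 n)⁻¹

/-- The value of `h_J` on `I`, where `I` has number `n` and `J` is the dyadic interval of which `I`
is a half, so that `J` has number `n / 2`; for `n = 1` the function `h_J` is `h_∅ = χ_[0,1)`. -/
def childSign (n : ℕ) : ℝ := if n % 2 = 0 ∨ n = 1 then 1 else -1

theorem haarLength_pos (n : ℕ) : 0 < haarLength n := by unfold haarLength; positivity

@[simp] theorem haarLength_zero : haarLength 0 = 1 := by simp [haarLength]

@[simp] theorem haarLength_one : haarLength 1 = 1 := by simp [haarLength]

theorem log_div_two {n : ℕ} (hn : 2 ≤ n) : Nat.log 2 n = Nat.log 2 (n / 2) + 1 := by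
  rw [Nat.log_of_one_lt_of_le (by norm_num) hn]

theorem haarLength_div_two {n : ℕ} (hn : 2 ≤ n) : haarLength n = haarLength (n / 2) / 2 := by
  rw [haarLength, haarLength, log_div_two hn, pow_succ, mul_inv, div_eq_mul_inv]

theorem childSign_mul_self (n : ℕ) : childSign n * childSign n = 1 := by
  unfold childSign; split_ifs <;> norm_num

theorem childSign_ne_zero (n : ℕ) : childSign n ≠ 0 := by
  unfold childSign; split_ifs <;> norm_num

theorem dyadicNode_zero {s : ℝ} (hs : s ∈ Set.Ico (0 : ℝ) 1) : dyadicNode 0 s = 1 := by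
  simp [dyadicNode, hs.2]

theorem dyadicNode_succ_div_two (j : ℕ) (s : ℝ) : dyadicNode (j + 1) s / 2 = dyadicNode j s := by
  have : ⌊(2 : ℝ) ^ (j + 1) * s⌋₊ / 2 = ⌊(2 : ℝ) ^ j * s⌋₊ := by
    rw [← Nat.floor_div_ofNat]
    congr 1
    rw [pow_succ, mul_right_comm]
    exact mul_div_cancel_right₀ _ (by norm_num)
  unfold dyadicNode
  rw [← this, pow_succ]
  omega

theorem le_dyadicNode (j : ℕ) (s : ℝ) : 2 ^ j ≤ dyadicNode j s := Nat.le_add_right _ _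

theorem dyadicNode_pos (j : ℕ) (s : ℝ) : 0 < dyadicNode j s :=
  lt_of_lt_of_le (by positivity) (le_dyadicNode j s)

theorem floor_pow_mul_lt (j : ℕ) {s : ℝ} (hs : s ∈ Set.Ico (0 : ℝ) 1) :
    ⌊(2 : ℝ) ^ j * s⌋₊ < 2 ^ j := by
  have h2 : (0 : ℝ) < 2 ^ j := by positivity
  rw [Nat.floor_lt (mul_nonneg h2.le hs.1)]
  push_cast
  nlinarith [hs.2]

theorem dyadicNode_lt (j : ℕ) {s : ℝ} (hs : s ∈ Set.Ico (0 : ℝ) 1) :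
    dyadicNode j s < 2 ^ (j + 1) := by
  have := floor_pow_mul_lt j hs
  unfold dyadicNode
  rw [pow_succ]
  omega

theorem log_dyadicNode (j : ℕ) {s : ℝ} (hs : s ∈ Set.Ico (0 : ℝ) 1) :
    Nat.log 2 (dyadicNode j s) = j :=
  Nat.log_eq_of_pow_le_of_lt_pow (le_dyadicNode j s) (dyadicNode_lt j hs)

theorem dyadicNode_mono (s : ℝ) : Monotone fun j => dyadicNode j s :=
  monotone_nat_of_le_succ fun j => by
    have := dyadicNode_succ_div_two j s
    omega

theorem dyadicIndicator_apply {j i : ℕ} {s : ℝ} (hs : s ∈ Set.Ico (0 : ℝ) 1) :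
    dyadicIndicator j i s = if dyadicNode j s = 2 ^ j + i then 1 else 0 := by
  classical
  rw [dyadicIndicator, Set.indicator_apply]
  exact if_congr ((mem_dyadicInterval_iff hs.1).trans Nat.add_left_cancel_iff.symm) rfl rfl

theorem haarSystem_zero_apply {s : ℝ} (hs : s ∈ Set.Ico (0 : ℝ) 1) : haarSystem 0 s = 1 := by
  rw [haarSystem, if_pos rfl, dyadicIndicator_apply hs, dyadicNode_zero hs]
  simp

theorem haarSystem_of_notMem (n : ℕ) {s : ℝ} (hs : s ∉ Set.Ico (0 : ℝ) 1) :
    haarSystem n s = 0 := by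
  obtain ⟨m, hm⟩ := mem_dyadicStep_iff.1 (haarSystem_mem n)
  exact hm.1 s hs

theorem haarSystem_apply {n : ℕ} (hn : 1 ≤ n) {s : ℝ} (hs : s ∈ Set.Ico (0 : ℝ) 1) :
    haarSystem n s = (if dyadicNode (Nat.log 2 n + 1) s = 2 * n then 1 else 0) -
      if dyadicNode (Nat.log 2 n + 1) s = 2 * n + 1 then 1 else 0 := by
  have h1 : 2 ^ Nat.log 2 n ≤ n := Nat.pow_log_le_self 2 (by omega)
  rw [haarSystem, if_neg (by omega), haarFunction, Pi.sub_apply, dyadicIndicator_apply hs,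
    dyadicIndicator_apply hs]
  have e1 : 2 ^ (Nat.log 2 n + 1) + 2 * (n - 2 ^ Nat.log 2 n) = 2 * n := by
    rw [pow_succ]; omega
  rw [← add_assoc, e1]

theorem haarSystem_trichotomy (n : ℕ) (s : ℝ) :
    haarSystem n s = 0 ∨ haarSystem n s = 1 ∨ haarSystem n s = -1 := by
  by_cases hs : s ∈ Set.Ico (0 : ℝ) 1
  · rcases Nat.eq_zero_or_pos n with rfl | hn
    · simp [haarSystem_zero_apply hs]
    · rw [haarSystem_apply hn hs]
      split_ifs
      · omega
      all_goals simp
  · simp [haarSystem_of_notMem n hs]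

theorem mem_Ico_of_haarSystem_ne_zero {n : ℕ} {s : ℝ} (h : haarSystem n s ≠ 0) :
    s ∈ Set.Ico (0 : ℝ) 1 := by
  by_contra hs
  exact h (haarSystem_of_notMem n hs)

theorem haarSystem_mul_self_of_ne_zero {n : ℕ} {s : ℝ} (h : haarSystem n s ≠ 0) :
    haarSystem n s * haarSystem n s = 1 := by
  rcases haarSystem_trichotomy n s with h' | h' | h'
  · exact absurd h' h
  all_goals rw [h']; norm_num

theorem haarSystem_ne_zero_iff {n : ℕ} (hn : 1 ≤ n) {s : ℝ} (hs : s ∈ Set.Ico (0 : ℝ) 1) :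
    haarSystem n s ≠ 0 ↔ dyadicNode (Nat.log 2 n) s = n := by
  have h := dyadicNode_succ_div_two (Nat.log 2 n) s
  rw [haarSystem_apply hn hs]
  split_ifs <;> simp <;> omega

/-- A Haar function has on each half of its support the sign recorded by `childSign`. -/
theorem haarSystem_div_two {n : ℕ} (hn : 1 ≤ n) {s : ℝ} (h : haarSystem n s ≠ 0) :
    haarSystem (n / 2) s = childSign n := by
  have hs := mem_Ico_of_haarSystem_ne_zero h
  rw [haarSystem_ne_zero_iff hn hs] at h
  rcases Nat.lt_or_ge n 2 with h2 | h2
  · obtain rfl : n = 1 := by omega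
    simp [haarSystem_zero_apply hs, childSign]
  · rw [haarSystem_apply (by omega) hs, ← log_div_two h2, h, childSign]
    rcases Nat.mod_two_eq_zero_or_one n with hm | hm
    · rw [if_pos (by omega), if_neg (by omega), if_pos (by omega), sub_zero]
    · rw [if_neg (by omega), if_pos (by omega), if_neg (by omega), zero_sub]

/-- If the supports of two Haar functions meet, then the coarser one is an ancestor of the finer. -/
theorem le_div_two_of_haarSystem_ne_zero {k n : ℕ} (hkn : k < n) {s : ℝ}
    (hk : haarSystem k s ≠ 0) (hn : haarSystem n s ≠ 0) : k ≤ n / 2 := by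
  have hs := mem_Ico_of_haarSystem_ne_zero hk
  rcases Nat.eq_zero_or_pos k with rfl | hk0
  · omega
  rw [haarSystem_ne_zero_iff (by omega) hs] at hk hn
  have hlog : Nat.log 2 k < Nat.log 2 n := by
    by_contra hc
    have : Nat.log 2 k = Nat.log 2 n := le_antisymm (Nat.log_mono_right hkn.le) (by omega)
    rw [this] at hk
    omega
  obtain ⟨j, hj⟩ : ∃ j, Nat.log 2 n = j + 1 := ⟨Nat.log 2 n - 1, by omega⟩
  rw [hj] at hn
  have h1 := dyadicNode_succ_div_two j s
  have h2 : dyadicNode (Nat.log 2 k) s ≤ dyadicNode j s := dyadicNode_mono s (by omega)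
  omega

theorem haarSystem_eq_of_dyadicNode_eq {L n : ℕ} (hn : n < 2 ^ L) {s t : ℝ}
    (hs : s ∈ Set.Ico (0 : ℝ) 1) (ht : t ∈ Set.Ico (0 : ℝ) 1)
    (h : ⌊(2 : ℝ) ^ L * s⌋₊ = ⌊(2 : ℝ) ^ L * t⌋₊) : haarSystem n s = haarSystem n t := by
  have key : ∀ d j, j + d = L → dyadicNode j s = dyadicNode j t := by
    intro d
    induction d with
    | zero => rintro j rfl; rw [add_zero] at h; rw [dyadicNode, dyadicNode, h]
    | succ d ih =>
      intro j hj
      rw [← dyadicNode_succ_div_two j s, ← dyadicNode_succ_div_two j t, ih (j + 1) (by omega)]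
  rcases Nat.eq_zero_or_pos n with rfl | h0
  · rw [haarSystem_zero_apply hs, haarSystem_zero_apply ht]
  · have hl : Nat.log 2 n < L := (Nat.log_lt_iff_lt_pow (by norm_num) (by omega)).2 hn
    rw [haarSystem_apply h0 hs, haarSystem_apply h0 ht,
      key (L - (Nat.log 2 n + 1)) _ (by omega)]

theorem isStepOfLevel_haarSystem {L n : ℕ} (hn : n < 2 ^ L) : IsStepOfLevel L (haarSystem n) :=
  ⟨fun _ hs => haarSystem_of_notMem n hs, fun _ hs _ ht h => haarSystem_eq_of_dyadicNode_eq hn hs ht h⟩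

/-- The left end point of the `i`-th dyadic interval of length `2⁻ᴸ`. -/
def dyadicPoint (L : ℕ) (i : Fin (2 ^ L)) : ℝ := (i : ℕ) / 2 ^ L

theorem dyadicPoint_mem (L : ℕ) (i : Fin (2 ^ L)) : dyadicPoint L i ∈ Set.Ico (0 : ℝ) 1 := by
  have h2 : (0 : ℝ) < 2 ^ L := by positivity
  refine ⟨by unfold dyadicPoint; positivity, ?_⟩
  rw [dyadicPoint, div_lt_one h2]
  exact_mod_cast i.2

theorem floor_dyadicPoint (L : ℕ) (i : Fin (2 ^ L)) :
    ⌊(2 : ℝ) ^ L * dyadicPoint L i⌋₊ = i := by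
  rw [dyadicPoint, mul_div_cancel₀ _ (by positivity), Nat.floor_natCast]

theorem dyadicNode_dyadicPoint {L j : ℕ} (hj : j ≤ L) (i : Fin (2 ^ L)) :
    dyadicNode j (dyadicPoint L i) = (2 ^ L + i) / 2 ^ (L - j) := by
  have key : ∀ d j, j + d = L → dyadicNode j (dyadicPoint L i) = (2 ^ L + i) / 2 ^ d := by
    intro d
    induction d with
    | zero => rintro j rfl; rw [dyadicNode, add_zero] at *; simp [floor_dyadicPoint]
    | succ d ih =>
      intro j hj
      rw [← dyadicNode_succ_div_two j, ih (j + 1) (by omega), Nat.div_div_eq_div_mul, pow_succ]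
  exact key _ _ (by omega)

theorem card_dyadicNode_eq {L j m : ℕ} (hj : j ≤ L) (h1 : 2 ^ j ≤ m) (h2 : m < 2 ^ (j + 1)) :
    (Finset.univ.filter fun i => dyadicNode j (dyadicPoint L i) = m).card = 2 ^ (L - j) := by
  have hL : 2 ^ L = 2 ^ j * 2 ^ (L - j) := by rw [← pow_add]; congr 1; omega
  have hd : 0 < 2 ^ (L - j) := by positivity
  rw [← Finset.card_map Fin.valEmbedding]
  have : (Finset.univ.filter fun i => dyadicNode j (dyadicPoint L i) = m).map Fin.valEmbedding
      = Finset.Ico ((m - 2 ^ j) * 2 ^ (L - j)) ((m - 2 ^ j) * 2 ^ (L - j) + 2 ^ (L - j)) := by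
    ext i
    simp only [Finset.mem_map, Finset.mem_filter, Finset.mem_univ, true_and,
      Fin.valEmbedding_apply, Finset.mem_Ico]
    obtain ⟨c, rfl⟩ := Nat.exists_eq_add_of_le h1
    have hc : c + 1 ≤ 2 ^ j := by rw [pow_succ] at h2; omega
    have hc' : (c + 1) * 2 ^ (L - j) ≤ 2 ^ L := by rw [hL]; exact Nat.mul_le_mul_right _ hc
    rw [add_one_mul] at hc'
    rw [Nat.add_sub_cancel_left]
    have hiff : ∀ i, (2 ^ L + i) / 2 ^ (L - j) = 2 ^ j + c ↔
        c * 2 ^ (L - j) ≤ i ∧ i < c * 2 ^ (L - j) + 2 ^ (L - j) := by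
      intro i
      rw [Nat.div_eq_iff hd, hL, add_mul]
      omega
    constructor
    · rintro ⟨x, hx, rfl⟩
      rw [dyadicNode_dyadicPoint hj, hiff] at hx
      exact hx
    · intro hi
      refine ⟨⟨i, by omega⟩, ?_, rfl⟩
      rw [dyadicNode_dyadicPoint hj, hiff]
      exact hi
  rw [this, Nat.card_Ico]
  omega

theorem log_lt_of_lt_two_pow {L n : ℕ} (h0 : 1 ≤ n) (hn : n < 2 ^ L) : Nat.log 2 n < L :=
  (Nat.log_lt_iff_lt_pow (by norm_num) (by omega)).2 hn

theorem sum_haarSystem {L n : ℕ} (h0 : 1 ≤ n) (hn : n < 2 ^ L) :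
    ∑ i, haarSystem n (dyadicPoint L i) = 0 := by
  have hl := log_lt_of_lt_two_pow h0 hn
  have h1 : 2 ^ Nat.log 2 n ≤ n := Nat.pow_log_le_self 2 (by omega)
  have h2 : n < 2 ^ (Nat.log 2 n + 1) := Nat.lt_pow_succ_log_self (by norm_num) n
  simp only [haarSystem_apply h0 (dyadicPoint_mem L _), Finset.sum_sub_distrib, Finset.sum_boole]
  rw [card_dyadicNode_eq (by omega) (by rw [pow_succ]; omega) (by rw [pow_succ]; omega),
    card_dyadicNode_eq (by omega) (by rw [pow_succ]; omega) (by rw [pow_succ]; omega), sub_self]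

theorem sum_haarSystem_mul_self {L n : ℕ} (hn : n < 2 ^ L) :
    ∑ i, haarSystem n (dyadicPoint L i) * haarSystem n (dyadicPoint L i)
      = 2 ^ L * haarLength n := by
  rcases Nat.eq_zero_or_pos n with rfl | h0
  · simp [haarSystem_zero_apply (dyadicPoint_mem L _)]
  have hl := log_lt_of_lt_two_pow h0 hn
  have h1 : 2 ^ Nat.log 2 n ≤ n := Nat.pow_log_le_self 2 (by omega)
  have h2 : n < 2 ^ (Nat.log 2 n + 1) := Nat.lt_pow_succ_log_self (by norm_num) n
  have : ∀ i, haarSystem n (dyadicPoint L i) * haarSystem n (dyadicPoint L i)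
      = if dyadicNode (Nat.log 2 n) (dyadicPoint L i) = n then 1 else 0 := by
    intro i
    have := haarSystem_ne_zero_iff h0 (dyadicPoint_mem L i)
    split_ifs with h
    · exact haarSystem_mul_self_of_ne_zero (this.2 h)
    · rw [not_not.1 (fun hh => h (this.1 hh)), mul_zero]
  simp only [this, Finset.sum_boole]
  rw [card_dyadicNode_eq hl.le h1 h2, haarLength]
  push_cast
  rw [pow_sub₀ _ (by norm_num) hl.le]

/-- Coarser Haar functions, and those of other branches, are constant on the support of a Haar
function. -/
theorem haarSystem_eq_of_lt {k n : ℕ} (hkn : k < n) {s t : ℝ}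
    (hs : haarSystem n s ≠ 0) (ht : haarSystem n t ≠ 0) : haarSystem k s = haarSystem k t := by
  have hs' := mem_Ico_of_haarSystem_ne_zero hs
  have ht' := mem_Ico_of_haarSystem_ne_zero ht
  induction n using Nat.strong_induction_on with
  | _ n ih =>
    have h1 := haarSystem_div_two (by omega) hs
    have h2 := haarSystem_div_two (by omega) ht
    by_cases hk : k = n / 2
    · rw [hk, h1, h2]
    · by_cases hlt : k < n / 2
      · exact ih (n / 2) (by omega) hlt (by rw [h1]; exact childSign_ne_zero n)
          (by rw [h2]; exact childSign_ne_zero n)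
      · have a1 : haarSystem k s = 0 := by
          by_contra hc
          have := le_div_two_of_haarSystem_ne_zero hkn hc hs
          omega
        have a2 : haarSystem k t = 0 := by
          by_contra hc
          have := le_div_two_of_haarSystem_ne_zero hkn hc ht
          omega
        rw [a1, a2]

theorem sum_haarSystem_mul {L k n : ℕ} (hk : k < 2 ^ L) (hn : n < 2 ^ L) :
    ∑ i, haarSystem k (dyadicPoint L i) * haarSystem n (dyadicPoint L i)
      = if k = n then 2 ^ L * haarLength n else 0 := by
  split_ifs with hkn
  · rw [hkn, sum_haarSystem_mul_self hn]
  have key : ∀ k n, n < 2 ^ L → k < n →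
      ∑ i, haarSystem k (dyadicPoint L i) * haarSystem n (dyadicPoint L i) = 0 := by
    intro k n hn hkn
    by_cases hex : ∃ i, haarSystem n (dyadicPoint L i) ≠ 0
    · obtain ⟨i₀, hi₀⟩ := hex
      have : ∀ i, haarSystem k (dyadicPoint L i) * haarSystem n (dyadicPoint L i) =
          haarSystem k (dyadicPoint L i₀) * haarSystem n (dyadicPoint L i) := by
        intro i
        by_cases hi : haarSystem n (dyadicPoint L i) = 0
        · rw [hi, mul_zero, mul_zero]
        · rw [haarSystem_eq_of_lt hkn hi hi₀]
      simp only [this]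
      rw [← Finset.mul_sum, sum_haarSystem (by omega) hn, mul_zero]
    · push Not at hex
      simp [hex]
  rcases Nat.lt_or_gt_of_ne hkn with h | h
  · exact key k n hn h
  · simp only [mul_comm (haarSystem k _)]
    exact key n k hk h

/-! ### Block systems and their kernels -/

/-- The function `∑_{K ∈ B k} ε k K • h_K`. -/
def blockFunction (B : ℕ → Finset ℕ) (ε : ℕ → ℕ → ℝ) (k : ℕ) (s : ℝ) : ℝ :=
  ∑ K ∈ B k, ε k K * haarSystem K s

/-- The tree structure of the Haar system, without the requirement that the blocks
`∑_{K ∈ B k} ε k K • h_K` have full support: block number `0` is `h_∅`, the intervals of each block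
are disjoint, different blocks have no interval in common, and on the support of block number
`k ≥ 1` the block number `k / 2` has the constant value `childSign k`, as is the case for the Haar
system itself. Empty blocks are allowed. -/
structure IsHaarBlockSystem (B : ℕ → Finset ℕ) (ε : ℕ → ℕ → ℝ) : Prop where
  zero_block : B 0 = {0}
  zero_sign : ε 0 0 = 1
  abs_sign : ∀ k, ∀ K ∈ B k, |ε k K| = 1
  disjoint : ∀ k, ∀ K ∈ B k, ∀ K' ∈ B k, ∀ s, haarSystem K s ≠ 0 → haarSystem K' s ≠ 0 → K = K'
  injective : ∀ k l K, K ∈ B k → K ∈ B l → k = l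
  nested : ∀ k, 1 ≤ k → ∀ K ∈ B k, ∀ s, haarSystem K s ≠ 0 →
    blockFunction B ε (k / 2) s = childSign k

namespace IsHaarBlockSystem

variable {B : ℕ → Finset ℕ} {ε : ℕ → ℕ → ℝ}

theorem sign_mul_self (h : IsHaarBlockSystem B ε) {k K : ℕ} (hK : K ∈ B k) :
    ε k K * ε k K = 1 := by
  rw [← abs_mul_abs_self, h.abs_sign k K hK, one_mul]

theorem blockFunction_eq (h : IsHaarBlockSystem B ε) {k K : ℕ} (hK : K ∈ B k) {s : ℝ}
    (hs : haarSystem K s ≠ 0) : blockFunction B ε k s = ε k K * haarSystem K s := by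
  refine Finset.sum_eq_single_of_mem K hK fun K' hK' hne => ?_
  by_contra hc
  exact hne (h.disjoint k K' hK' K hK s (right_ne_zero_of_mul hc) hs)

theorem exists_of_blockFunction_ne_zero {k : ℕ} {s : ℝ} (hs : blockFunction B ε k s ≠ 0) :
    ∃ K ∈ B k, haarSystem K s ≠ 0 := by
  obtain ⟨K, hK, hne⟩ := Finset.exists_ne_zero_of_sum_ne_zero hs
  exact ⟨K, hK, right_ne_zero_of_mul hne⟩

theorem blockFunction_div_two (h : IsHaarBlockSystem B ε) {k : ℕ} (hk : 1 ≤ k) {s : ℝ}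
    (hs : blockFunction B ε k s ≠ 0) : blockFunction B ε (k / 2) s = childSign k := by
  obtain ⟨K, hK, hne⟩ := exists_of_blockFunction_ne_zero hs
  exact h.nested k hk K hK s hne

theorem abs_blockFunction_le (h : IsHaarBlockSystem B ε) (k : ℕ) (s : ℝ) :
    |blockFunction B ε k s| ≤ 1 := by
  by_cases hs : blockFunction B ε k s = 0
  · rw [hs]; norm_num
  · obtain ⟨K, hK, hne⟩ := exists_of_blockFunction_ne_zero hs
    rw [h.blockFunction_eq hK hne, abs_mul, h.abs_sign k K hK, one_mul]
    rcases haarSystem_trichotomy K s with h | h | h <;> simp [h]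

theorem blockFunction_zero (h : IsHaarBlockSystem B ε) (s : ℝ) :
    blockFunction B ε 0 s = haarSystem 0 s := by
  simp [blockFunction, h.zero_block, h.zero_sign]

theorem one_le_of_mem (h : IsHaarBlockSystem B ε) {k K : ℕ} (hk : 1 ≤ k) (hK : K ∈ B k) :
    1 ≤ K := by
  by_contra hc
  have : K ∈ B 0 := by rw [h.zero_block]; simp; omega
  have := h.injective k 0 K hK this
  omega

/-- Only the blocks on the branches that run through both `s` and `t` contribute to the kernel
`∑_k ĥ_k(s) h_k(t) / |I_k|`, so that its partial sums double along a branch until the signs differ,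
when the sum drops to zero. -/
theorem kernel_eq (h : IsHaarBlockSystem B ε) {s t : ℝ} (n : ℕ) (hn : 1 ≤ n)
    (hs : blockFunction B ε n s ≠ 0) (ht : haarSystem n t ≠ 0) :
    ∑ k ∈ Finset.range n, blockFunction B ε k s * haarSystem k t / haarLength k
      = 1 / haarLength n := by
  induction n using Nat.strong_induction_on with
  | _ n ih =>
    have hps := h.blockFunction_div_two hn hs
    have hpt := haarSystem_div_two hn ht
    rcases Nat.lt_or_ge n 2 with h2 | h2
    · obtain rfl : n = 1 := by omega
      have e : childSign 1 = 1 := by simp [childSign]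
      simp only [Nat.reduceDiv, e] at hps hpt
      simp [hps, hpt]
    · have hsub : Finset.range (n / 2 + 1) ⊆ Finset.range n :=
        Finset.range_subset_range.2 (by omega)
      rw [← Finset.sum_subset hsub, Finset.sum_range_succ,
        ih (n / 2) (by omega) (by omega) (by rw [hps]; exact childSign_ne_zero n)
          (by rw [hpt]; exact childSign_ne_zero n), hps, hpt, childSign_mul_self,
        haarLength_div_two h2]
      · field_simp
        norm_num
      · intro k hk hk'
        have : haarSystem k t = 0 := by
          by_contra hc
          have := le_div_two_of_haarSystem_ne_zero (Finset.mem_range.1 hk) hc ht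
          exact hk' (Finset.mem_range.2 (by omega))
        rw [this, mul_zero, zero_div]

theorem kernel_nonneg (h : IsHaarBlockSystem B ε) (s t : ℝ) (n : ℕ) :
    0 ≤ ∑ k ∈ Finset.range n, blockFunction B ε k s * haarSystem k t / haarLength k := by
  induction n with
  | zero => simp
  | succ n ih =>
    by_cases h0 : blockFunction B ε n s = 0 ∨ haarSystem n t = 0
    · rw [Finset.sum_range_succ]
      rcases h0 with h0 | h0 <;> simpa [h0] using ih
    · push Not at h0
      have hl := haarLength_pos n
      rcases Nat.eq_zero_or_pos n with rfl | hn
      · rw [Finset.sum_range_succ, h.blockFunction_zero] at *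
        simp only [Finset.range_zero, Finset.sum_empty, haarLength_zero]
        rw [haarSystem_zero_apply (mem_Ico_of_haarSystem_ne_zero h0.1),
          haarSystem_zero_apply (mem_Ico_of_haarSystem_ne_zero h0.2)]
        norm_num
      · rw [Finset.sum_range_succ, h.kernel_eq n hn h0.1 h0.2, ← add_div]
        refine div_nonneg ?_ hl.le
        have h1 := abs_le.1 (h.abs_blockFunction_le n s)
        rcases haarSystem_trichotomy n t with h2 | h2 | h2 <;> rw [h2] <;> linarith

end IsHaarBlockSystem

/-- The matrix, on the dyadic points of level `L`, of the operator that maps `h_k` to block number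
`k` and annihilates all finer functions. -/
def blockMatrix (B : ℕ → Finset ℕ) (ε : ℕ → ℕ → ℝ) (L : ℕ) :
    Matrix (Fin (2 ^ L)) (Fin (2 ^ L)) ℝ := fun i j =>
  (∑ k ∈ Finset.range (2 ^ L), blockFunction B ε k (dyadicPoint L i) *
    haarSystem k (dyadicPoint L j) / haarLength k) / 2 ^ L

namespace IsHaarBlockSystem

variable {B : ℕ → Finset ℕ} {ε : ℕ → ℕ → ℝ}

theorem sum_blockFunction_mul {L : ℕ}
    (hL : ∀ k, ∀ K ∈ B k, K < 2 ^ L) (k : ℕ) {n : ℕ} (hn : n < 2 ^ L) :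
    ∑ i, blockFunction B ε k (dyadicPoint L i) * haarSystem n (dyadicPoint L i)
      = if n ∈ B k then ε k n * (2 ^ L * haarLength n) else 0 := by
  simp only [blockFunction, Finset.sum_mul]
  rw [Finset.sum_comm]
  simp only [mul_assoc, ← Finset.mul_sum]
  rw [Finset.sum_congr rfl fun K hK => by rw [sum_haarSystem_mul (hL k K hK) hn]]
  simp only [mul_ite, mul_zero]
  rw [Finset.sum_ite_eq']

theorem blockMatrix_mulVec (L : ℕ) {n : ℕ} (hn : n < 2 ^ L) (i : Fin (2 ^ L)) :
    ∑ j, blockMatrix B ε L i j * haarSystem n (dyadicPoint L j)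
      = blockFunction B ε n (dyadicPoint L i) := by
  have h2 : (2 : ℝ) ^ L ≠ 0 := by positivity
  have hl := (haarLength_pos n).ne'
  simp only [blockMatrix, Finset.sum_div, Finset.sum_mul]
  rw [Finset.sum_comm]
  have : ∀ k ∈ Finset.range (2 ^ L), ∑ j, blockFunction B ε k (dyadicPoint L i) *
      haarSystem k (dyadicPoint L j) / haarLength k / 2 ^ L * haarSystem n (dyadicPoint L j)
      = if k = n then blockFunction B ε n (dyadicPoint L i) else 0 := by
    intro k hk
    have e : ∀ j, blockFunction B ε k (dyadicPoint L i) *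
      haarSystem k (dyadicPoint L j) / haarLength k / 2 ^ L * haarSystem n (dyadicPoint L j)
      = blockFunction B ε k (dyadicPoint L i) / haarLength k / 2 ^ L *
        (haarSystem k (dyadicPoint L j) * haarSystem n (dyadicPoint L j)) := fun j => by ring
    simp only [e]
    rw [← Finset.mul_sum, sum_haarSystem_mul (Finset.mem_range.1 hk) hn]
    split_ifs with hkn
    · rw [hkn]; field_simp
    · rw [mul_zero]
  rw [Finset.sum_congr rfl this, Finset.sum_ite_eq', if_pos (Finset.mem_range.2 hn)]

theorem blockMatrix_transpose_mulVec {L : ℕ}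
    (hL : ∀ k, ∀ K ∈ B k, K < 2 ^ L) {n : ℕ} (hn : n < 2 ^ L) (j : Fin (2 ^ L)) :
    ∑ i, blockMatrix B ε L i j * haarSystem n (dyadicPoint L i)
      = ∑ k ∈ Finset.range (2 ^ L), if n ∈ B k then
          ε k n * haarLength n / haarLength k * haarSystem k (dyadicPoint L j) else 0 := by
  have h2 : (2 : ℝ) ^ L ≠ 0 := by positivity
  simp only [blockMatrix, Finset.sum_div, Finset.sum_mul]
  rw [Finset.sum_comm]
  refine Finset.sum_congr rfl fun k _ => ?_
  have hl := (haarLength_pos k).ne'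
  have e : ∀ i, blockFunction B ε k (dyadicPoint L i) *
      haarSystem k (dyadicPoint L j) / haarLength k / 2 ^ L * haarSystem n (dyadicPoint L i)
      = haarSystem k (dyadicPoint L j) / haarLength k / 2 ^ L *
        (blockFunction B ε k (dyadicPoint L i) * haarSystem n (dyadicPoint L i)) :=
    fun i => by ring
  simp only [e]
  rw [← Finset.mul_sum, sum_blockFunction_mul hL k hn]
  split_ifs
  · field_simp
  · rw [mul_zero]

/-- Row and column sums are `1` since all blocks but `h_∅` have mean zero. -/
theorem blockMatrix_mem_doublyStochastic (h : IsHaarBlockSystem B ε) {L : ℕ}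
    (hL : ∀ k, ∀ K ∈ B k, K < 2 ^ L) : blockMatrix B ε L ∈ doublyStochastic ℝ (Fin (2 ^ L)) := by
  have h0 : 0 < 2 ^ L := by positivity
  have hone : ∀ i, haarSystem 0 (dyadicPoint L i) = 1 :=
    fun i => haarSystem_zero_apply (dyadicPoint_mem L i)
  rw [mem_doublyStochastic_iff_sum]
  refine ⟨fun i j => div_nonneg (h.kernel_nonneg _ _ _) (by positivity), fun i => ?_, fun j => ?_⟩
  · have := blockMatrix_mulVec (B := B) (ε := ε) L h0 i
    simp only [hone, mul_one] at this
    rw [this, h.blockFunction_zero, hone]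
  · have := blockMatrix_transpose_mulVec (ε := ε) hL h0 j
    simp only [hone, mul_one] at this
    rw [this, Finset.sum_eq_single_of_mem 0 (Finset.mem_range.2 h0)]
    · rw [if_pos (by rw [h.zero_block]; simp), h.zero_sign, hone]
      simp
    · intro k _ hk
      rw [if_neg]
      intro hc
      exact hk (h.injective k 0 0 hc (by rw [h.zero_block]; simp))

/-- Omitting all blocks from some number on leaves a block system. -/
theorem truncate (h : IsHaarBlockSystem B ε) {n : ℕ} (hn : 1 ≤ n) :
    IsHaarBlockSystem (fun k => if k < n then B k else ∅) ε where
  zero_block := by rw [if_pos (by omega), h.zero_block]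
  zero_sign := h.zero_sign
  abs_sign k K hK := by
    split_ifs at hK
    · exact h.abs_sign k K hK
    · simp at hK
  disjoint k K hK K' hK' := by
    split_ifs at hK hK'
    · exact h.disjoint k K hK K' hK'
    · simp at hK
  injective k l K hK hK' := by
    split_ifs at hK hK'
    · exact h.injective k l K hK hK'
    · simp at hK'
    · simp at hK
    · simp at hK
  nested k hk K hK s hs := by
    split_ifs at hK with hkn
    · have : k / 2 < n := by omega
      rw [← h.nested k hk K hK s hs]
      simp only [blockFunction, this, if_true]
    · simp at hK

end IsHaarBlockSystem

/-! ### Haar system norms and doubly stochastic matrices -/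

/-- The function with value `v i` on the `i`-th dyadic interval of length `2⁻ᴸ`. -/
def stepFunction (L : ℕ) : (Fin (2 ^ L) → ℝ) →ₗ[ℝ] dyadicStep where
  toFun v := ⟨fun s => ∑ i, v i * dyadicIndicator L i s, by
    have : (fun s => ∑ i, v i * dyadicIndicator L i s) = ∑ i, v i • dyadicIndicator L i := by
      ext s; simp
    rw [this]
    exact Submodule.sum_mem _ fun i _ => Submodule.smul_mem _ _
      (Submodule.subset_span ⟨L, i, i.2, rfl⟩)⟩
  map_add' v w := by
    ext s
    simp [add_mul, Finset.sum_add_distrib]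
  map_smul' c v := by
    ext s
    simp [Finset.mul_sum, mul_assoc]

theorem stepFunction_apply {L : ℕ} (v : Fin (2 ^ L) → ℝ) (s : ℝ) :
    (stepFunction L v : ℝ → ℝ) s = ∑ i, v i * dyadicIndicator L i s := rfl

theorem stepFunction_of_notMem {L : ℕ} (v : Fin (2 ^ L) → ℝ) {s : ℝ}
    (hs : s ∉ Set.Ico (0 : ℝ) 1) : (stepFunction L v : ℝ → ℝ) s = 0 := by
  rw [stepFunction_apply]
  exact Finset.sum_eq_zero fun i _ => by
    rw [(isStepOfLevel_dyadicIndicator i.2).1 s hs, mul_zero]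

theorem stepFunction_of_mem {L : ℕ} (v : Fin (2 ^ L) → ℝ) {s : ℝ}
    (hs : s ∈ Set.Ico (0 : ℝ) 1) :
    (stepFunction L v : ℝ → ℝ) s = v ⟨⌊(2 : ℝ) ^ L * s⌋₊, floor_pow_mul_lt L hs⟩ := by
  rw [stepFunction_apply, Finset.sum_eq_single ⟨⌊(2 : ℝ) ^ L * s⌋₊, floor_pow_mul_lt L hs⟩]
  · rw [dyadicIndicator_apply hs, if_pos (by rfl), mul_one]
  · intro i _ hi
    rw [dyadicIndicator_apply hs, if_neg, mul_zero]
    intro hc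
    exact hi (Fin.ext (Nat.add_left_cancel hc).symm)
  · simp

theorem IsStepOfLevel.eq_stepFunction {L : ℕ} {f : ℝ → ℝ} (hf : IsStepOfLevel L f) :
    f = stepFunction L fun i => f (dyadicPoint L i) := by
  ext s
  by_cases hs : s ∈ Set.Ico (0 : ℝ) 1
  · rw [stepFunction_of_mem _ hs]
    exact hf.2 s hs _ (dyadicPoint_mem L _)
      (floor_dyadicPoint L ⟨⌊(2 : ℝ) ^ L * s⌋₊, floor_pow_mul_lt L hs⟩).symm
  · rw [stepFunction_of_notMem _ hs, hf.1 s hs]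

theorem volume_dyadicInterval (j i : ℕ) :
    volume (dyadicInterval j i) = ENNReal.ofReal (2 ^ j)⁻¹ := by
  rw [dyadicInterval, Real.volume_Ico]
  congr 1
  field_simp
  ring

theorem measurableSet_dyadicInterval (j i : ℕ) : MeasurableSet (dyadicInterval j i) :=
  measurableSet_Ico

theorem measurable_stepFunction {L : ℕ} (v : Fin (2 ^ L) → ℝ) :
    Measurable (stepFunction L v : ℝ → ℝ) := by
  have : (stepFunction L v : ℝ → ℝ) = fun s => ∑ i, v i * dyadicIndicator L i s := rfl
  rw [this]
  refine Finset.measurable_sum _ fun i _ => Measurable.const_mul ?_ _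
  exact (measurable_one).indicator (measurableSet_dyadicInterval _ _)

theorem volume_preimage_stepFunction {L : ℕ} (v : Fin (2 ^ L) → ℝ) {S : Set ℝ}
    (hS : MeasurableSet S) :
    (volume.restrict (Set.Ico (0 : ℝ) 1)) ((fun s => |(stepFunction L v : ℝ → ℝ) s|) ⁻¹' S) =
      ∑ i, S.indicator (fun _ => ENNReal.ofReal (2 ^ L)⁻¹) |v i| := by
  classical
  have hm := (measurable_stepFunction v).abs hS
  rw [Measure.restrict_apply hm]
  have hset : (fun s => |(stepFunction L v : ℝ → ℝ) s|) ⁻¹' S ∩ Set.Ico (0 : ℝ) 1 =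
      ⋃ i ∈ Finset.univ.filter (fun i => |v i| ∈ S), dyadicInterval L i := by
    ext s
    simp only [Set.mem_inter_iff, Set.mem_preimage, Finset.mem_filter, Finset.mem_univ, true_and,
      Set.mem_iUnion, exists_prop]
    constructor
    · rintro ⟨h, hs⟩
      rw [stepFunction_of_mem v hs] at h
      exact ⟨_, h, (mem_dyadicInterval_iff hs.1).2 rfl⟩
    · rintro ⟨i, hi, his⟩
      have hs := dyadicInterval_subset i.2 his
      refine ⟨?_, hs⟩
      rw [stepFunction_of_mem v hs]
      have : (⟨⌊(2 : ℝ) ^ L * s⌋₊, floor_pow_mul_lt L hs⟩ : Fin (2 ^ L)) = i :=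
        Fin.ext ((mem_dyadicInterval_iff hs.1).1 his)
      rwa [this]
  rw [hset, measure_biUnion_finset]
  · simp only [volume_dyadicInterval, Finset.sum_filter, Set.indicator_apply]
  · intro i _ j _ hij
    refine Set.disjoint_left.2 fun s hi hj => hij ?_
    have hs := dyadicInterval_subset i.2 hi
    exact Fin.ext (((mem_dyadicInterval_iff hs.1).1 hi).symm.trans
      ((mem_dyadicInterval_iff hs.1).1 hj))
  · exact fun i _ => measurableSet_dyadicInterval _ _

theorem HaarSystemNorm.norm_stepFunction_comp_perm (X : HaarSystemNorm) {L : ℕ}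
    (v : Fin (2 ^ L) → ℝ) (σ : Equiv.Perm (Fin (2 ^ L))) :
    X.norm (stepFunction L (v ∘ σ)) = X.norm (stepFunction L v) := by
  refine X.norm_eq_of_equimeasurable _ _ ⟨?_, ?_, ?_⟩
  · exact (measurable_stepFunction _).abs.aemeasurable
  · exact (measurable_stepFunction _).abs.aemeasurable
  · refine Measure.ext fun S hS => ?_
    rw [Measure.map_apply (measurable_stepFunction _).abs hS,
      Measure.map_apply (measurable_stepFunction _).abs hS, volume_preimage_stepFunction _ hS,
      volume_preimage_stepFunction _ hS]
    exact Equiv.sum_comp σ fun i => S.indicator (fun _ => ENNReal.ofReal (2 ^ L)⁻¹) |v i|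

theorem HaarSystemNorm.norm_stepFunction_mono (X : HaarSystemNorm) {L : ℕ}
    {v w : Fin (2 ^ L) → ℝ} (h : ∀ i, |v i| ≤ |w i|) :
    X.norm (stepFunction L v) ≤ X.norm (stepFunction L w) := by
  refine X.norm_mono _ _ fun s => ?_
  by_cases hs : s ∈ Set.Ico (0 : ℝ) 1
  · rw [stepFunction_of_mem _ hs, stepFunction_of_mem _ hs]
    exact h _
  · rw [stepFunction_of_notMem _ hs, stepFunction_of_notMem _ hs]

/-- By Birkhoff's theorem, a doubly stochastic matrix is an average of permutations. -/
theorem HaarSystemNorm.norm_stepFunction_mulVec_le (X : HaarSystemNorm) {L : ℕ}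
    {M : Matrix (Fin (2 ^ L)) (Fin (2 ^ L)) ℝ} (hM : M ∈ doublyStochastic ℝ (Fin (2 ^ L)))
    (v : Fin (2 ^ L) → ℝ) :
    X.norm (stepFunction L (M.mulVec v)) ≤ X.norm (stepFunction L v) := by
  obtain ⟨w, hw0, hw1, hwM⟩ := exists_eq_sum_perm_of_mem_doublyStochastic hM
  have : M.mulVec v = ∑ σ : Equiv.Perm (Fin (2 ^ L)), w σ • (v ∘ σ) := by
    rw [← hwM, Matrix.sum_mulVec]
    refine Finset.sum_congr rfl fun σ _ => ?_
    rw [Matrix.smul_mulVec, Matrix.permMatrix_mulVec]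
  rw [this, map_sum]
  refine (Finset.le_sum_of_subadditive X.norm (map_zero X.norm).le (map_add_le_add X.norm) _ _).trans ?_
  refine le_of_eq ?_
  calc _ = ∑ σ : Equiv.Perm (Fin (2 ^ L)), w σ * X.norm (stepFunction L v) := by
        refine Finset.sum_congr rfl fun σ _ => ?_
        rw [map_smul, map_smul_eq_mul, Real.norm_of_nonneg (hw0 σ), X.norm_stepFunction_comp_perm]
    _ = _ := by rw [← Finset.sum_mul, hw1, one_mul]

/-! ### The Rademacher functions -/

theorem integral_of_isStepOfLevel {L : ℕ} {f : ℝ → ℝ} (hf : IsStepOfLevel L f) :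
    ∫ u in (0 : ℝ)..1, f u = (2 ^ L)⁻¹ * ∑ i, f (dyadicPoint L i) := by
  rw [intervalIntegral.integral_of_le zero_le_one, ← integral_Ico_eq_integral_Ioc]
  have h1 : ∀ u, f u = ∑ i : Fin (2 ^ L), f (dyadicPoint L i) * dyadicIndicator L i u := fun u => by
    rw [← stepFunction_apply, ← hf.eq_stepFunction]
  have h2 : ∀ i : Fin (2 ^ L), Integrable (dyadicIndicator L i) volume := fun i => by
    unfold dyadicIndicator dyadicInterval
    rw [integrable_indicator_iff measurableSet_Ico]
    simp only [Pi.one_def]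
    exact integrableOn_const (by simp)
  rw [integral_congr_ae (Eventually.of_forall h1), integral_finsetSum, Finset.mul_sum]
  · refine Finset.sum_congr rfl fun i _ => ?_
    rw [integral_const_mul, mul_comm]
    congr 1
    unfold dyadicIndicator
    rw [setIntegral_indicator (measurableSet_dyadicInterval _ _),
      Set.inter_eq_right.2 (dyadicInterval_subset i.2)]
    simp only [Pi.one_apply]
    rw [setIntegral_const, Measure.real, volume_dyadicInterval, ENNReal.toReal_ofReal (by positivity),
      smul_eq_mul, mul_one]
  · exact fun i _ => ((h2 i).const_mul _).integrableOn

theorem rademacher_apply (n : ℕ) {s : ℝ} (hs : s ∈ Set.Ico (0 : ℝ) 1) :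
    rademacher n s = if dyadicNode (n + 1) s % 2 = 0 then 1 else -1 := by
  have h0 := le_dyadicNode n s
  have h1 := dyadicNode_succ_div_two n s
  have h2 := dyadicNode_lt n hs
  rw [pow_succ] at h2
  rw [rademacher, Finset.sum_apply, Finset.sum_eq_single_of_mem (dyadicNode n s - 2 ^ n)
    (Finset.mem_range.2 (by omega)), haarFunction, Pi.sub_apply, dyadicIndicator_apply hs,
    dyadicIndicator_apply hs, pow_succ]
  · split_ifs <;> first | omega | norm_num
  · intro i _ hi
    rw [haarFunction, Pi.sub_apply, dyadicIndicator_apply hs, dyadicIndicator_apply hs, pow_succ,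
      if_neg (by omega), if_neg (by omega), sub_zero]

theorem rademacher_of_notMem (n : ℕ) {s : ℝ} (hs : s ∉ Set.Ico (0 : ℝ) 1) : rademacher n s = 0 := by
  obtain ⟨m, hm⟩ := mem_dyadicStep_iff.1 (rademacher_mem n)
  exact hm.1 s hs

theorem isStepOfLevel_rademacher {L n : ℕ} (hn : n < L) : IsStepOfLevel L (rademacher n) := by
  have : IsStepOfLevel (n + 1) (rademacher n) :=
    ⟨fun s hs => rademacher_of_notMem n hs, fun s hs t ht hst => by
      rw [rademacher_apply n hs, rademacher_apply n ht, dyadicNode, dyadicNode, hst]⟩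
  exact this.mono hn

/-- The signs `r_0, …, r_{L-1}` on the `i`-th dyadic interval of length `2⁻ᴸ`. -/
def signPattern (L : ℕ) (i : Fin (2 ^ L)) (n : Fin L) : Bool :=
  decide (dyadicNode (n + 1) (dyadicPoint L i) % 2 = 0)

theorem signPattern_bijective (L : ℕ) : Function.Bijective (signPattern L) := by
  refine (Fintype.bijective_iff_injective_and_card _).2 ⟨fun i j hij => ?_, by simp⟩
  have key : ∀ n ≤ L, dyadicNode n (dyadicPoint L i) = dyadicNode n (dyadicPoint L j) := by
    intro n
    induction n with
    | zero => intro _; rw [dyadicNode_zero (dyadicPoint_mem L i), dyadicNode_zero (dyadicPoint_mem L j)]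
    | succ n ih =>
      intro hn
      have h1 := ih (by omega)
      have h2 := congrFun hij ⟨n, hn⟩
      simp only [signPattern, decide_eq_decide] at h2
      have h3 := dyadicNode_succ_div_two n (dyadicPoint L i)
      have h4 := dyadicNode_succ_div_two n (dyadicPoint L j)
      omega
  have := key L le_rfl
  rw [dyadicNode_dyadicPoint le_rfl, dyadicNode_dyadicPoint le_rfl] at this
  simp only [Nat.sub_self, pow_zero, Nat.div_one] at this
  exact Fin.ext (by omega)

/-- The Rademacher functions `r_0, …, r_{L-1}` take all patterns of signs with equal probability. -/
theorem integral_abs_sum_rademacher {L : ℕ} (d : Fin L → ℝ) :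
    ∫ u in (0 : ℝ)..1, |∑ n : Fin L, rademacher n u * d n| =
      (2 ^ L)⁻¹ * ∑ b : Fin L → Bool, |∑ n, (if b n then 1 else -1) * d n| := by
  have hstep : IsStepOfLevel L fun u => |∑ n : Fin L, rademacher n u * d n| := by
    refine ⟨fun s hs => ?_, fun s hs t ht hst => ?_⟩
    · simp [rademacher_of_notMem _ hs]
    · have : ∀ n : Fin L, rademacher n s = rademacher n t := fun n =>
        (isStepOfLevel_rademacher n.2).2 s hs t ht hst
      simp only [this]
  rw [integral_of_isStepOfLevel hstep, ← (Equiv.ofBijective _ (signPattern_bijective L)).sum_comp]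
  congr 1
  refine Finset.sum_congr rfl fun i _ => ?_
  congr 1
  refine Finset.sum_congr rfl fun n _ => ?_
  rw [rademacher_apply _ (dyadicPoint_mem L i), Equiv.ofBijective_apply, signPattern]
  simp only [decide_eq_true_eq]

/-- The Rademacher functions are exchangeable. -/
theorem integral_abs_sum_rademacher_comp {L : ℕ} (d : Fin L → ℝ) (σ : Equiv.Perm (Fin L)) :
    ∫ u in (0 : ℝ)..1, |∑ n : Fin L, rademacher (σ n) u * d n| =
      ∫ u in (0 : ℝ)..1, |∑ n : Fin L, rademacher n u * d n| := by
  have : ∀ u, ∑ n : Fin L, rademacher (σ n) u * d n = ∑ n : Fin L, rademacher n u * d (σ.symm n) := by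
    intro u
    simpa using Equiv.sum_comp σ fun m : Fin L => rademacher m u * d (σ.symm m)
  simp only [this]
  rw [integral_abs_sum_rademacher, integral_abs_sum_rademacher]
  congr 1
  rw [← (Equiv.arrowCongr σ (Equiv.refl Bool)).sum_comp]
  refine Finset.sum_congr rfl fun b _ => ?_
  rw [← Equiv.sum_comp σ]
  simp [Equiv.arrowCongr]

/-- The average over `u` of `|∑ r_n(u) c_n|` does not change when the members of the family are
relabelled without repetitions. -/
theorem integral_abs_sum_family_relabel (r : rademacherFamilies) (S : Finset ℕ) {ψ : ℕ → ℕ}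
    (hψ : Set.InjOn ψ S) (c : ℕ → ℝ) :
    ∫ u in (0 : ℝ)..1, |∑ n ∈ S, (r : ℕ → ℝ → ℝ) (ψ n) u * c n| =
      ∫ u in (0 : ℝ)..1, |∑ n ∈ S, (r : ℕ → ℝ → ℝ) n u * c n| := by
  obtain ⟨r, rfl | rfl⟩ := r
  swap
  · rfl
  obtain ⟨L, hL⟩ : ∃ L, ∀ n ∈ S, n < L ∧ ψ n < L := by
    refine ⟨S.sup (fun n => n + ψ n) + 1, fun n hn => ?_⟩
    have : n + ψ n ≤ S.sup (fun n => n + ψ n) := Finset.le_sup (f := fun n => n + ψ n) hn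
    omega
  rcases Nat.eq_zero_or_pos L with rfl | hLpos
  · have : S = ∅ := Finset.eq_empty_of_forall_notMem fun n hn => by have := hL n hn; omega
    simp [this]
  let S' : Finset (Fin L) := Finset.univ.filter fun n => (n : ℕ) ∈ S
  let f : Fin L → Fin L := fun n => ⟨ψ n % L, Nat.mod_lt _ hLpos⟩
  have hf : ∀ n ∈ S', ((f n : Fin L) : ℕ) = ψ n := fun n hn =>
    Nat.mod_eq_of_lt (hL n (Finset.mem_filter.1 hn).2).2
  have hinj : Set.InjOn f S' := fun a ha b hb hab => by
    have h := congrArg Fin.val hab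
    rw [hf a ha, hf b hb] at h
    exact Fin.ext (hψ (Finset.mem_filter.1 ha).2 (Finset.mem_filter.1 hb).2 h)
  obtain ⟨g, hg⟩ := Finset.exists_equiv_extend_of_card_eq (t := Finset.univ) (s := S') (f := f)
    (by simp) (Finset.subset_univ _) hinj
  let σ : Equiv.Perm (Fin L) := g.trans (Equiv.subtypeUnivEquiv (by simp))
  have hσ : ∀ n ∈ S', ((σ n : Fin L) : ℕ) = ψ n := fun n hn => by
    rw [← hf n hn, ← hg n hn]; rfl
  let d : Fin L → ℝ := fun n => if (n : ℕ) ∈ S then c n else 0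
  have key : ∀ F : ℕ → ℝ, ∑ n ∈ S, F n = ∑ n : Fin L, if (n : ℕ) ∈ S then F n else 0 := by
    intro F
    rw [Fin.sum_univ_eq_sum_range (fun n => if n ∈ S then F n else 0) L, ← Finset.sum_filter]
    congr 1
    ext n
    simp only [Finset.mem_filter, Finset.mem_range]
    exact ⟨fun h => ⟨(hL n h).1, h⟩, fun h => h.2⟩
  have e1 : ∀ u, ∑ n ∈ S, rademacher (ψ n) u * c n = ∑ n : Fin L, rademacher (σ n) u * d n := by
    intro u
    rw [key]
    refine Finset.sum_congr rfl fun n _ => ?_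
    by_cases hn : (n : ℕ) ∈ S
    · rw [if_pos hn, hσ n (Finset.mem_filter.2 ⟨Finset.mem_univ _, hn⟩)]
      simp [d, hn]
    · simp [d, hn]
  have e2 : ∀ u, ∑ n ∈ S, rademacher n u * c n = ∑ n : Fin L, rademacher n u * d n := by
    intro u
    rw [key]
    refine Finset.sum_congr rfl fun n _ => ?_
    by_cases hn : (n : ℕ) ∈ S <;> simp [d, hn]
  simp only [e1, e2]
  exact integral_abs_sum_rademacher_comp d σ

/-! ### Block operators and their adjoints are contractions -/

theorem hardyFunction_eq_linearCombination (r : ℕ → ℝ → ℝ) (a : ℕ →₀ ℝ) (s : ℝ) :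
    hardyFunction r a s =
      ∫ u in (0 : ℝ)..1, |Finsupp.linearCombination ℝ (fun n => r n u * haarSystem n s) a| := by
  unfold hardyFunction
  congr 1
  funext u
  rw [Finsupp.linearCombination_apply]
  congr 2
  funext n c
  rw [smul_eq_mul]
  ring

/-- In the definition of the norm of `X(𝐫)`, the Rademacher functions may be relabelled as long as the
labels of the Haar functions which do not vanish at `s` remain distinct. -/
theorem hardyFunction_eq_relabel (r : rademacherFamilies) (a : ℕ →₀ ℝ) (s : ℝ) {ψ : ℕ → ℕ}
    (hψ : Set.InjOn ψ {n | n ∈ a.support ∧ haarSystem n s ≠ 0}) :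
    hardyFunction r a s = ∫ u in (0 : ℝ)..1,
      |Finsupp.linearCombination ℝ (fun n => (r : ℕ → ℝ → ℝ) (ψ n) u * haarSystem n s) a| := by
  classical
  rw [hardyFunction_eq_linearCombination]
  have key : ∀ ρ : ℕ → ℝ, Finsupp.linearCombination ℝ (fun n => ρ n * haarSystem n s) a =
      ∑ n ∈ a.support.filter (fun n => haarSystem n s ≠ 0), ρ n * (a n * haarSystem n s) := by
    intro ρ
    rw [Finsupp.linearCombination_apply, Finsupp.sum, Finset.sum_filter]
    refine Finset.sum_congr rfl fun n _ => ?_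
    split_ifs with h
    · rw [smul_eq_mul]; ring
    · rw [not_not.1 h]; simp
  have e1 := fun u => key fun n => (r : ℕ → ℝ → ℝ) n u
  have e2 := fun u => key fun n => (r : ℕ → ℝ → ℝ) (ψ n) u
  simp only [e1, e2]
  refine (integral_abs_sum_family_relabel r _ (fun x hx y hy => ?_) _).symm
  rw [Finset.mem_coe, Finset.mem_filter] at hx hy
  exact hψ hx hy

theorem isStepOfLevel_hardyFunction (r : ℕ → ℝ → ℝ) {a : ℕ →₀ ℝ} {L : ℕ}
    (ha : ∀ n ∈ a.support, n < 2 ^ L) : IsStepOfLevel L (hardyFunction r a) := by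
  refine ⟨fun s hs => ?_, fun s hs t ht hst => ?_⟩
  · simp [hardyFunction, haarSystem_of_notMem _ hs]
  · have : ∀ u, (a.sum fun n c => r n u * c * haarSystem n s) =
        a.sum fun n c => r n u * c * haarSystem n t := fun u =>
      Finset.sum_congr rfl fun n hn => by
        simp only [(isStepOfLevel_haarSystem (ha n hn)).2 s hs t ht hst]
    simp only [hardyFunction, this]

theorem hardyNorm_eq_norm_stepFunction (X : HaarSystemNorm) (r : rademacherFamilies) {a : ℕ →₀ ℝ}
    {L : ℕ} (ha : ∀ n ∈ a.support, n < 2 ^ L) :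
    hardyNorm X r a = X.norm (stepFunction L fun i => hardyFunction r a (dyadicPoint L i)) := by
  change X.norm ⟨hardyFunction r a, hardyFunction_mem r a⟩ = _
  congr 1
  exact Subtype.ext (isStepOfLevel_hardyFunction r ha).eq_stepFunction

theorem intervalIntegrable_linearCombination (r : rademacherFamilies) (a : ℕ →₀ ℝ) (s : ℝ)
    (ψ : ℕ → ℕ) : IntervalIntegrable (fun u => Finsupp.linearCombination ℝ
      (fun n => (r : ℕ → ℝ → ℝ) (ψ n) u * haarSystem n s) a) volume 0 1 := by
  have h := IntervalIntegrable.sum (μ := volume) (a := (0 : ℝ)) (b := 1) a.support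
    (f := fun n u => a n * ((r : ℕ → ℝ → ℝ) (ψ n) u * haarSystem n s)) fun n _ =>
      ((intervalIntegrable_of_mem (rademacherFamilies_mem r (ψ n))).mul_const _).const_mul _
  convert! h using 1
  ext u
  simp [Finsupp.linearCombination_apply, Finsupp.sum]

/-- A doubly stochastic matrix satisfies `|M f| ≤ M |f|` pointwise. Applied to
`f = ∑ r_{φ(n)}(u) a_n h_n` and averaged over `u`, this compares the functions which define the
norm of `X(𝐫)`, provided that the labels `φ(n)` are distinct along each branch. -/
theorem hardyNorm_le_of_doublyStochastic (X : HaarSystemNorm) (r : rademacherFamilies) {L : ℕ}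
    {M : Matrix (Fin (2 ^ L)) (Fin (2 ^ L)) ℝ} (hM : M ∈ doublyStochastic ℝ (Fin (2 ^ L)))
    {a b : ℕ →₀ ℝ} (ha : ∀ n ∈ a.support, n < 2 ^ L) (hb : ∀ n ∈ b.support, n < 2 ^ L)
    {φ ψ : ℕ → ℕ} (hφ : ∀ s, Set.InjOn φ {n | n ∈ a.support ∧ haarSystem n s ≠ 0})
    (hψ : ∀ s, Set.InjOn ψ {n | n ∈ b.support ∧ haarSystem n s ≠ 0})
    (hab : ∀ (ρ : ℕ → ℝ) (i : Fin (2 ^ L)),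
      ∑ j, M i j * Finsupp.linearCombination ℝ
        (fun n => ρ (φ n) * haarSystem n (dyadicPoint L j)) a =
      Finsupp.linearCombination ℝ (fun n => ρ (ψ n) * haarSystem n (dyadicPoint L i)) b) :
    hardyNorm X r b ≤ hardyNorm X r a := by
  rw [hardyNorm_eq_norm_stepFunction X r ha, hardyNorm_eq_norm_stepFunction X r hb]
  refine le_trans ?_ (X.norm_stepFunction_mulVec_le hM _)
  refine X.norm_stepFunction_mono fun i => ?_
  have hM0 : ∀ i j, 0 ≤ M i j := fun i j => nonneg_of_mem_doublyStochastic hM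
  rw [abs_of_nonneg (hardyFunction_nonneg _ _ _)]
  refine le_trans ?_ (le_abs_self _)
  simp only [Matrix.mulVec, dotProduct]
  rw [hardyFunction_eq_relabel r b _ (hψ _)]
  simp only [fun s => hardyFunction_eq_relabel r a s (hφ s), ← intervalIntegral.integral_const_mul]
  have hint : ∀ j, IntervalIntegrable (fun u => M i j * |Finsupp.linearCombination ℝ
      (fun n => (r : ℕ → ℝ → ℝ) (φ n) u * haarSystem n (dyadicPoint L j)) a|) volume 0 1 :=
    fun j => (intervalIntegrable_linearCombination r a _ φ).abs.const_mul _
  rw [← intervalIntegral.integral_finsetSum fun j _ => hint j]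
  refine intervalIntegral.integral_mono_on zero_le_one
    (intervalIntegrable_linearCombination r b _ ψ).abs
    (by
      have := IntervalIntegrable.sum (μ := volume) (a := (0 : ℝ)) (b := 1) Finset.univ
        fun j _ => hint j
      convert! this using 1
      ext u; simp) fun u _ => ?_
  rw [← hab (fun n => (r : ℕ → ℝ → ℝ) n u) i]
  refine (Finset.abs_sum_le_sum_abs _ _).trans (Finset.sum_le_sum fun j _ => ?_)
  rw [abs_mul, abs_of_nonneg (hM0 i j)]

/-- The operator that maps `h_k` to `∑_{K ∈ B k} ε k K • h_K`, in terms of Haar coefficients. -/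
def blockMap (B : ℕ → Finset ℕ) (ε : ℕ → ℕ → ℝ) : (ℕ →₀ ℝ) →ₗ[ℝ] (ℕ →₀ ℝ) :=
  Finsupp.linearCombination ℝ fun k => ∑ K ∈ B k, Finsupp.single K (ε k K)

open Classical in
/-- The adjoint of `blockMap` with respect to the inner product of `L²`, in terms of Haar
coefficients: it maps `h_K` to `ε k K |I_K| / |I_k| • h_k` if `K` belongs to block number `k`, and
to zero if `K` belongs to no block. -/
def blockAdjoint (B : ℕ → Finset ℕ) (ε : ℕ → ℕ → ℝ) : (ℕ →₀ ℝ) →ₗ[ℝ] (ℕ →₀ ℝ) :=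
  Finsupp.linearCombination ℝ fun K => if h : ∃ k, K ∈ B k then
    Finsupp.single h.choose (ε h.choose K * haarLength K / haarLength h.choose) else 0

open Classical in
/-- The number of the block to which `K` belongs; intervals which belong to no block receive
distinct numbers starting from `N`. -/
def blockIndex (B : ℕ → Finset ℕ) (N K : ℕ) : ℕ := if h : ∃ k, K ∈ B k then h.choose else K + N

theorem blockMap_single (B : ℕ → Finset ℕ) (ε : ℕ → ℕ → ℝ) (k : ℕ) (c : ℝ) :
    blockMap B ε (Finsupp.single k c) = c • ∑ K ∈ B k, Finsupp.single K (ε k K) := by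
  simp [blockMap]

theorem blockAdjoint_single_of_notMem {B : ℕ → Finset ℕ} (ε : ℕ → ℕ → ℝ) {K : ℕ}
    (hK : ∀ k, K ∉ B k) (c : ℝ) : blockAdjoint B ε (Finsupp.single K c) = 0 := by
  have : ¬ ∃ k, K ∈ B k := by simpa using hK
  simp [blockAdjoint, this]

namespace IsHaarBlockSystem

variable {B : ℕ → Finset ℕ} {ε : ℕ → ℕ → ℝ}

theorem blockAdjoint_single (h : IsHaarBlockSystem B ε) {k K : ℕ} (hK : K ∈ B k) (c : ℝ) :
    blockAdjoint B ε (Finsupp.single K c) =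
      c • Finsupp.single k (ε k K * haarLength K / haarLength k) := by
  have hex : ∃ k, K ∈ B k := ⟨k, hK⟩
  have : hex.choose = k := h.injective _ _ _ hex.choose_spec hK
  rw [blockAdjoint, Finsupp.linearCombination_single, dif_pos hex, this]

theorem blockIndex_eq (h : IsHaarBlockSystem B ε) {k K : ℕ} (hK : K ∈ B k) (N : ℕ) :
    blockIndex B N K = k := by
  have hex : ∃ k, K ∈ B k := ⟨k, hK⟩
  rw [blockIndex, dif_pos hex]
  exact h.injective _ _ _ hex.choose_spec hK

/-- On each branch of the dyadic tree different intervals belong to different blocks. -/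
theorem blockIndex_injOn (h : IsHaarBlockSystem B ε) {N : ℕ} (hN : ∀ k, ∀ K ∈ B k, k < N) (s : ℝ) :
    Set.InjOn (blockIndex B N) {n | haarSystem n s ≠ 0} := by
  intro K hK K' hK' heq
  by_cases h1 : ∃ k, K ∈ B k <;> by_cases h2 : ∃ k, K' ∈ B k
  · obtain ⟨k, hk⟩ := h1
    obtain ⟨k', hk'⟩ := h2
    rw [h.blockIndex_eq hk, h.blockIndex_eq hk'] at heq
    subst heq
    exact h.disjoint k K hk K' hk' s hK hK'
  · obtain ⟨k, hk⟩ := h1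
    have := hN k K hk
    rw [h.blockIndex_eq hk, blockIndex, dif_neg h2] at heq
    omega
  · obtain ⟨k, hk⟩ := h2
    have := hN k K' hk
    rw [h.blockIndex_eq hk, blockIndex, dif_neg h1] at heq
    omega
  · rw [blockIndex, dif_neg h1, blockIndex, dif_neg h2] at heq
    omega

theorem exists_mem_of_mem_support_blockMap {a : ℕ →₀ ℝ} {K : ℕ}
    (hK : K ∈ (blockMap B ε a).support) : ∃ k, K ∈ B k := by
  classical
  rw [blockMap, Finsupp.linearCombination_apply] at hK
  obtain ⟨k, _, hk⟩ := Finset.mem_biUnion.1 (Finsupp.support_sum hK)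
  have := Finsupp.support_finsetSum (Finsupp.support_smul hk)
  obtain ⟨K', hK', hh⟩ := Finset.mem_biUnion.1 this
  have := Finsupp.support_single_subset hh
  rw [Finset.mem_singleton] at this
  exact ⟨k, this ▸ hK'⟩

theorem exists_mem_of_mem_support_blockAdjoint {a : ℕ →₀ ℝ} {k : ℕ}
    (hk : k ∈ (blockAdjoint B ε a).support) : ∃ K, K ∈ B k := by
  classical
  rw [blockAdjoint, Finsupp.linearCombination_apply] at hk
  obtain ⟨K, _, hK⟩ := Finset.mem_biUnion.1 (Finsupp.support_sum hk)
  have := Finsupp.support_smul hK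
  split_ifs at this with hex
  · have := Finsupp.support_single_subset this
    rw [Finset.mem_singleton] at this
    exact ⟨K, this ▸ hex.choose_spec⟩
  · simp at this

theorem hardyNorm_blockMap_le_of_level (h : IsHaarBlockSystem B ε) (X : HaarSystemNorm)
    (r : rademacherFamilies) {L : ℕ} (hL : ∀ k, ∀ K ∈ B k, K < 2 ^ L)
    (hN : ∀ k, ∀ K ∈ B k, k < 2 ^ L) {a : ℕ →₀ ℝ} (ha : ∀ n ∈ a.support, n < 2 ^ L) :
    hardyNorm X r (blockMap B ε a) ≤ hardyNorm X r a := by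
  refine hardyNorm_le_of_doublyStochastic X r (h.blockMatrix_mem_doublyStochastic hL) ha ?_
    (φ := id) (ψ := blockIndex B (2 ^ L)) (fun s => Function.injective_id.injOn)
    (fun s => (h.blockIndex_injOn hN s).mono fun n hn => hn.2) fun ρ i => ?_
  · intro n hn
    obtain ⟨k, hk⟩ := exists_mem_of_mem_support_blockMap hn
    exact hL k n hk
  · have e1 : ∀ j, blockMatrix B ε L i j * Finsupp.linearCombination ℝ
        (fun n => ρ (id n) * haarSystem n (dyadicPoint L j)) a = ∑ k ∈ a.support,
          a k * ρ k * (blockMatrix B ε L i j * haarSystem k (dyadicPoint L j)) := by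
      intro j
      rw [Finsupp.linearCombination_apply, Finsupp.sum, Finset.mul_sum]
      refine Finset.sum_congr rfl fun k _ => ?_
      simp only [id, smul_eq_mul]
      ring
    simp only [e1]
    rw [Finset.sum_comm, blockMap, Finsupp.linearCombination_apply _ a, Finsupp.sum, map_sum]
    refine Finset.sum_congr rfl fun k hk => ?_
    rw [← Finset.mul_sum, blockMatrix_mulVec L (ha k hk), map_smul, map_sum, blockFunction,
      smul_eq_mul, mul_assoc, Finset.mul_sum]
    congr 1
    refine Finset.sum_congr rfl fun K hK => ?_
    rw [Finsupp.linearCombination_single, h.blockIndex_eq hK, smul_eq_mul]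
    ring

theorem hardyNorm_blockAdjoint_le_of_level (h : IsHaarBlockSystem B ε) (X : HaarSystemNorm)
    (r : rademacherFamilies) {L : ℕ} (hL : ∀ k, ∀ K ∈ B k, K < 2 ^ L)
    (hN : ∀ k, ∀ K ∈ B k, k < 2 ^ L) {a : ℕ →₀ ℝ} (ha : ∀ n ∈ a.support, n < 2 ^ L) :
    hardyNorm X r (blockAdjoint B ε a) ≤ hardyNorm X r a := by
  refine hardyNorm_le_of_doublyStochastic X r
    (transpose_mem_doublyStochastic_iff.2 (h.blockMatrix_mem_doublyStochastic hL)) ha ?_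
    (φ := blockIndex B (2 ^ L)) (ψ := id)
    (fun s => (h.blockIndex_injOn hN s).mono fun n hn => hn.2)
    (fun s => Function.injective_id.injOn) fun ρ i => ?_
  · intro n hn
    obtain ⟨K, hK⟩ := exists_mem_of_mem_support_blockAdjoint hn
    exact hN n K hK
  · have e1 : ∀ j, (blockMatrix B ε L).transpose i j * Finsupp.linearCombination ℝ
        (fun n => ρ (blockIndex B (2 ^ L) n) * haarSystem n (dyadicPoint L j)) a =
        ∑ K ∈ a.support, a K * ρ (blockIndex B (2 ^ L) K) *
          (blockMatrix B ε L j i * haarSystem K (dyadicPoint L j)) := by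
      intro j
      rw [Finsupp.linearCombination_apply, Finsupp.sum, Finset.mul_sum]
      refine Finset.sum_congr rfl fun k _ => ?_
      simp only [Matrix.transpose_apply, smul_eq_mul]
      ring
    simp only [e1]
    rw [Finset.sum_comm]
    conv_rhs => rw [← Finsupp.sum_single a, Finsupp.sum, map_sum, map_sum]
    refine Finset.sum_congr rfl fun K hK => ?_
    rw [← Finset.mul_sum, blockMatrix_transpose_mulVec hL (ha K hK)]
    by_cases hex : ∃ k, K ∈ B k
    · obtain ⟨k, hk⟩ := hex
      rw [h.blockAdjoint_single hk, h.blockIndex_eq hk,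
        Finset.sum_eq_single_of_mem k (Finset.mem_range.2 (hN k K hk)), if_pos hk, map_smul,
        Finsupp.linearCombination_single, smul_eq_mul, smul_eq_mul]
      · simp only [id]; ring
      · intro l _ hl
        rw [if_neg fun hc => hl (h.injective l k K hc hk)]
    · push Not at hex
      rw [blockAdjoint_single_of_notMem ε hex, map_zero, Finset.sum_eq_zero, mul_zero]
      intro k _
      rw [if_neg (hex k)]

/-- A dyadic level which resolves the first `n` blocks and the support of `a`. -/
theorem exists_level (B : ℕ → Finset ℕ) (a : ℕ →₀ ℝ) (n : ℕ) : ∃ L,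
    (∀ k < n, ∀ K ∈ B k, K < 2 ^ L) ∧ n ≤ 2 ^ L ∧ ∀ k ∈ a.support, k < 2 ^ L := by
  refine ⟨((Finset.range n).sup fun k => (B k).sup id) + n + a.support.sup id, fun k hk K hK => ?_,
    le_trans ?_ Nat.lt_two_pow_self.le, fun k hk => ?_⟩
  · refine lt_of_le_of_lt ?_ Nat.lt_two_pow_self
    have h1 : K ≤ (B k).sup id := Finset.le_sup (f := id) hK
    have h2 : (B k).sup id ≤ (Finset.range n).sup fun k => (B k).sup id :=
      Finset.le_sup (f := fun k => (B k).sup id) (Finset.mem_range.2 hk)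
    omega
  · omega
  · refine lt_of_le_of_lt ?_ Nat.lt_two_pow_self
    have h1 : k ≤ a.support.sup id := Finset.le_sup (f := id) hk
    omega

/-- Block operators are contractions for the norm of `X(𝐫)`. Only finitely many blocks matter for a
finitely supported `a`, so that a single doubly stochastic matrix suffices. -/
theorem hardyNorm_blockMap_le (h : IsHaarBlockSystem B ε) (X : HaarSystemNorm)
    (r : rademacherFamilies) (a : ℕ →₀ ℝ) :
    hardyNorm X r (blockMap B ε a) ≤ hardyNorm X r a := by
  have ha : ∀ k ∈ a.support, k < a.support.sup id + 1 := fun k hk =>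
    Nat.lt_succ_of_le (Finset.le_sup (f := id) hk)
  obtain ⟨L, hL1, hL2, hL3⟩ := exists_level B a (a.support.sup id + 1)
  have ht := h.truncate (n := a.support.sup id + 1) (by omega)
  have key := ht.hardyNorm_blockMap_le_of_level X r (L := L) ?_ ?_ hL3
  · convert key using 2
    rw [blockMap, blockMap, Finsupp.linearCombination_apply, Finsupp.linearCombination_apply]
    refine Finset.sum_congr rfl fun k hk => ?_
    simp only [if_pos (ha k hk)]
  all_goals
    intro k K hK
    split_ifs at hK with hk
    · first | exact hL1 k hk K hK | omega
    · simp at hK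

/-- Adjoint block operators are contractions for the norm of `X(𝐫)`. -/
theorem hardyNorm_blockAdjoint_le (h : IsHaarBlockSystem B ε) (X : HaarSystemNorm)
    (r : rademacherFamilies) (a : ℕ →₀ ℝ) :
    hardyNorm X r (blockAdjoint B ε a) ≤ hardyNorm X r a := by
  obtain ⟨n, hn, ha⟩ : ∃ n, 1 ≤ n ∧ ∀ K ∈ a.support, ∀ k, K ∈ B k → k < n := by
    refine ⟨a.support.sup (blockIndex B 0) + 1, by omega, fun K hK k hk => ?_⟩
    have := Finset.le_sup (f := blockIndex B 0) hK
    rw [h.blockIndex_eq hk] at this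
    omega
  obtain ⟨L, hL1, hL2, hL3⟩ := exists_level B a n
  have ht := h.truncate hn
  have key := ht.hardyNorm_blockAdjoint_le_of_level X r (L := L) ?_ ?_ hL3
  · convert key using 2
    conv_lhs => rw [← Finsupp.sum_single a, Finsupp.sum, map_sum]
    conv_rhs => rw [← Finsupp.sum_single a, Finsupp.sum, map_sum]
    refine Finset.sum_congr rfl fun K hK => ?_
    by_cases hex : ∃ k, K ∈ B k
    · obtain ⟨k, hk⟩ := hex
      rw [h.blockAdjoint_single hk, ht.blockAdjoint_single (k := k)]
      rw [if_pos (ha K hK k hk)]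
      exact hk
    · push Not at hex
      rw [blockAdjoint_single_of_notMem ε hex, blockAdjoint_single_of_notMem ε]
      intro k hk
      split_ifs at hk
      · exact hex k hk
      · simp at hk
  all_goals
    intro k K hK
    split_ifs at hK with hk
    · first | exact hL1 k hk K hK | omega
    · simp at hK

end IsHaarBlockSystem

/-! ### Schauder bases from monotone partial sums -/

section Monotone

variable {E : Type*} [NormedAddCommGroup E] [NormedSpace ℝ E] {u : ℕ → E}

theorem linearCombination_filter_lt (a : ℕ →₀ ℝ) (n : ℕ) :
    Finsupp.linearCombination ℝ u (a.filter (· < n)) = ∑ i ∈ Finset.range n, a i • u i := by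
  rw [Finsupp.linearCombination_apply, Finsupp.sum_of_support_subset (s := Finset.range n)]
  · refine Finset.sum_congr rfl fun i hi => ?_
    rw [Finsupp.filter_apply_pos (· < n) a (Finset.mem_range.1 hi)]
  · intro i hi
    rw [Finsupp.support_filter, Finset.mem_filter] at hi
    exact Finset.mem_range.2 hi.2
  · simp

theorem linearCombination_eq_sum_range {a : ℕ →₀ ℝ} {n : ℕ} (h : ∀ i ∈ a.support, i < n) :
    Finsupp.linearCombination ℝ u a = ∑ i ∈ Finset.range n, a i • u i := by
  rw [Finsupp.linearCombination_apply, Finsupp.sum_of_support_subset (s := Finset.range n)]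
  · exact fun i hi => Finset.mem_range.2 (h i hi)
  · simp

theorem exists_forall_support_lt (a : ℕ →₀ ℝ) : ∃ n, ∀ i ∈ a.support, i < n :=
  ⟨a.support.sup id + 1, fun _ hi => Nat.lt_succ_of_le (Finset.le_sup (f := id) hi)⟩

/-- A sequence of non-zero vectors with dense span whose partial sums are monotone in norm, and any
sequence of non-zero multiples of it, is a Schauder basis. -/
theorem exists_schauderBasis_of_monotone
    (hdense : DenseRange (Finsupp.linearCombination ℝ u))
    (hmono : ∀ (a : ℕ →₀ ℝ) (n : ℕ),
      ‖Finsupp.linearCombination ℝ u (a.filter (· < n))‖ ≤ ‖Finsupp.linearCombination ℝ u a‖)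
    (hne : ∀ n, u n ≠ 0) {c : ℕ → ℝ} (hc : ∀ n, c n ≠ 0) :
    ∃ b : SchauderBasis ℝ E, ∀ n, b n = c n • u n := by
  classical
  have hpos : ∀ n, 0 < ‖u n‖ := fun n => norm_pos_iff.2 (hne n)
  have hbound : ∀ n (a : ℕ →₀ ℝ), ‖Finsupp.lapply (R := ℝ) n a‖ ≤
      2 / ‖u n‖ * ‖Finsupp.linearCombination ℝ u a‖ := by
    intro n a
    have h1 : a n • u n = Finsupp.linearCombination ℝ u (a.filter (· < n + 1)) -
        Finsupp.linearCombination ℝ u (a.filter (· < n)) := by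
      rw [linearCombination_filter_lt, linearCombination_filter_lt, Finset.sum_range_succ,
        add_sub_cancel_left]
    have h2 : ‖a n‖ * ‖u n‖ ≤ 2 * ‖Finsupp.linearCombination ℝ u a‖ := by
      rw [← norm_smul, h1]
      refine (norm_sub_le _ _).trans ?_
      linarith [hmono a (n + 1), hmono a n]
    rw [div_mul_eq_mul_div, le_div_iff₀ (hpos n)]
    exact h2
  let f : ℕ → StrongDual ℝ E := fun n =>
    (Finsupp.lapply (R := ℝ) n).extendOfNorm (Finsupp.linearCombination ℝ u)
  have hf : ∀ n a, f n (Finsupp.linearCombination ℝ u a) = a n := fun n a =>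
    LinearMap.extendOfNorm_eq hdense ⟨_, hbound n⟩ a
  have hsmul : ∀ n x, ((c n)⁻¹ • f n) x • c n • u n = f n x • u n := by
    intro n x
    rw [smul_apply, smul_eq_mul, smul_smul]
    congr 1
    field_simp [hc n]
  refine ⟨⟨fun n => c n • u n, fun n => (c n)⁻¹ • f n, fun i j => ?_, fun x => ?_⟩, fun n => rfl⟩
  · have : u j = Finsupp.linearCombination ℝ u (Finsupp.single j 1) := by simp
    rw [smul_apply, map_smul, this, hf]
    by_cases hij : i = j
    · subst hij
      simp [hc i]
    · simp [hij]
  · simp only [hsmul]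
    rw [HasSum, SummationFilter.conditional_filter_eq_map_range, tendsto_map'_iff]
    have hP : ∀ n (x : E), ‖∑ i ∈ Finset.range n, f i x • u i‖ ≤ ‖x‖ := by
      intro n x
      refine hdense.induction_on (p := fun x => ‖∑ i ∈ Finset.range n, f i x • u i‖ ≤ ‖x‖) x
        (isClosed_le (by fun_prop) (by fun_prop)) fun a => ?_
      simp only [hf]
      rw [← linearCombination_filter_lt]
      exact hmono a n
    rw [Metric.tendsto_atTop]
    intro δ hδ
    obtain ⟨a, ha⟩ := hdense.exists_dist_lt x (half_pos hδ)
    obtain ⟨N, hN⟩ := exists_forall_support_lt a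
    refine ⟨N, fun n hn => ?_⟩
    set y := Finsupp.linearCombination ℝ u a with hy
    have e1 : ∑ i ∈ Finset.range n, f i y • u i = y := by
      simp only [hy, hf]
      exact (linearCombination_eq_sum_range fun i hi => (hN i hi).trans_le hn).symm
    have e2 : ∑ i ∈ Finset.range n, f i x • u i - x =
        ∑ i ∈ Finset.range n, f i (x - y) • u i - (x - y) := by
      simp only [map_sub, sub_smul, Finset.sum_sub_distrib, e1]
      abel
    rw [dist_eq_norm] at ha
    simp only [Function.comp]
    rw [dist_eq_norm, e2]
    refine (norm_sub_le _ _).trans_lt ?_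
    linarith [hP n (x - y)]

/-- Abel summation: an increasing bounded multiplier is bounded by its bound plus its variation. -/
theorem norm_linearCombination_multiplier_le
    (hmono : ∀ (a : ℕ →₀ ℝ) (n : ℕ),
      ‖Finsupp.linearCombination ℝ u (a.filter (· < n))‖ ≤ ‖Finsupp.linearCombination ℝ u a‖)
    {m : ℕ → ℝ} (hm : Monotone m) (hm0 : 0 ≤ m 0) {C : ℝ} (hC : ∀ n, m n ≤ C) (a : ℕ →₀ ℝ) :
    ‖Finsupp.linearCombination ℝ (fun n => m n • u n) a‖ ≤
      (2 * C - m 0) * ‖Finsupp.linearCombination ℝ u a‖ := by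
  obtain ⟨N, hN⟩ := exists_forall_support_lt a
  set A := ‖Finsupp.linearCombination ℝ u a‖ with hA
  have hA0 : 0 ≤ A := norm_nonneg _
  have hG : ∀ n, ‖∑ i ∈ Finset.range n, a i • u i‖ ≤ A := fun n => by
    rw [← linearCombination_filter_lt]; exact hmono a n
  rw [linearCombination_eq_sum_range hN]
  simp only [smul_smul, mul_comm (a _)]
  simp only [← smul_smul]
  rw [Finset.sum_range_by_parts]
  refine (norm_sub_le _ _).trans ?_
  have h1 : ‖m (N - 1) • ∑ i ∈ Finset.range N, a i • u i‖ ≤ m (N - 1) * A := by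
    rw [norm_smul, Real.norm_of_nonneg (hm0.trans (hm (Nat.zero_le _)))]
    exact mul_le_mul_of_nonneg_left (hG N) (hm0.trans (hm (Nat.zero_le _)))
  have h2 : ‖∑ i ∈ Finset.range (N - 1), (m (i + 1) - m i) • ∑ j ∈ Finset.range (i + 1), a j • u j‖
      ≤ (m (N - 1) - m 0) * A := by
    refine (norm_sum_le _ _).trans ?_
    rw [← Finset.sum_range_sub m, Finset.sum_mul]
    refine Finset.sum_le_sum fun i _ => ?_
    have : 0 ≤ m (i + 1) - m i := sub_nonneg.2 (hm (Nat.le_succ i))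
    rw [norm_smul, Real.norm_of_nonneg this]
    exact mul_le_mul_of_nonneg_left (hG _) this
  nlinarith [hC (N - 1)]

end Monotone

/-! ### The Haar basis of `X₀(𝐫)` -/

section HaarBasis

variable (X : HaarSystemNorm) (r : rademacherFamilies)

theorem norm_coe_mk (a : ℕ →₀ ℝ) :
    ‖((HardyPre.mk X r a : HardyPre X r) : HardySpace X r)‖ = hardyNorm X r a :=
  UniformSpace.Completion.norm_coe _

/-- `HardyPre.mk`, with values in the completion, as a linear map. -/
def hardyMk : (ℕ →₀ ℝ) →ₗ[ℝ] HardySpace X r where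
  toFun a := ((HardyPre.mk X r a : HardyPre X r) : HardySpace X r)
  map_add' a b := UniformSpace.Completion.coe_add (HardyPre.mk X r a) (HardyPre.mk X r b)
  map_smul' c a := UniformSpace.Completion.coe_smul c (HardyPre.mk X r a)

theorem norm_hardyMk (a : ℕ →₀ ℝ) : ‖hardyMk X r a‖ = hardyNorm X r a := norm_coe_mk X r a

theorem hardyMk_single (n : ℕ) (c : ℝ) : hardyMk X r (Finsupp.single n c) = c • haarVector X r n := by
  rw [← mul_one c, ← smul_eq_mul, ← Finsupp.smul_single, map_smul, smul_eq_mul, mul_one]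
  rfl

theorem coe_linearCombination (a : ℕ →₀ ℝ) :
    ((Finsupp.linearCombination ℝ (haarBasisVector X r) a : HardySpaceZero X r) : HardySpace X r) =
      hardyMk X r (a.mapDomain Nat.succ) := by
  have : (hardySubspace X r).subtype ∘ₗ Finsupp.linearCombination ℝ (haarBasisVector X r) =
      hardyMk X r ∘ₗ Finsupp.lmapDomain ℝ ℝ Nat.succ := by
    refine Finsupp.lhom_ext fun n c => ?_
    simp only [LinearMap.comp_apply, Finsupp.linearCombination_single, Finsupp.lmapDomain_apply,
      Finsupp.mapDomain_single, hardyMk_single, map_smul]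
    rfl
  exact LinearMap.congr_fun this a

theorem norm_linearCombination_haar (a : ℕ →₀ ℝ) :
    ‖Finsupp.linearCombination ℝ (haarBasisVector X r) a‖ =
      hardyNorm X r (a.mapDomain Nat.succ) := by
  rw [← norm_hardyMk, ← coe_linearCombination]
  rfl

theorem denseRange_linearCombination_haar :
    DenseRange (Finsupp.linearCombination ℝ (haarBasisVector X r)) := by
  intro y
  rw [Metric.mem_closure_iff]
  intro δ hδ
  obtain ⟨z, hz, hdist⟩ := Metric.mem_closure_iff.1 y.2 δ hδ
  obtain ⟨a, ha⟩ := (Finsupp.mem_span_range_iff_exists_finsupp).1 hz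
  refine ⟨_, ⟨a, rfl⟩, ?_⟩
  have : ((Finsupp.linearCombination ℝ (haarBasisVector X r) a : HardySpaceZero X r) :
      HardySpace X r) = z := by
    rw [← ha, Finsupp.linearCombination_apply, Finsupp.sum, Finsupp.sum]
    push_cast
    rfl
  rw [Subtype.dist_eq, this]
  exact hdist

theorem exists_haarSystem_ne_zero (n : ℕ) : ∃ s, haarSystem n s ≠ 0 := by
  by_contra! h
  have h1 := sum_haarSystem_mul_self (Nat.lt_two_pow_self (n := n))
  simp only [h, mul_zero, Finset.sum_const_zero] at h1
  have := haarLength_pos n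
  have : (0 : ℝ) < 2 ^ n * haarLength n := by positivity
  linarith

theorem integral_abs_rademacher (n : ℕ) : ∫ u in (0 : ℝ)..1, |rademacher n u| = 1 := by
  have h := isStepOfLevel_rademacher (Nat.lt_succ_self n)
  have h' : IsStepOfLevel (n + 1) fun u => |rademacher n u| :=
    ⟨fun s hs => by simp [h.1 s hs], fun s hs t ht hst => by simp only [h.2 s hs t ht hst]⟩
  rw [integral_of_isStepOfLevel h']
  have : ∀ i, |rademacher n (dyadicPoint (n + 1) i)| = 1 := fun i => by
    rw [rademacher_apply n (dyadicPoint_mem _ i)]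
    split_ifs <;> simp
  simp [this]

theorem hardyFunction_single (n : ℕ) (s : ℝ) :
    hardyFunction r (Finsupp.single n 1) s = |haarSystem n s| := by
  have h1 : ∫ u in (0 : ℝ)..1, |(r : ℕ → ℝ → ℝ) n u| = 1 := by
    obtain ⟨r, rfl | rfl⟩ := r
    exacts [integral_abs_rademacher n, integral_abs_rademacher 0]
  rw [hardyFunction]
  simp only [zero_mul, mul_zero, Finsupp.sum_single_index, mul_one, abs_mul]
  rw [intervalIntegral.integral_mul_const, h1, one_mul]

theorem haarBasisVector_ne_zero (n : ℕ) : haarBasisVector X r n ≠ 0 := by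
  intro h
  have h1 : hardyNorm X r (Finsupp.single (n + 1) 1) = 0 := by
    have := norm_linearCombination_haar X r (Finsupp.single n 1)
    simp only [Finsupp.linearCombination_single, one_smul, h, norm_zero,
      Finsupp.mapDomain_single] at this
    exact this.symm
  have h2 := X.eq_zero_of_norm_eq_zero _ h1
  obtain ⟨s, hs⟩ := exists_haarSystem_ne_zero (n + 1)
  have h3 := congrFun (congrArg Subtype.val h2) s
  change hardyFunction r (Finsupp.single (n + 1) 1) s = 0 at h3
  rw [hardyFunction_single] at h3
  exact hs (abs_eq_zero.1 h3)

/-- The first Haar functions form a block system, whose block operator is the partial sum projection. -/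
theorem isHaarBlockSystem_initial (n : ℕ) :
    IsHaarBlockSystem (fun k => if k ≤ n then {k} else ∅) (fun _ _ => 1) where
  zero_block := by simp
  zero_sign := rfl
  abs_sign := by simp
  disjoint k K hK K' hK' s _ _ := by
    split_ifs at hK hK' <;> simp at hK hK'
    rw [hK, hK']
  injective k l K hK hK' := by
    split_ifs at hK hK' <;> simp at hK hK'
    rw [← hK, hK']
  nested k hk K hK s hs := by
    split_ifs at hK with hkn
    · rw [Finset.mem_singleton] at hK
      subst hK
      have : K / 2 ≤ n := by omega
      rw [← haarSystem_div_two hk hs]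
      simp [blockFunction, this]
    · simp at hK

/-- The partial sum projections of the Haar system are contractions, since they are block operators. -/
theorem norm_linearCombination_haar_filter_le (a : ℕ →₀ ℝ) (n : ℕ) :
    ‖Finsupp.linearCombination ℝ (haarBasisVector X r) (a.filter (· < n))‖ ≤
      ‖Finsupp.linearCombination ℝ (haarBasisVector X r) a‖ := by
  rw [norm_linearCombination_haar, norm_linearCombination_haar]
  convert (isHaarBlockSystem_initial n).hardyNorm_blockMap_le X r (a.mapDomain Nat.succ) using 2
  conv_rhs => rw [← Finsupp.sum_single a, Finsupp.sum, Finsupp.mapDomain_finsetSum, map_sum]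
  conv_lhs => rw [← Finsupp.sum_single (a.filter (· < n)), Finsupp.sum,
    Finsupp.mapDomain_finsetSum, Finsupp.support_filter, Finset.sum_filter]
  refine Finset.sum_congr rfl fun i _ => ?_
  rw [Finsupp.mapDomain_single, Finsupp.mapDomain_single, blockMap_single]
  split_ifs with h1 h2 h2
  · rw [Finsupp.filter_apply_pos (· < n) a h1]
    simp
  · omega
  · omega
  · simp

/-- The normalized Haar system is a Schauder basis of `X₀(𝐫)`. -/
theorem exists_haarBasis : ∃ b : SchauderBasis ℝ (HardySpaceZero X r),
    ∀ n, b n = ‖haarBasisVector X r n‖⁻¹ • haarBasisVector X r n :=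
  exists_schauderBasis_of_monotone (denseRange_linearCombination_haar X r)
    (norm_linearCombination_haar_filter_le X r) (haarBasisVector_ne_zero X r)
    fun n => inv_ne_zero (norm_ne_zero_iff.2 (haarBasisVector_ne_zero X r n))

end HaarBasis

/-! ### The distance to a subspace of finite codimension -/

/-- A subspace of finite codimension is the common kernel of finitely many functionals, and these
control the distance to it. -/
theorem exists_coordinates_of_finite_quotient {V : Type*} [AddCommGroup V] [Module ℝ V]
    (W : Submodule ℝ V) [FiniteDimensional ℝ (V ⧸ W)] :
    ∃ (d : ℕ) (c : Fin d → V ⧸ W →ₗ[ℝ] ℝ) (v : Fin d → V),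
      ∀ x, x - ∑ i, c i (W.mkQ x) • v i ∈ W := by
  let b := Module.finBasis ℝ (V ⧸ W)
  choose v hv using fun i => W.mkQ_surjective (b i)
  refine ⟨_, fun i => b.coord i, v, fun x => ?_⟩
  refine (Submodule.Quotient.mk_eq_zero W).1 ?_
  change W.mkQ _ = 0
  rw [map_sub, map_sum, sub_eq_zero]
  simp only [map_smul, hv, Module.Basis.coord_apply]
  exact (b.sum_repr _).symm

theorem continuous_comp_mkQ {V : Type*} [AddCommGroup V] [Module ℝ V] [TopologicalSpace V]
    [IsTopologicalAddGroup V] [ContinuousSMul ℝ V] {W : Submodule ℝ V} (hW : IsClosed (W : Set V))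
    [FiniteDimensional ℝ (V ⧸ W)] (c : V ⧸ W →ₗ[ℝ] ℝ) : Continuous fun x => c (W.mkQ x) := by
  have := hW
  exact (LinearMap.continuous_of_finiteDimensional c).comp continuous_quot_mk

theorem infDist_lt_of_coordinates {V : Type*} [NormedAddCommGroup V] [NormedSpace ℝ V]
    {W : Submodule ℝ V} {d : ℕ} (v : Fin d → V) {δ : ℝ} (hδ : 0 < δ) {x : V} {t : Fin d → ℝ}
    (hx : x - ∑ i, t i • v i ∈ W) (ht : ∀ i, |t i| < δ / (∑ i, ‖v i‖ + 1)) :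
    Metric.infDist x W < δ := by
  have hpos : 0 < ∑ i, ‖v i‖ + 1 := by positivity
  refine (Metric.infDist_le_dist_of_mem hx).trans_lt ?_
  rw [dist_eq_norm, sub_sub_cancel]
  calc ‖∑ i, t i • v i‖ ≤ ∑ i, δ / (∑ i, ‖v i‖ + 1) * ‖v i‖ := by
        refine (norm_sum_le _ _).trans (Finset.sum_le_sum fun i _ => ?_)
        rw [norm_smul, Real.norm_eq_abs]
        exact mul_le_mul_of_nonneg_right (ht i).le (norm_nonneg _)
    _ = δ * ((∑ i, ‖v i‖) / (∑ i, ‖v i‖ + 1)) := by rw [← Finset.mul_sum]; ring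
    _ < δ * 1 := by
        refine mul_lt_mul_of_pos_left ?_ hδ
        rw [div_lt_one hpos]
        linarith
    _ = δ := mul_one δ

theorem exists_finset_infDist_lt {E : Type*} [NormedAddCommGroup E] [NormedSpace ℝ E]
    {W : Submodule ℝ E} (hW : IsClosed (W : Set E)) [FiniteDimensional ℝ (E ⧸ W)] {δ : ℝ}
    (hδ : 0 < δ) : ∃ (Φ : Finset (StrongDual ℝ E)) (γ : ℝ), 0 < γ ∧
      ∀ x, (∀ φ ∈ Φ, |φ x| < γ) → Metric.infDist x W < δ := by
  classical
  obtain ⟨d, c, v, h⟩ := exists_coordinates_of_finite_quotient W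
  let φ : Fin d → StrongDual ℝ E := fun i => ⟨(c i).comp W.mkQ, continuous_comp_mkQ hW (c i)⟩
  refine ⟨Finset.univ.image φ, δ / (∑ i, ‖v i‖ + 1), by positivity, fun x hx => ?_⟩
  exact infDist_lt_of_coordinates v hδ (h x) fun i =>
    hx (φ i) (Finset.mem_image_of_mem φ (Finset.mem_univ i))

/-- For a weak* closed subspace of finite codimension, finitely many evaluations control the
distance, since the weak* continuous functionals are the evaluations. -/
theorem exists_finset_infDist_lt_of_weakStar_closed {E : Type*} [NormedAddCommGroup E]
    [NormedSpace ℝ E] {G : Submodule ℝ (StrongDual ℝ E)}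
    (hG : IsClosed (WeakDual.toStrongDual ⁻¹' (G : Set (StrongDual ℝ E))))
    [FiniteDimensional ℝ (StrongDual ℝ E ⧸ G)] {δ : ℝ} (hδ : 0 < δ) :
    ∃ (F : Finset E) (γ : ℝ), 0 < γ ∧
      ∀ φ : StrongDual ℝ E, (∀ f ∈ F, |φ f| < γ) → Metric.infDist φ G < δ := by
  classical
  let e : StrongDual ℝ E ≃ₗ[ℝ] WeakDual ℝ E := StrongDual.toWeakDual
  let G' : Submodule ℝ (WeakDual ℝ E) := G.map e.toLinearMap
  have hG' : IsClosed (G' : Set (WeakDual ℝ E)) := by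
    convert hG using 1
    ext φ
    constructor
    · rintro ⟨ψ, hψ, rfl⟩
      exact hψ
    · intro h
      exact ⟨WeakDual.toStrongDual φ, h, rfl⟩
  let q : (StrongDual ℝ E ⧸ G) ≃ₗ[ℝ] (WeakDual ℝ E ⧸ G') := Submodule.Quotient.equiv G G' e rfl
  have : FiniteDimensional ℝ (WeakDual ℝ E ⧸ G') := Module.Finite.equiv q
  obtain ⟨d, c, v, h⟩ := exists_coordinates_of_finite_quotient G
  have heval : ∀ i, ∃ y : E, ∀ φ : StrongDual ℝ E, c i (G.mkQ φ) = φ y := by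
    intro i
    have hcont := continuous_comp_mkQ hG' ((c i).comp q.symm.toLinearMap)
    let f : StrongDual ℝ (WeakBilin (topDualPairing ℝ E)) :=
      ⟨((c i).comp q.symm.toLinearMap).comp G'.mkQ, hcont⟩
    obtain ⟨y, hy⟩ := LinearMap.dualEmbedding_surjective (topDualPairing ℝ E) f
    refine ⟨y, fun φ => ?_⟩
    have h1 : f (e φ) = c i (G.mkQ φ) := by
      change c i (q.symm (G'.mkQ (e φ))) = _
      congr 1
    rw [← h1, ← hy]
    rfl
  choose y hy using heval
  refine ⟨Finset.univ.image y, δ / (∑ i, ‖v i‖ + 1), by positivity, fun φ hφ => ?_⟩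
  refine infDist_lt_of_coordinates v hδ (h φ) fun i => ?_
  rw [hy]
  exact hφ (y i) (Finset.mem_image_of_mem y (Finset.mem_univ i))

/-! ### Block operators on `X₀(𝐫)` -/

namespace IsHaarBlockSystem

variable {B : ℕ → Finset ℕ} {ε : ℕ → ℕ → ℝ}

/-- The operator of `X₀(𝐫)` that maps `h_k` to `∑_{K ∈ B k} ε k K • h_K` is a contraction. -/
theorem exists_operator (h : IsHaarBlockSystem B ε) (X : HaarSystemNorm)
    (r : rademacherFamilies) : ∃ T : HardySpaceZero X r →L[ℝ] HardySpaceZero X r,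
      (∀ j, T (haarBasisVector X r j) =
        ∑ K ∈ B (j + 1), ε (j + 1) K • haarBasisVector X r (K - 1)) ∧ ∀ y, ‖T y‖ ≤ ‖y‖ := by
  set v : ℕ → HardySpaceZero X r := fun j =>
    ∑ K ∈ B (j + 1), ε (j + 1) K • haarBasisVector X r (K - 1) with hv
  have hcoe : (hardySubspace X r).subtype ∘ₗ Finsupp.linearCombination ℝ v =
      hardyMk X r ∘ₗ blockMap B ε ∘ₗ Finsupp.lmapDomain ℝ ℝ Nat.succ := by
    refine Finsupp.lhom_ext fun j c => ?_
    simp only [LinearMap.comp_apply, Finsupp.linearCombination_single, Finsupp.lmapDomain_apply,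
      Finsupp.mapDomain_single, blockMap_single, map_smul, map_sum, hv]
    congr 1
    refine Finset.sum_congr rfl fun K hK => ?_
    obtain ⟨i, rfl⟩ := Nat.exists_eq_add_of_le' (h.one_le_of_mem (Nat.succ_pos j) hK)
    rw [hardyMk_single]
    rfl
  have hbound : ∀ a : ℕ →₀ ℝ, ‖Finsupp.linearCombination ℝ v a‖ ≤
      1 * ‖Finsupp.linearCombination ℝ (haarBasisVector X r) a‖ := by
    intro a
    have h1 : ‖Finsupp.linearCombination ℝ v a‖ =
        hardyNorm X r (blockMap B ε (a.mapDomain Nat.succ)) := by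
      rw [← norm_hardyMk]
      exact congrArg norm (LinearMap.congr_fun hcoe a)
    rw [one_mul, h1, norm_linearCombination_haar]
    exact h.hardyNorm_blockMap_le X r _
  have hd := denseRange_linearCombination_haar X r
  refine ⟨(Finsupp.linearCombination ℝ v).extendOfNorm
    (Finsupp.linearCombination ℝ (haarBasisVector X r)), fun j => ?_, fun y => ?_⟩
  · have := LinearMap.extendOfNorm_eq hd ⟨1, hbound⟩ (Finsupp.single j 1)
    simpa using this
  · simpa using LinearMap.norm_extendOfNorm_apply_le hd 1 hbound y

/-- The `L²`-adjoint of a block operator is a contraction of `X₀(𝐫)`. -/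
theorem exists_adjoint (h : IsHaarBlockSystem B ε) (X : HaarSystemNorm)
    (r : rademacherFamilies) : ∃ S : HardySpaceZero X r →L[ℝ] HardySpaceZero X r,
      (∀ j k, j + 1 ∈ B (k + 1) → S (haarBasisVector X r j) =
        (ε (k + 1) (j + 1) * haarLength (j + 1) / haarLength (k + 1)) • haarBasisVector X r k) ∧
      (∀ j, (∀ k, j + 1 ∉ B (k + 1)) → S (haarBasisVector X r j) = 0) ∧ ∀ y, ‖S y‖ ≤ ‖y‖ := by
  classical
  set v : ℕ → HardySpaceZero X r := fun j => if hex : ∃ k, j + 1 ∈ B (k + 1) then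
    (ε (hex.choose + 1) (j + 1) * haarLength (j + 1) / haarLength (hex.choose + 1)) •
      haarBasisVector X r hex.choose else 0 with hv
  have hv1 : ∀ j k, j + 1 ∈ B (k + 1) → v j =
      (ε (k + 1) (j + 1) * haarLength (j + 1) / haarLength (k + 1)) • haarBasisVector X r k := by
    intro j k hk
    have hex : ∃ k, j + 1 ∈ B (k + 1) := ⟨k, hk⟩
    have e : hex.choose = k := by
      have := h.injective _ _ _ hex.choose_spec hk
      omega
    simp only [hv]
    rw [dif_pos hex, e]
  have hv2 : ∀ j, (∀ k, j + 1 ∉ B (k + 1)) → v j = 0 := by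
    intro j hj
    simp only [hv]
    rw [dif_neg]
    simpa using hj
  have hcoe : (hardySubspace X r).subtype ∘ₗ Finsupp.linearCombination ℝ v =
      hardyMk X r ∘ₗ blockAdjoint B ε ∘ₗ Finsupp.lmapDomain ℝ ℝ Nat.succ := by
    refine Finsupp.lhom_ext fun j c => ?_
    simp only [LinearMap.comp_apply, Finsupp.linearCombination_single, Finsupp.lmapDomain_apply,
      Finsupp.mapDomain_single, map_smul]
    by_cases hex : ∃ k, j + 1 ∈ B (k + 1)
    · obtain ⟨k, hk⟩ := hex
      rw [hv1 j k hk, h.blockAdjoint_single hk, map_smul, map_smul, hardyMk_single]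
      rfl
    · push Not at hex
      rw [hv2 j hex, blockAdjoint_single_of_notMem ε, map_zero, map_zero, smul_zero]
      rintro (_ | k) hk
      · rw [h.zero_block] at hk
        simp at hk
      · exact hex k hk
  have hbound : ∀ a : ℕ →₀ ℝ, ‖Finsupp.linearCombination ℝ v a‖ ≤
      1 * ‖Finsupp.linearCombination ℝ (haarBasisVector X r) a‖ := by
    intro a
    have h1 : ‖Finsupp.linearCombination ℝ v a‖ =
        hardyNorm X r (blockAdjoint B ε (a.mapDomain Nat.succ)) := by
      rw [← norm_hardyMk]
      exact congrArg norm (LinearMap.congr_fun hcoe a)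
    rw [one_mul, h1, norm_linearCombination_haar]
    exact h.hardyNorm_blockAdjoint_le X r _
  have hd := denseRange_linearCombination_haar X r
  have hS : ∀ j, (Finsupp.linearCombination ℝ v).extendOfNorm
      (Finsupp.linearCombination ℝ (haarBasisVector X r)) (haarBasisVector X r j) = v j := fun j => by
    have := LinearMap.extendOfNorm_eq hd ⟨1, hbound⟩ (Finsupp.single j 1)
    simpa using this
  refine ⟨(Finsupp.linearCombination ℝ v).extendOfNorm
    (Finsupp.linearCombination ℝ (haarBasisVector X r)), fun j k hk => ?_, fun j hj => ?_,
    fun y => ?_⟩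
  · rw [hS, hv1 j k hk]
  · rw [hS, hv2 j hj]
  · simpa using LinearMap.norm_extendOfNorm_apply_le hd 1 hbound y

end IsHaarBlockSystem

theorem ext_haarBasisVector {X : HaarSystemNorm} {r : rademacherFamilies} {F : Type*}
    [NormedAddCommGroup F] [NormedSpace ℝ F] {S T : HardySpaceZero X r →L[ℝ] F}
    (h : ∀ j, S (haarBasisVector X r j) = T (haarBasisVector X r j)) : S = T := by
  have hd := denseRange_linearCombination_haar X r
  refine ContinuousLinearMap.ext fun y => hd.induction_on (p := fun y => S y = T y) y
    (isClosed_eq S.continuous T.continuous) fun a => ?_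
  rw [Finsupp.linearCombination_apply, Finsupp.sum, map_sum, map_sum]
  exact Finset.sum_congr rfl fun j _ => by rw [map_smul, map_smul, h]

/-- The intervals with numbers in `B` are pairwise disjoint. -/
def IsDisjointFamily (B : Finset ℕ) : Prop :=
  (∀ K ∈ B, 1 ≤ K) ∧
    ∀ K ∈ B, ∀ K' ∈ B, ∀ s, haarSystem K s ≠ 0 → haarSystem K' s ≠ 0 → K = K'

theorem IsDisjointFamily.isHaarBlockSystem {B : Finset ℕ} (hB : IsDisjointFamily B) {σ : ℕ → ℝ}
    (hσ : ∀ K ∈ B, |σ K| = 1) :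
    IsHaarBlockSystem (fun k => if k = 0 then {0} else if k = 1 then B else ∅)
      (fun k K => if k = 0 then 1 else σ K) where
  zero_block := by simp
  zero_sign := by simp
  abs_sign k K hK := by
    split_ifs at hK ⊢ with h1 h2
    · simp
    · exact hσ K hK
    · simp at hK
  disjoint k K hK K' hK' := by
    split_ifs at hK hK' with h1 h2
    · intros; simp at hK hK'; omega
    · exact hB.2 K hK K' hK'
    · simp at hK
  injective k l K hK hK' := by
    have h1 := hB.1 K
    have key : ∀ k, K ∈ (if k = 0 then {0} else if k = 1 then B else ∅ : Finset ℕ) →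
        (k = 0 ∧ K = 0) ∨ (k = 1 ∧ K ∈ B) := by
      intro k hK
      split_ifs at hK with h2 h3
      · exact Or.inl ⟨h2, by simpa using hK⟩
      · exact Or.inr ⟨h3, hK⟩
      · simp at hK
    rcases key k hK with ⟨rfl, h2⟩ | ⟨rfl, h2⟩ <;> rcases key l hK' with ⟨rfl, h3⟩ | ⟨rfl, h3⟩
    · rfl
    · have := h1 h3; omega
    · have := h1 h2; omega
    · rfl
  nested k hk K hK s hs := by
    split_ifs at hK with h1 h2
    · omega
    · subst h2
      have hs' := mem_Ico_of_haarSystem_ne_zero hs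
      simp [blockFunction, haarSystem_zero_apply hs', childSign]
    · simp at hK

theorem coord_haarBasisVector {X : HaarSystemNorm} {r : rademacherFamilies}
    {b : SchauderBasis ℝ (HardySpaceZero X r)}
    (hb : ∀ n, b n = ‖haarBasisVector X r n‖⁻¹ • haarBasisVector X r n) (i j : ℕ) :
    b.coord i (haarBasisVector X r j) = if i = j then ‖haarBasisVector X r j‖ else 0 := by
  have hne := norm_ne_zero_iff.2 (haarBasisVector_ne_zero X r j)
  have : haarBasisVector X r j = ‖haarBasisVector X r j‖ • b j := by
    rw [hb, smul_smul, mul_inv_cancel₀ hne, one_smul]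
  conv_lhs => rw [this]
  rw [map_smul, b.ortho, smul_eq_mul]
  by_cases hij : i = j
  · subst hij; simp
  · simp [hij]

/-! ### Smallness of fine disjoint families -/

/-- For `f ∈ X₀(𝐫)` the functionals `f ↦ ∑_{K ∈ B} ± |I_K| h_K*(f)`, where `B` is a disjoint family,
tend to zero as `B` becomes fine: they are uniformly bounded and vanish eventually on finite linear
combinations of the Haar system. -/
theorem eventually_abs_sum_coord_lt {X : HaarSystemNorm} {r : rademacherFamilies}
    {b : SchauderBasis ℝ (HardySpaceZero X r)}
    (hb : ∀ n, b n = ‖haarBasisVector X r n‖⁻¹ • haarBasisVector X r n)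
    (f : HardySpaceZero X r) {δ : ℝ} (hδ : 0 < δ) :
    ∀ᶠ N in atTop, ∀ B : Finset ℕ, IsDisjointFamily B → (∀ K ∈ B, N ≤ K) →
      ∀ σ : ℕ → ℝ, (∀ K ∈ B, |σ K| = 1) →
        |∑ K ∈ B, σ K * (haarLength K / ‖haarBasisVector X r (K - 1)‖) * b.coord (K - 1) f| < δ := by
  have hpos : ∀ n, 0 < ‖haarBasisVector X r n‖ :=
    fun n => norm_pos_iff.2 (haarBasisVector_ne_zero X r n)
  set c := ‖haarBasisVector X r 0‖ with hc
  obtain ⟨a, ha⟩ := (denseRange_linearCombination_haar X r).exists_dist_lt f (mul_pos hδ (hpos 0))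
  obtain ⟨n, hn⟩ := exists_forall_support_lt a
  filter_upwards [eventually_ge_atTop (n + 1)] with N hN B hB hBN σ hσ
  let ψ : StrongDual ℝ (HardySpaceZero X r) :=
    ∑ K ∈ B, (σ K * (haarLength K / ‖haarBasisVector X r (K - 1)‖)) • b.coord (K - 1)
  have hψ : ∀ y, ψ y =
      ∑ K ∈ B, σ K * (haarLength K / ‖haarBasisVector X r (K - 1)‖) * b.coord (K - 1) y := by
    intro y
    simp [ψ, mul_assoc]
  have hψu : ∀ j, ψ (haarBasisVector X r j) =
      if j + 1 ∈ B then σ (j + 1) * haarLength (j + 1) else 0 := by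
    intro j
    rw [hψ]
    simp only [coord_haarBasisVector hb, mul_ite, mul_zero]
    split_ifs with hj
    · rw [Finset.sum_eq_single_of_mem (j + 1) hj]
      · rw [if_pos (by omega), Nat.add_sub_cancel, mul_assoc, div_mul_cancel₀ _ (hpos j).ne']
      · intro K hK hKj
        rw [if_neg]
        have := hB.1 K hK
        omega
    · refine Finset.sum_eq_zero fun K hK => ?_
      rw [if_neg]
      have := hB.1 K hK
      rintro rfl
      rw [Nat.sub_add_cancel this] at hj
      exact hj hK
  obtain ⟨S, hS1, hS2, hS3⟩ := (hB.isHaarBlockSystem hσ).exists_adjoint X r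
  have hS : S = ψ.smulRight (haarBasisVector X r 0) := by
    refine ext_haarBasisVector fun j => ?_
    rw [ContinuousLinearMap.smulRight_apply, hψu]
    split_ifs with hj
    · rw [hS1 j 0 (by simpa using hj)]
      simp
    · rw [hS2 j, zero_smul]
      rintro (_ | k) hk
      · exact hj (by simpa using hk)
      · simp at hk
  have hbound : ∀ y, |ψ y| * c ≤ ‖y‖ := by
    intro y
    have := hS3 y
    rwa [hS, ContinuousLinearMap.smulRight_apply, norm_smul, Real.norm_eq_abs] at this
  have hzero : ψ (Finsupp.linearCombination ℝ (haarBasisVector X r) a) = 0 := by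
    rw [Finsupp.linearCombination_apply, Finsupp.sum, map_sum]
    refine Finset.sum_eq_zero fun j hj => ?_
    rw [map_smul, hψu, if_neg, smul_zero]
    intro hc
    have := hBN _ hc
    have := hn j hj
    omega
  rw [← hψ]
  have h1 := hbound (f - Finsupp.linearCombination ℝ (haarBasisVector X r) a)
  rw [map_sub, hzero, sub_zero, ← dist_eq_norm] at h1
  exact lt_of_mul_lt_mul_right (h1.trans_lt ha) (hpos 0).le

/-- A disjoint family of intervals with numbers at least `2 ^ l` is contained in a finite partition
of `[0,1)` into such intervals. -/
theorem IsDisjointFamily.exists_partition {B : Finset ℕ} (hB : IsDisjointFamily B) {l : ℕ}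
    (hl : ∀ K ∈ B, 2 ^ l ≤ K) : ∃ F : Finset ℕ, B ⊆ F ∧ IsDisjointFamily F ∧
      (∀ K ∈ F, 2 ^ l ≤ K) ∧ ∀ s ∈ Set.Ico (0 : ℝ) 1, ∃ K ∈ F, haarSystem K s ≠ 0 := by
  classical
  obtain ⟨L, hL, hBL⟩ : ∃ L, l ≤ L ∧ ∀ K ∈ B, K < 2 ^ L := by
    refine ⟨l + B.sup id, by omega, fun K hK => lt_of_le_of_lt ?_ Nat.lt_two_pow_self⟩
    have : K ≤ B.sup id := Finset.le_sup (f := id) hK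
    omega
  let R : Finset ℕ := (Finset.Ico (2 ^ L) (2 ^ (L + 1))).filter fun K =>
    ∀ K' ∈ B, ∀ s, haarSystem K s ≠ 0 → haarSystem K' s = 0
  have hR : ∀ K ∈ R, (2 ^ L ≤ K ∧ K < 2 ^ (L + 1)) ∧
      ∀ K' ∈ B, ∀ s, haarSystem K s ≠ 0 → haarSystem K' s = 0 := fun K hK => by
    simpa [R] using hK
  have h1 : 1 ≤ 2 ^ L := Nat.one_le_two_pow
  have hlog : ∀ K ∈ R, Nat.log 2 K = L := fun K hK =>
    Nat.log_eq_of_pow_le_of_lt_pow (hR K hK).1.1 (hR K hK).1.2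
  refine ⟨B ∪ R, Finset.subset_union_left, ⟨fun K hK => ?_, fun K hK K' hK' s hs hs' => ?_⟩,
    fun K hK => ?_, fun s hs => ?_⟩
  · rcases Finset.mem_union.1 hK with h | h
    · exact hB.1 K h
    · exact h1.trans (hR K h).1.1
  · rcases Finset.mem_union.1 hK with h | h <;> rcases Finset.mem_union.1 hK' with h' | h'
    · exact hB.2 K h K' h' s hs hs'
    · exact absurd ((hR K' h').2 K h s hs') hs
    · exact absurd ((hR K h).2 K' h' s hs) hs'
    · have hs0 := mem_Ico_of_haarSystem_ne_zero hs
      rw [haarSystem_ne_zero_iff (h1.trans (hR K h).1.1) hs0, hlog K h] at hs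
      rw [haarSystem_ne_zero_iff (h1.trans (hR K' h').1.1) hs0, hlog K' h'] at hs'
      rw [← hs, ← hs']
  · rcases Finset.mem_union.1 hK with h | h
    · exact hl K h
    · exact (Nat.pow_le_pow_right (by norm_num) hL).trans (hR K h).1.1
  · by_cases hex : ∃ K ∈ B, haarSystem K s ≠ 0
    · obtain ⟨K, hK, hKs⟩ := hex
      exact ⟨K, Finset.mem_union_left _ hK, hKs⟩
    · push Not at hex
      have hn := log_dyadicNode L hs
      have hKs : haarSystem (dyadicNode L s) s ≠ 0 := by
        rw [haarSystem_ne_zero_iff (dyadicNode_pos L s) hs, hn]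
      refine ⟨dyadicNode L s, Finset.mem_union_right _ ?_, hKs⟩
      simp only [R, Finset.mem_filter, Finset.mem_Ico]
      refine ⟨⟨le_dyadicNode L s, dyadicNode_lt L hs⟩, fun K' hK' t ht => ?_⟩
      rw [haarSystem_eq_of_lt ((hBL K' hK').trans_le (le_dyadicNode L s)) ht hKs, hex K' hK']

/-- The number of the node at depth `m` of the binary tree that is reached by following the signs of
the functions `∑_{K ∈ F l} σ K h_K`, `l < m`, at the point `s`. -/
def branchNode (F : ℕ → Finset ℕ) (σ : ℕ → ℝ) : ℕ → ℝ → ℕ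
  | 0, _ => 1
  | m + 1, s => 2 * branchNode F σ m s + if ∑ K ∈ F m, σ K * haarSystem K s = 1 then 0 else 1

theorem log_branchNode (F : ℕ → Finset ℕ) (σ : ℕ → ℝ) (m : ℕ) (s : ℝ) :
    Nat.log 2 (branchNode F σ m s) = m ∧ 1 ≤ branchNode F σ m s := by
  induction m with
  | zero => simp [branchNode]
  | succ m ih =>
    have h2 : branchNode F σ (m + 1) s / 2 = branchNode F σ m s := by
      rw [branchNode]; split_ifs <;> omega
    have h3 : 2 ≤ branchNode F σ (m + 1) s := by
      rw [branchNode]; omega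
    rw [log_div_two h3, h2, ih.1]
    exact ⟨rfl, by omega⟩

theorem branchNode_eq {F : ℕ → Finset ℕ} (σ : ℕ → ℝ) {m K : ℕ}
    (hlt : ∀ l < m, ∀ K' ∈ F l, K' < K) {s t : ℝ} (hs : haarSystem K s ≠ 0)
    (ht : haarSystem K t ≠ 0) : branchNode F σ m s = branchNode F σ m t := by
  induction m with
  | zero => rfl
  | succ m ih =>
    rw [branchNode, branchNode, ih fun l hl => hlt l (by omega)]
    congr 2
    refine congrArg (· = (1 : ℝ)) (Finset.sum_congr rfl fun K' hK' => ?_)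
    rw [haarSystem_eq_of_lt (hlt m (by omega) K' hK') hs ht]

open Classical in
/-- The block system obtained from a sequence of finer and finer partitions `F m` of `[0,1)`: the
intervals of `F m` are distributed among the blocks with numbers `2 ^ m ≤ k < 2 ^ (m + 1)`. -/
def branchBlocks (F : ℕ → Finset ℕ) (σ : ℕ → ℝ) (k : ℕ) : Finset ℕ :=
  if k = 0 then {0} else
    (F (Nat.log 2 k)).filter fun K => ∃ s, haarSystem K s ≠ 0 ∧ branchNode F σ (Nat.log 2 k) s = k

section Branch

variable {F : ℕ → Finset ℕ} {σ : ℕ → ℝ}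

theorem mem_branchBlocks {k K : ℕ} (hk : 1 ≤ k) : K ∈ branchBlocks F σ k ↔
    K ∈ F (Nat.log 2 k) ∧ ∃ s, haarSystem K s ≠ 0 ∧ branchNode F σ (Nat.log 2 k) s = k := by
  classical
  rw [branchBlocks, if_neg (by omega), Finset.mem_filter]

theorem mem_branchBlocks_branchNode {m K : ℕ} (hK : K ∈ F m) {s : ℝ} (hs : haarSystem K s ≠ 0) :
    K ∈ branchBlocks F σ (branchNode F σ m s) := by
  obtain ⟨h1, h2⟩ := log_branchNode F σ m s
  rw [mem_branchBlocks h2, h1]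
  exact ⟨hK, s, hs, rfl⟩

theorem branchNode_eq_of_mem (hlt : ∀ l m, l < m → ∀ K' ∈ F l, ∀ K ∈ F m, K' < K) {k K : ℕ}
    (hk : 1 ≤ k) (hK : K ∈ branchBlocks F σ k) {s : ℝ} (hs : haarSystem K s ≠ 0) :
    branchNode F σ (Nat.log 2 k) s = k := by
  obtain ⟨hKF, t, ht, hkt⟩ := (mem_branchBlocks hk).1 hK
  rw [← hkt, log_branchNode F σ _ t |>.1]
  exact branchNode_eq σ (fun l hl K' hK' => hlt l _ hl K' hK' K hKF) hs ht

theorem isHaarBlockSystem_branchBlocks (hF : ∀ m, IsDisjointFamily (F m))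
    (hcover : ∀ m, ∀ s ∈ Set.Ico (0 : ℝ) 1, ∃ K ∈ F m, haarSystem K s ≠ 0)
    (hlt : ∀ l m, l < m → ∀ K' ∈ F l, ∀ K ∈ F m, K' < K) (hσ : ∀ K, σ K = 1 ∨ σ K = -1) :
    IsHaarBlockSystem (branchBlocks F σ) (fun k K => if k = 0 then 1 else σ K) where
  zero_block := by simp [branchBlocks]
  zero_sign := by simp
  abs_sign k K _ := by
    split_ifs
    · simp
    · rcases hσ K with h | h <;> simp [h]
  disjoint k K hK K' hK' s hs hs' := by
    rcases Nat.eq_zero_or_pos k with rfl | hk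
    · simp only [branchBlocks, if_true, Finset.mem_singleton] at hK hK'
      rw [hK, hK']
    · exact (hF _).2 K ((mem_branchBlocks hk).1 hK).1 K' ((mem_branchBlocks hk).1 hK').1 s hs hs'
  injective k l K hK hK' := by
    have key : ∀ l, K = 0 → K ∈ branchBlocks F σ l → l = 0 := by
      intro l h0 hl
      by_contra hl0
      have := (hF _).1 K ((mem_branchBlocks (by omega)).1 hl).1
      omega
    rcases Nat.eq_zero_or_pos k with rfl | hk
    · rw [key l (by simpa [branchBlocks] using hK) hK']
    rcases Nat.eq_zero_or_pos l with rfl | hl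
    · rw [key k (by simpa [branchBlocks] using hK') hK]
    obtain ⟨h1, s, hs, h2⟩ := (mem_branchBlocks hk).1 hK
    obtain ⟨h3, -⟩ := (mem_branchBlocks hl).1 hK'
    have h4 := branchNode_eq_of_mem hlt hl hK' hs
    rcases Nat.lt_trichotomy (Nat.log 2 k) (Nat.log 2 l) with h | h | h
    · exact absurd (hlt _ _ h K h1 K h3) (lt_irrefl _)
    · rw [← h2, ← h4, h]
    · exact absurd (hlt _ _ h K h3 K h1) (lt_irrefl _)
  nested k hk K hK s hs := by
    have hs0 := mem_Ico_of_haarSystem_ne_zero hs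
    rcases Nat.lt_or_ge k 2 with h2 | h2
    · obtain rfl : k = 1 := by omega
      simp [blockFunction, branchBlocks, childSign, haarSystem_zero_apply hs0]
    · have hnode := branchNode_eq_of_mem hlt hk hK hs
      rw [log_div_two h2, branchNode] at hnode
      set p := branchNode F σ (Nat.log 2 (k / 2)) s with hp
      have hpk : p = k / 2 := by split_ifs at hnode <;> omega
      obtain ⟨K', hK', hs'⟩ := hcover (Nat.log 2 (k / 2)) s hs0
      have hmem : K' ∈ branchBlocks F σ (k / 2) := by
        have := mem_branchBlocks_branchNode (σ := σ) hK' hs'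
        rwa [← hp, hpk] at this
      have e1 : ∑ K ∈ F (Nat.log 2 (k / 2)), σ K * haarSystem K s = σ K' * haarSystem K' s := by
        refine Finset.sum_eq_single_of_mem K' hK' fun K'' hK'' hne => ?_
        by_contra hc
        exact hne ((hF _).2 K'' hK'' K' hK' s (right_ne_zero_of_mul hc) hs')
      have e2 : blockFunction (branchBlocks F σ) (fun k K => if k = 0 then 1 else σ K) (k / 2) s =
          σ K' * haarSystem K' s := by
        have h0 : k / 2 ≠ 0 := by omega
        simp only [blockFunction, if_neg h0]
        refine Finset.sum_eq_single_of_mem K' hmem fun K'' hK'' hne => ?_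
        by_contra hc
        exact hne ((hF _).2 K'' ((mem_branchBlocks (by omega)).1 hK'').1 K' hK' s
          (right_ne_zero_of_mul hc) hs')
      have e3 : σ K' * haarSystem K' s = 1 ∨ σ K' * haarSystem K' s = -1 := by
        rcases hσ K' with h | h <;> rcases haarSystem_trichotomy K' s with h' | h' | h' <;>
          first | exact absurd h' hs' | simp [h, h']
      rw [e2]
      rw [e1] at hnode
      unfold childSign
      rcases e3 with h | h <;> rw [h] at hnode ⊢
      · rw [if_pos rfl] at hnode
        rw [if_pos (by omega)]
      · rw [if_neg (by norm_num)] at hnode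
        rw [if_neg (by omega)]

/-- The blocks with numbers `2 ^ m ≤ k < 2 ^ (m + 1)` make up the partition `F m`. -/
theorem sum_branchBlocks (hF : ∀ m, IsDisjointFamily (F m))
    (hcover : ∀ m, ∀ s ∈ Set.Ico (0 : ℝ) 1, ∃ K ∈ F m, haarSystem K s ≠ 0)
    (hlt : ∀ l m, l < m → ∀ K' ∈ F l, ∀ K ∈ F m, K' < K) (hσ : ∀ K, σ K = 1 ∨ σ K = -1)
    {A : Type*} [AddCommMonoid A] (g : ℕ → A) (m : ℕ) :
    ∑ i ∈ Finset.range (2 ^ m), ∑ K ∈ branchBlocks F σ (2 ^ m + i), g K = ∑ K ∈ F m, g K := by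
  classical
  have hsys := isHaarBlockSystem_branchBlocks hF hcover hlt hσ
  have h0 : 1 ≤ 2 ^ m := Nat.one_le_two_pow
  rw [← Finset.sum_biUnion]
  · congr 1
    ext K
    simp only [Finset.mem_biUnion, Finset.mem_range]
    constructor
    · rintro ⟨i, hi, hK⟩
      have : Nat.log 2 (2 ^ m + i) = m :=
        Nat.log_eq_of_pow_le_of_lt_pow (by omega) (by rw [pow_succ]; omega)
      have hK' := ((mem_branchBlocks (by omega)).1 hK).1
      rwa [this] at hK'
    · intro hK
      obtain ⟨s, hs⟩ := exists_haarSystem_ne_zero K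
      obtain ⟨h1, h2⟩ := log_branchNode F σ m s
      have h3 : 2 ^ m ≤ branchNode F σ m s := by
        conv_lhs => rw [← h1]
        exact Nat.pow_log_le_self 2 (by omega)
      have h4 : branchNode F σ m s < 2 ^ (m + 1) := by
        conv_rhs => rw [← h1]
        exact Nat.lt_pow_succ_log_self (by norm_num) _
      rw [pow_succ] at h4
      refine ⟨branchNode F σ m s - 2 ^ m, by omega, ?_⟩
      rw [Nat.add_sub_cancel' h3]
      exact mem_branchBlocks_branchNode hK hs
  · intro i _ j _ hij
    refine Finset.disjoint_left.2 fun K hK hK' => hij ?_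
    have := hsys.injective _ _ K hK hK'
    omega

end Branch

/-- If the Rademacher functions are weakly null, then a functional is small on all fine disjoint
families. Otherwise there is a sequence of finer and finer partitions `F m` of `[0,1)` on which it
is large; distributing their members among blocks yields an operator that maps `r_m` to
`∑_{K ∈ F m} ± h_K`. -/
theorem eventually_sum_abs_lt {X : HaarSystemNorm} {r : rademacherFamilies}
    (hweak : ∀ φ : StrongDual ℝ (HardySpaceZero X r),
      Tendsto (fun n => φ (rademacherVector X r n)) atTop (𝓝 0))
    (φ : StrongDual ℝ (HardySpaceZero X r)) {δ : ℝ} (hδ : 0 < δ) :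
    ∀ᶠ N in atTop, ∀ B : Finset ℕ, IsDisjointFamily B → (∀ K ∈ B, N ≤ K) →
      ∑ K ∈ B, |φ (haarBasisVector X r (K - 1))| < δ := by
  classical
  by_contra hcon
  have hbig : ∀ n, ∃ F : Finset ℕ, IsDisjointFamily F ∧ (∀ K ∈ F, n < K) ∧
      (∀ s ∈ Set.Ico (0 : ℝ) 1, ∃ K ∈ F, haarSystem K s ≠ 0) ∧
      δ ≤ ∑ K ∈ F, |φ (haarBasisVector X r (K - 1))| := by
    intro n
    rw [Filter.not_eventually] at hcon
    obtain ⟨N, hN, hc⟩ := frequently_atTop.1 hcon (2 ^ n)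
    push Not at hc
    obtain ⟨B, hB, hBN, hsum⟩ := hc
    obtain ⟨F, hBF, hF, hFn, hcover⟩ := hB.exists_partition fun K hK => hN.trans (hBN K hK)
    exact ⟨F, hF, fun K hK => Nat.lt_two_pow_self.trans_le (hFn K hK), hcover,
      hsum.trans (Finset.sum_le_sum_of_subset_of_nonneg hBF fun _ _ _ => abs_nonneg _)⟩
  choose G hG1 hG2 hG3 hG4 using hbig
  let F : ℕ → Finset ℕ := fun m => m.rec (G 0) fun _ A => G (A.sup id)
  have hFsucc : ∀ m, F (m + 1) = G ((F m).sup id) := fun _ => rfl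
  have hFG : ∀ m, ∃ n, F m = G n := by
    rintro (_ | m)
    exacts [⟨0, rfl⟩, ⟨_, hFsucc m⟩]
  have hF : ∀ m, IsDisjointFamily (F m) := fun m => by
    obtain ⟨n, hn⟩ := hFG m
    rw [hn]; exact hG1 n
  have hcover : ∀ m, ∀ s ∈ Set.Ico (0 : ℝ) 1, ∃ K ∈ F m, haarSystem K s ≠ 0 := fun m => by
    obtain ⟨n, hn⟩ := hFG m
    rw [hn]; exact hG3 n
  have hsum : ∀ m, δ ≤ ∑ K ∈ F m, |φ (haarBasisVector X r (K - 1))| := fun m => by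
    obtain ⟨n, hn⟩ := hFG m
    rw [hn]; exact hG4 n
  have hstep : ∀ m, ∀ K' ∈ F m, ∀ K ∈ F (m + 1), K' < K := by
    intro m K' hK' K hK
    have h1 : K' ≤ (F m).sup id := Finset.le_sup (f := id) hK'
    rw [hFsucc] at hK
    exact h1.trans_lt (hG2 _ K hK)
  have hne : ∀ m, (F m).Nonempty := fun m => by
    obtain ⟨K, hK, -⟩ := hcover m 0 ⟨le_rfl, one_pos⟩
    exact ⟨K, hK⟩
  have hlt : ∀ l m, l < m → ∀ K' ∈ F l, ∀ K ∈ F m, K' < K := by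
    intro l m hlm
    induction m with
    | zero => omega
    | succ m ih =>
      intro K' hK' K hK
      rcases Nat.lt_succ_iff_lt_or_eq.1 hlm with h | rfl
      · obtain ⟨K'', hK''⟩ := hne m
        exact (ih h K' hK' K'' hK'').trans (hstep m K'' hK'' K hK)
      · exact hstep l K' hK' K hK
  let σ : ℕ → ℝ := fun K => if 0 ≤ φ (haarBasisVector X r (K - 1)) then 1 else -1
  have hσ : ∀ K, σ K = 1 ∨ σ K = -1 := fun K => by
    simp only [σ]; split_ifs <;> simp
  have hσφ : ∀ K, σ K * φ (haarBasisVector X r (K - 1)) = |φ (haarBasisVector X r (K - 1))| := by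
    intro K
    simp only [σ]
    split_ifs with h
    · rw [one_mul, abs_of_nonneg h]
    · rw [neg_one_mul, abs_of_neg (not_le.1 h)]
  obtain ⟨T, hT, -⟩ := (isHaarBlockSystem_branchBlocks hF hcover hlt hσ).exists_operator X r
  have hTr : ∀ m, (φ.comp T) (rademacherVector X r m) =
      ∑ K ∈ F m, |φ (haarBasisVector X r (K - 1))| := by
    intro m
    rw [← sum_branchBlocks hF hcover hlt hσ, rademacherVector, map_sum]
    refine Finset.sum_congr rfl fun i _ => ?_
    have h0 : 1 ≤ 2 ^ m := Nat.one_le_two_pow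
    have e : 2 ^ m - 1 + i + 1 = 2 ^ m + i := by omega
    rw [ContinuousLinearMap.comp_apply, hT, e, map_sum]
    refine Finset.sum_congr rfl fun K _ => ?_
    rw [if_neg (by omega), map_smul, smul_eq_mul, hσφ]
  have hlim := hweak (φ.comp T)
  simp only [hTr] at hlim
  exact absurd (ge_of_tendsto' hlim hsum) (not_le.2 hδ)

/-! ### Selection of intervals -/

/-- The set of points that lie in infinitely many of the dyadic intervals with numbers in `M`. -/
def limsupSet (M : Set ℕ) : Set ℝ := {s | ∃ᶠ K in atTop, K ∈ M ∧ haarSystem K s ≠ 0}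

theorem measurable_haarSystem (n : ℕ) : Measurable (haarSystem n) := by
  have : haarSystem n = stepFunction n fun i => haarSystem n (dyadicPoint n i) :=
    (isStepOfLevel_haarSystem Nat.lt_two_pow_self).eq_stepFunction
  rw [this]
  exact measurable_stepFunction _

theorem measurableSet_haarSystem_ne_zero (n : ℕ) : MeasurableSet {s | haarSystem n s ≠ 0} :=
  (measurable_haarSystem n) (measurableSet_singleton 0).compl

theorem measurableSet_limsupSet (M : Set ℕ) : MeasurableSet (limsupSet M) := by
  have : limsupSet M = ⋂ n : ℕ, ⋃ K : ℕ, ⋃ _ : n ≤ K ∧ K ∈ M, {s | haarSystem K s ≠ 0} := by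
    ext s
    simp only [limsupSet, Set.mem_ofPred_eq, frequently_atTop, Set.mem_iInter, Set.mem_iUnion,
      exists_prop, and_assoc]
  rw [this]
  exact MeasurableSet.iInter fun n => MeasurableSet.iUnion fun K => MeasurableSet.iUnion fun _ =>
    measurableSet_haarSystem_ne_zero K

theorem limsupSet_subset (M : Set ℕ) : limsupSet M ⊆ Set.Ico 0 1 := by
  intro s hs
  obtain ⟨K, hK⟩ := Frequently.exists hs
  exact mem_Ico_of_haarSystem_ne_zero hK.2

theorem frequently_haarSystem_ne_zero {s : ℝ} (hs : s ∈ Set.Ico (0 : ℝ) 1) :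
    ∃ᶠ K in atTop, 1 ≤ K ∧ haarSystem K s ≠ 0 := by
  rw [frequently_atTop]
  intro n
  refine ⟨dyadicNode n s, Nat.lt_two_pow_self.le.trans (le_dyadicNode n s), dyadicNode_pos n s, ?_⟩
  rw [haarSystem_ne_zero_iff (dyadicNode_pos n s) hs, log_dyadicNode n hs]

/-- If the dyadic intervals are divided into two collections, then one of them has a limes superior
of measure at least `1 / 2`. -/
theorem exists_half_le_volume_limsupSet {N : Fin 2 → Set ℕ} (hN : IsCompl (N 0) (N 1)) :
    ∃ i, 1 / 2 ≤ volume.real (limsupSet {K | 1 ≤ K ∧ K - 1 ∈ N i}) := by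
  by_contra! hcon
  set A : Fin 2 → Set ℝ := fun i => limsupSet {K | 1 ≤ K ∧ K - 1 ∈ N i} with hA
  have hfin : ∀ i, volume (A i) ≠ ⊤ := fun i =>
    ((measure_mono (limsupSet_subset _)).trans_lt (by simp)).ne
  have hsub : Set.Ico (0 : ℝ) 1 ⊆ A 0 ∪ A 1 := by
    intro s hs
    have h := frequently_haarSystem_ne_zero hs
    have h2 : ∃ᶠ K in atTop, (K ∈ {K | 1 ≤ K ∧ K - 1 ∈ N 0} ∧ haarSystem K s ≠ 0) ∨
        (K ∈ {K | 1 ≤ K ∧ K - 1 ∈ N 1} ∧ haarSystem K s ≠ 0) := by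
      refine h.mono fun K hK => ?_
      have : K - 1 ∈ N 0 ⊔ N 1 := by rw [hN.sup_eq_top]; trivial
      rcases this with h' | h'
      · exact Or.inl ⟨⟨hK.1, h'⟩, hK.2⟩
      · exact Or.inr ⟨⟨hK.1, h'⟩, hK.2⟩
    exact frequently_or_distrib.1 h2
  have h1 : volume.real (Set.Ico (0 : ℝ) 1) ≤ volume.real (A 0 ∪ A 1) :=
    measureReal_mono hsub (measure_union_ne_top (hfin 0) (hfin 1))
  have h2 := measureReal_union_le (μ := volume) (A 0) (A 1)
  have h3 : volume.real (Set.Ico (0 : ℝ) 1) = 1 := by simp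
  linarith [hcon 0, hcon 1]

theorem abs_sub_lt_haarLength {K : ℕ} (hK : 1 ≤ K) {s t : ℝ} (hs : haarSystem K s ≠ 0)
    (ht : haarSystem K t ≠ 0) : |t - s| < haarLength K := by
  have hs0 := mem_Ico_of_haarSystem_ne_zero hs
  have ht0 := mem_Ico_of_haarSystem_ne_zero ht
  rw [haarSystem_ne_zero_iff hK hs0] at hs
  rw [haarSystem_ne_zero_iff hK ht0] at ht
  have h : ⌊(2 : ℝ) ^ Nat.log 2 K * t⌋₊ = ⌊(2 : ℝ) ^ Nat.log 2 K * s⌋₊ :=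
    Nat.add_left_cancel (ht.trans hs.symm)
  set p : ℝ := 2 ^ Nat.log 2 K with hp
  have hpos : 0 < p := by positivity
  have h1 := Nat.floor_le (mul_nonneg hpos.le hs0.1)
  have h2 := Nat.floor_le (mul_nonneg hpos.le ht0.1)
  have h3 := Nat.lt_floor_add_one (p * s)
  have h4 := Nat.lt_floor_add_one (p * t)
  rw [h] at h2 h4
  have h5 : |p * (t - s)| < 1 := by
    rw [abs_lt]; constructor <;> linarith
  rw [abs_mul, abs_of_pos hpos] at h5
  rw [haarLength, ← hp, ← one_div, lt_div_iff₀ hpos]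
  linarith [mul_comm p |t - s|]

theorem eventually_haarLength_lt {δ : ℝ} (hδ : 0 < δ) : ∀ᶠ K in atTop, haarLength K < δ := by
  obtain ⟨p, hp⟩ := exists_pow_lt_of_lt_one hδ (by norm_num : (1 / 2 : ℝ) < 1)
  filter_upwards [eventually_ge_atTop (2 ^ p)] with K hK
  refine lt_of_le_of_lt ?_ hp
  have : p ≤ Nat.log 2 K := Nat.le_log_of_pow_le (by norm_num) hK
  rw [haarLength, one_div, inv_pow]
  exact inv_anti₀ (by positivity) (pow_le_pow_right₀ (by norm_num) this)

theorem volume_haarSystem_eq {K : ℕ} (hK : 1 ≤ K) {v : ℝ} (hv : v = 1 ∨ v = -1) :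
    volume.real {s | haarSystem K s = v} = haarLength K / 2 := by
  have h1 : 2 ^ Nat.log 2 K ≤ K := Nat.pow_log_le_self 2 (by omega)
  have h2 : K < 2 ^ (Nat.log 2 K + 1) := Nat.lt_pow_succ_log_self (by norm_num) K
  rw [pow_succ] at h2
  have key : ∀ i, i < 2 ^ (Nat.log 2 K + 1) →
      volume.real {s | s ∈ Set.Ico (0 : ℝ) 1 ∧
        dyadicNode (Nat.log 2 K + 1) s = 2 ^ (Nat.log 2 K + 1) + i} = haarLength K / 2 := by
    intro i hi
    have : {s | s ∈ Set.Ico (0 : ℝ) 1 ∧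
        dyadicNode (Nat.log 2 K + 1) s = 2 ^ (Nat.log 2 K + 1) + i} =
        dyadicInterval (Nat.log 2 K + 1) i := by
      ext s
      constructor
      · rintro ⟨hs, h⟩
        exact (mem_dyadicInterval_iff hs.1).2 (Nat.add_left_cancel h)
      · intro hs
        have hs0 := dyadicInterval_subset hi hs
        refine ⟨hs0, ?_⟩
        rw [dyadicNode, (mem_dyadicInterval_iff hs0.1).1 hs]
    rw [this, Measure.real, volume_dyadicInterval, ENNReal.toReal_ofReal (by positivity),
      haarLength, pow_succ, mul_inv]
    rfl
  rcases hv with rfl | rfl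
  · rw [← key (2 * (K - 2 ^ Nat.log 2 K)) (by rw [pow_succ]; omega)]
    congr 1
    ext s
    simp only [Set.mem_ofPred_eq]
    by_cases hs : s ∈ Set.Ico (0 : ℝ) 1
    · rw [haarSystem_apply hK hs, pow_succ]
      split_ifs <;> simp [hs.1, hs.2] <;> norm_num <;> omega
    · simp [haarSystem_of_notMem K hs, hs]
  · rw [← key (2 * (K - 2 ^ Nat.log 2 K) + 1) (by rw [pow_succ]; omega)]
    congr 1
    ext s
    simp only [Set.mem_ofPred_eq]
    by_cases hs : s ∈ Set.Ico (0 : ℝ) 1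
    · rw [haarSystem_apply hK hs, pow_succ]
      split_ifs <;> simp [hs.1, hs.2] <;> norm_num <;> omega
    · simp [haarSystem_of_notMem K hs, hs]

theorem volume_haarSystem_ne_zero {K : ℕ} (hK : 1 ≤ K) :
    volume.real {s | haarSystem K s ≠ 0} = haarLength K := by
  have hfin : ∀ v : ℝ, v ≠ 0 → volume {s | haarSystem K s = v} ≠ ⊤ := fun v hv =>
    ((measure_mono fun s hs => mem_Ico_of_haarSystem_ne_zero (n := K)
      (by rw [hs.out]; exact hv)).trans_lt (by simp : volume (Set.Ico (0 : ℝ) 1) < ⊤)).ne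
  have : {s | haarSystem K s ≠ 0} = {s | haarSystem K s = 1} ∪ {s | haarSystem K s = -1} := by
    ext s
    rcases haarSystem_trichotomy K s with h | h | h <;> simp [h]
  rw [this, measureReal_union _ _ (hfin 1 one_ne_zero) (hfin (-1) (by norm_num)),
    volume_haarSystem_eq hK (Or.inl rfl), volume_haarSystem_eq hK (Or.inr rfl), add_halves]
  · refine Set.disjoint_left.2 fun s (h1 : _ = _) (h2 : _ = _) => ?_
    rw [h1] at h2
    norm_num at h2
  · exact (measurable_haarSystem K) (measurableSet_singleton _)

theorem IsDisjointFamily.volume_biUnion {B : Finset ℕ} (hB : IsDisjointFamily B) :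
    volume.real (⋃ K ∈ B, {s | haarSystem K s ≠ 0}) = ∑ K ∈ B, haarLength K := by
  have hfin : ∀ K ∈ B, volume {s | haarSystem K s ≠ 0} ≠ ⊤ := fun K _ =>
    ((measure_mono fun s hs => mem_Ico_of_haarSystem_ne_zero hs).trans_lt
      (by simp : volume (Set.Ico (0 : ℝ) 1) < ⊤)).ne
  rw [measureReal_biUnion_finset (h := hfin)]
  · exact Finset.sum_congr rfl fun K hK => volume_haarSystem_ne_zero (hB.1 K hK)
  · intro K hK K' hK' hne
    exact Set.disjoint_left.2 fun s hs hs' => hne (hB.2 K hK K' hK' s hs hs')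
  · exact fun K _ => measurableSet_haarSystem_ne_zero K

theorem IsDisjointFamily.sum_eq {B : Finset ℕ} (hB : IsDisjointFamily B) (σ : ℕ → ℝ) {K : ℕ}
    (hK : K ∈ B) {s : ℝ} (hs : haarSystem K s ≠ 0) :
    ∑ K' ∈ B, σ K' * haarSystem K' s = σ K * haarSystem K s := by
  refine Finset.sum_eq_single_of_mem K hK fun K' hK' hne => ?_
  by_contra hc
  exact hne (hB.2 K' hK' K hK s (right_ne_zero_of_mul hc) hs)

theorem IsDisjointFamily.volume_sum_eq {B : Finset ℕ} (hB : IsDisjointFamily B) {σ : ℕ → ℝ}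
    (hσ : ∀ K ∈ B, |σ K| = 1) {v : ℝ} (hv : v = 1 ∨ v = -1) :
    volume.real {s | ∑ K ∈ B, σ K * haarSystem K s = v} = (∑ K ∈ B, haarLength K) / 2 := by
  have hv0 : v ≠ 0 := by rcases hv with rfl | rfl <;> norm_num
  have hσ' : ∀ K ∈ B, σ K = 1 ∨ σ K = -1 := fun K hK => by
    have := hσ K hK
    rcases abs_choice (σ K) with h | h <;> rw [h] at this
    · exact Or.inl this
    · exact Or.inr (by linarith)
  have hset : {s | ∑ K ∈ B, σ K * haarSystem K s = v} =
      ⋃ K ∈ B, {s | haarSystem K s = σ K * v} := by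
    ext s
    simp only [Set.mem_ofPred_eq, Set.mem_iUnion, exists_prop]
    constructor
    · intro h
      obtain ⟨K, hK, hne⟩ := Finset.exists_ne_zero_of_sum_ne_zero (h.trans_ne hv0)
      rw [hB.sum_eq σ hK (right_ne_zero_of_mul hne)] at h
      refine ⟨K, hK, ?_⟩
      rw [← h]
      rcases hσ' K hK with h' | h' <;> rw [h'] <;> ring
    · rintro ⟨K, hK, h⟩
      have hs : haarSystem K s ≠ 0 := by
        rw [h]; rcases hσ' K hK with h' | h' <;> rw [h'] <;> simpa using hv0
      rw [hB.sum_eq σ hK hs, h]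
      rcases hσ' K hK with h' | h' <;> rw [h'] <;> ring
  have hvK : ∀ K ∈ B, σ K * v = 1 ∨ σ K * v = -1 := fun K hK => by
    rcases hσ' K hK with h' | h' <;> rcases hv with rfl | rfl <;> rw [h'] <;> norm_num
  have hne : ∀ K ∈ B, ∀ s, haarSystem K s = σ K * v → haarSystem K s ≠ 0 := fun K hK s h => by
    rw [h]; rcases hvK K hK with h' | h' <;> rw [h'] <;> norm_num
  have hfin : ∀ K ∈ B, volume {s | haarSystem K s = σ K * v} ≠ ⊤ := fun K hK =>
    ((measure_mono fun s hs => mem_Ico_of_haarSystem_ne_zero (hne K hK s hs)).trans_lt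
      (by simp : volume (Set.Ico (0 : ℝ) 1) < ⊤)).ne
  rw [hset, measureReal_biUnion_finset (h := hfin), Finset.sum_div]
  · exact Finset.sum_congr rfl fun K hK => volume_haarSystem_eq (hB.1 K hK) (hvK K hK)
  · intro K hK K' hK' hKK'
    exact Set.disjoint_left.2 fun s hs hs' =>
      hKK' (hB.2 K hK K' hK' s (hne K hK s hs) (hne K' hK' s hs'))
  · exact fun K _ => (measurable_haarSystem K) (measurableSet_singleton _)

theorem exists_subset_sum_mem_Ioc {α : Type*} {w : α → ℝ} {δ t : ℝ} (ht : 0 ≤ t)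
    (B : Finset α) (hw : ∀ a ∈ B, w a < δ) (hB : t < ∑ a ∈ B, w a) :
    ∃ B' ⊆ B, t - δ < ∑ a ∈ B', w a ∧ ∑ a ∈ B', w a ≤ t := by
  classical
  induction B using Finset.induction_on with
  | empty => simp at hB; linarith
  | insert a B ha ih =>
    by_cases h : t < ∑ a ∈ B, w a
    · obtain ⟨B', hB', h'⟩ := ih (fun a ha => hw a (Finset.mem_insert_of_mem ha)) h
      exact ⟨B', hB'.trans (Finset.subset_insert a B), h'⟩
    · refine ⟨B, Finset.subset_insert a B, ?_, not_lt.1 h⟩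
      rw [Finset.sum_insert ha] at hB
      linarith [hw a (Finset.mem_insert_self a B)]

/-- The intervals of a finite collection that are contained in no other interval of it. -/
theorem exists_isDisjointFamily_biUnion_eq {C : Finset ℕ} (hC : ∀ K ∈ C, 1 ≤ K) :
    ∃ B ⊆ C, IsDisjointFamily B ∧
      ⋃ K ∈ B, {s | haarSystem K s ≠ 0} = ⋃ K ∈ C, {s | haarSystem K s ≠ 0} := by
  classical
  refine ⟨C.filter fun K => ∀ K' ∈ C, K' < K → ∀ s, haarSystem K s ≠ 0 → haarSystem K' s = 0,
    Finset.filter_subset _ _, ⟨fun K hK => hC K (Finset.mem_filter.1 hK).1,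
    fun K hK K' hK' s hs hs' => ?_⟩, ?_⟩
  · rw [Finset.mem_filter] at hK hK'
    rcases Nat.lt_trichotomy K K' with h | h | h
    · exact absurd (hK'.2 K hK.1 h s hs') hs
    · exact h
    · exact absurd (hK.2 K' hK'.1 h s hs) hs'
  · refine Set.Subset.antisymm
      (Set.biUnion_subset_biUnion_left fun K hK => (Finset.mem_filter.1 hK).1) fun s hs => ?_
    simp only [Set.mem_iUnion, exists_prop, Set.mem_ofPred_eq] at hs ⊢
    have hne : (C.filter fun K => haarSystem K s ≠ 0).Nonempty := by
      obtain ⟨K, hK, hKs⟩ := hs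
      exact ⟨K, Finset.mem_filter.2 ⟨hK, hKs⟩⟩
    obtain ⟨hK, hKs⟩ := Finset.mem_filter.1 (Finset.min'_mem _ hne)
    refine ⟨_, Finset.mem_filter.2 ⟨hK, fun K' hK' hlt t ht => ?_⟩, hKs⟩
    rw [haarSystem_eq_of_lt hlt ht hKs]
    by_contra hc
    exact absurd (Finset.min'_le _ K' (Finset.mem_filter.2 ⟨hK', hc⟩)) (not_le.2 hlt)

/-- Inside a set `Γ` which fine dyadic intervals either avoid or are contained in, a disjoint family
can be selected from `M` whose total length is slightly below the measure of the part of `Γ` that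
is covered infinitely often by `M`, and such that both sets where a signed sum of the selected Haar
functions is `1` or `-1` still are almost entirely covered infinitely often. -/
theorem exists_isDisjointFamily_of_limsupSet {M : Set ℕ} (hM : ∀ K ∈ M, 1 ≤ K) {Γ : Set ℝ}
    (hΓ : MeasurableSet Γ) {n : ℕ}
    (hn : ∀ K, n < K → ∀ s ∈ Γ, haarSystem K s ≠ 0 → ∀ s', haarSystem K s' ≠ 0 → s' ∈ Γ)
    {t' t : ℝ} (ht' : 0 < t') (htt' : t' < t) (ht : t < volume.real (Γ ∩ limsupSet M)) (n₀ : ℕ) :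
    ∃ B : Finset ℕ, IsDisjointFamily B ∧ (∀ K ∈ B, K ∈ M ∧ n₀ ≤ K) ∧
      (∀ K ∈ B, ∀ s, haarSystem K s ≠ 0 → s ∈ Γ) ∧
      t' < ∑ K ∈ B, haarLength K ∧ ∑ K ∈ B, haarLength K ≤ t ∧
      ∀ σ : ℕ → ℝ, (∀ K ∈ B, |σ K| = 1) → ∀ v : ℝ, v = 1 ∨ v = -1 →
        t' / 2 < volume.real ({s | ∑ K ∈ B, σ K * haarSystem K s = v} ∩ limsupSet M) := by
  classical
  set A := limsupSet M with hA
  set δ := (t - t') / 4 with hδ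
  have hδ0 : 0 < δ := by rw [hδ]; linarith
  have hAm : MeasurableSet (Γ ∩ A) := hΓ.inter (measurableSet_limsupSet M)
  have hAfin : volume (Γ ∩ A) ≠ ⊤ :=
    ((measure_mono (Set.inter_subset_right.trans (limsupSet_subset M))).trans_lt
      (by simp : volume (Set.Ico (0 : ℝ) 1) < ⊤)).ne
  obtain ⟨V, hAV, hVo, hVA⟩ := (Γ ∩ A).exists_isOpen_lt_add hAfin
    (ENNReal.ofReal_pos.2 hδ0).ne'
  have hVfin : volume V ≠ ⊤ := (hVA.trans_le le_top).ne
  have hVδ : volume.real (V \ (Γ ∩ A)) < δ := by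
    rw [measureReal_sdiff hAV hAm hVfin, sub_lt_iff_lt_add']
    have := (ENNReal.toReal_lt_toReal hVfin (by finiteness)).2 hVA
    rwa [ENNReal.toReal_add hAfin (by finiteness), ENNReal.toReal_ofReal hδ0.le] at this
  obtain ⟨n₁, hn₁⟩ := eventually_atTop.1 (eventually_haarLength_lt hδ0)
  let C : ℕ → Finset ℕ := fun m => (Finset.range m).filter fun K =>
    K ∈ M ∧ n₀ ≤ K ∧ n₁ ≤ K ∧ ∀ s, haarSystem K s ≠ 0 → s ∈ V ∩ Γ
  have hC : ∀ m, ∀ K ∈ C m, K ∈ M ∧ n₀ ≤ K ∧ n₁ ≤ K ∧ ∀ s, haarSystem K s ≠ 0 → s ∈ V ∩ Γ :=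
    fun m K hK => (Finset.mem_filter.1 hK).2
  let U : ℕ → Set ℝ := fun m => ⋃ K ∈ C m, {s | haarSystem K s ≠ 0}
  have hUmono : Monotone U := fun m m' hmm' => by
    refine Set.biUnion_subset_biUnion_left fun K hK => ?_
    obtain ⟨h1, h2⟩ := Finset.mem_filter.1 hK
    exact Finset.mem_filter.2 ⟨Finset.mem_range.2 ((Finset.mem_range.1 h1).trans_le hmm'), h2⟩
  have hUfin : ∀ m, volume (U m) ≠ ⊤ := fun m => by
    refine ((measure_mono ?_).trans_lt (by simp : volume (Set.Ico (0 : ℝ) 1) < ⊤)).ne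
    exact Set.iUnion₂_subset fun K _ s hs => mem_Ico_of_haarSystem_ne_zero hs
  have hcover : Γ ∩ A ⊆ ⋃ m, U m := by
    rintro s ⟨hsΓ, hsA⟩
    obtain ⟨ρ, hρ, hball⟩ := Metric.isOpen_iff.1 hVo s (hAV ⟨hsΓ, hsA⟩)
    obtain ⟨K, ⟨hKM, hKs⟩, hlen, hK0, hK1, hKn⟩ := (Frequently.and_eventually hsA
      ((eventually_haarLength_lt hρ).and ((eventually_ge_atTop n₀).and
        ((eventually_ge_atTop n₁).and (eventually_gt_atTop n))))).exists
    refine Set.mem_iUnion.2 ⟨K + 1, ?_⟩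
    simp only [U, Set.mem_iUnion, exists_prop]
    refine ⟨K, Finset.mem_filter.2 ⟨by simp, hKM, hK0, hK1, fun x hx => ⟨hball ?_, ?_⟩⟩, hKs⟩
    · rw [Metric.mem_ball, Real.dist_eq]
      exact (abs_sub_lt_haarLength (hM K hKM) hKs hx).trans hlen
    · exact hn K hKn s hsΓ hKs x hx
  obtain ⟨m, hm⟩ : ∃ m, t < volume.real (U m) := by
    have h1 : ENNReal.ofReal t < volume (⋃ m, U m) := by
      refine lt_of_lt_of_le ?_ (measure_mono hcover)
      rwa [ENNReal.ofReal_lt_iff_lt_toReal (by linarith) hAfin]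
    rw [hUmono.measure_iUnion] at h1
    obtain ⟨m, hm⟩ := lt_iSup_iff.1 h1
    exact ⟨m, (ENNReal.ofReal_lt_iff_lt_toReal (by linarith) (hUfin m)).1 hm⟩
  obtain ⟨B₀, hB₀C, hB₀, hB₀U⟩ := exists_isDisjointFamily_biUnion_eq (C := C m)
    fun K hK => hM K (hC m K hK).1
  have hsum : t < ∑ K ∈ B₀, haarLength K := by
    rw [← hB₀.volume_biUnion, hB₀U]
    exact hm
  obtain ⟨B, hBB₀, hB1, hB2⟩ := exists_subset_sum_mem_Ioc (by linarith) B₀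
    (fun K hK => hn₁ K (hC m K (hB₀C hK)).2.2.1) hsum
  have hBC : ∀ K ∈ B, K ∈ M ∧ n₀ ≤ K ∧ n₁ ≤ K ∧ ∀ s, haarSystem K s ≠ 0 → s ∈ V ∩ Γ :=
    fun K hK => hC m K (hB₀C (hBB₀ hK))
  have hB : IsDisjointFamily B := ⟨fun K hK => hB₀.1 K (hBB₀ hK),
    fun K hK K' hK' => hB₀.2 K (hBB₀ hK) K' (hBB₀ hK')⟩
  refine ⟨B, hB, fun K hK => ⟨(hBC K hK).1, (hBC K hK).2.1⟩,
    fun K hK s hs => ((hBC K hK).2.2.2 s hs).2, by linarith, hB2, fun σ hσ v hv => ?_⟩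
  set H := {s | ∑ K ∈ B, σ K * haarSystem K s = v} with hH
  have hHvol : volume.real H = (∑ K ∈ B, haarLength K) / 2 := hB.volume_sum_eq hσ hv
  have hHV : H ⊆ V ∩ Γ := by
    intro s hs
    have hv0 : v ≠ 0 := by rcases hv with rfl | rfl <;> norm_num
    obtain ⟨K, hK, hne⟩ := Finset.exists_ne_zero_of_sum_ne_zero (hs.out.trans_ne hv0)
    exact (hBC K hK).2.2.2 s (right_ne_zero_of_mul hne)
  have hHsub : H ⊆ (H ∩ A) ∪ (V \ (Γ ∩ A)) := by
    intro s hs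
    by_cases hsA : s ∈ A
    · exact Or.inl ⟨hs, hsA⟩
    · exact Or.inr ⟨(hHV hs).1, fun h => hsA h.2⟩
  have h1 : volume.real H ≤ volume.real (H ∩ A) + volume.real (V \ (Γ ∩ A)) := by
    refine (measureReal_mono hHsub ?_).trans (measureReal_union_le _ _)
    refine measure_union_ne_top ?_ ?_
    · exact ((measure_mono (Set.inter_subset_left.trans (hHV.trans Set.inter_subset_left))).trans_lt
        hVfin.lt_top).ne
    · exact ((measure_mono Set.sdiff_subset).trans_lt hVfin.lt_top).ne
  linarith

/-! ### Admissible blocks -/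

/-- The coefficients `λ_j` of a block that replaces the basis vector with index `n`; with them the
block is `c` times the image of that vector under the block operator. -/
def blockLam (X : HaarSystemNorm) (r : rademacherFamilies) (c : ℝ) (n j : ℕ) : ℝ :=
  c * ‖haarBasisVector X r j‖ / ‖haarBasisVector X r n‖

/-- The coefficients `μ_j` of the functional dual to a block with the intervals `B`, for which
`∑ λ_j μ_j = 1`. -/
def blockMu (X : HaarSystemNorm) (r : rademacherFamilies) (c : ℝ) (n : ℕ) (B : Finset ℕ) (j : ℕ) :
    ℝ :=
  c⁻¹ * (‖haarBasisVector X r n‖ / ‖haarBasisVector X r j‖) *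
    (haarLength (j + 1) / ∑ K ∈ B, haarLength K)

/-- A set `B` of intervals that is admissible as the block with index `n` in the reply to `o`: its
intervals are disjoint, contained in `Γ`, have numbers in `M` above `n₀` and total length in
`(t', t]`, they leave enough room in the limes superior of `M` for the two successors of the
block, and for all signs the resulting vector and functional satisfy the distance conditions. -/
structure IsGoodBlock {X : HaarSystemNorm} {r : rademacherFamilies}
    (b : SchauderBasis ℝ (HardySpaceZero X r)) (M : Set ℕ) (c t' t : ℝ) (Γ : Set ℝ) (n₀ n : ℕ)
    (o : Opening (HardySpaceZero X r)) (B : Finset ℕ) : Prop where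
  isDisjointFamily : IsDisjointFamily B
  mem : ∀ K ∈ B, K ∈ M
  lt_of_mem : ∀ K ∈ B, n₀ < K
  subset : ∀ K ∈ B, ∀ s, haarSystem K s ≠ 0 → s ∈ Γ
  lower : t' < ∑ K ∈ B, haarLength K
  upper : ∑ K ∈ B, haarLength K ≤ t
  half : ∀ σ : ℕ → ℝ, (∀ K ∈ B, |σ K| = 1) → ∀ v : ℝ, v = 1 ∨ v = -1 →
    t' / 2 < volume.real ({s | ∑ K ∈ B, σ K * haarSystem K s = v} ∩ limsupSet M)
  dist_W : ∀ ε : ℕ → ℤˣ, Metric.infDist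
    (signedSum (B.image (· - 1)) ε (blockLam X r c n) b.basis) (o.W : Set _) < o.tol
  dist_G : ∀ ε : ℕ → ℤˣ, Metric.infDist
    (signedSum (B.image (· - 1)) ε (blockMu X r c n B) b.coord)
    (o.G : Set (StrongDual ℝ (HardySpaceZero X r))) < o.tol

theorem abs_intUnit (x : ℤˣ) : |((x : ℤ) : ℝ)| = 1 := by
  rcases Int.units_eq_one_or x with rfl | rfl <;> simp

theorem IsDisjointFamily.sum_image {B : Finset ℕ} (hB : IsDisjointFamily B) {F : Type*}
    [AddCommMonoid F] (f : ℕ → F) : ∑ j ∈ B.image (· - 1), f j = ∑ K ∈ B, f (K - 1) := by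
  refine Finset.sum_image fun K hK K' hK' h => ?_
  have h1 := hB.1 K hK
  have h2 := hB.1 K' hK'
  have h3 : K - 1 = K' - 1 := h
  omega

section

variable {X : HaarSystemNorm} {r : rademacherFamilies} {b : SchauderBasis ℝ (HardySpaceZero X r)}

theorem signedSum_blockLam
    (hb : ∀ n, b n = ‖haarBasisVector X r n‖⁻¹ • haarBasisVector X r n) {B : Finset ℕ}
    (hB : IsDisjointFamily B) (ε : ℕ → ℤˣ) (c : ℝ) (n : ℕ) :
    signedSum (B.image (· - 1)) ε (blockLam X r c n) b.basis =
      (c / ‖haarBasisVector X r n‖) •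
        ∑ K ∈ B, ((ε (K - 1) : ℤ) : ℝ) • haarBasisVector X r (K - 1) := by
  rw [signedSum, hB.sum_image, Finset.smul_sum]
  refine Finset.sum_congr rfl fun K _ => ?_
  have h : b.basis (K - 1) = ‖haarBasisVector X r (K - 1)‖⁻¹ • haarBasisVector X r (K - 1) :=
    hb (K - 1)
  have hne := norm_ne_zero_iff.2 (haarBasisVector_ne_zero X r (K - 1))
  rw [h, smul_smul, smul_smul, blockLam]
  congr 1
  field_simp

theorem signedSum_blockMu_apply {B : Finset ℕ} (hB : IsDisjointFamily B) (ε : ℕ → ℤˣ) (c : ℝ)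
    (n : ℕ) (f : HardySpaceZero X r) :
    signedSum (B.image (· - 1)) ε (blockMu X r c n B) b.coord f =
      c⁻¹ * ‖haarBasisVector X r n‖ / (∑ K ∈ B, haarLength K) *
        ∑ K ∈ B, ((ε (K - 1) : ℤ) : ℝ) * (haarLength K / ‖haarBasisVector X r (K - 1)‖) *
          b.coord (K - 1) f := by
  rw [signedSum, hB.sum_image, sum_apply, Finset.mul_sum]
  refine Finset.sum_congr rfl fun K hK => ?_
  rw [smul_apply, smul_eq_mul, blockMu, Nat.sub_add_cancel (hB.1 K hK)]
  ring

theorem sum_blockLam_mul_blockMu {B : Finset ℕ} (hB : IsDisjointFamily B) {c : ℝ} (hc : c ≠ 0)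
    (n : ℕ) (hsum : 0 < ∑ K ∈ B, haarLength K) :
    ∑ j ∈ B.image (· - 1), blockLam X r c n j * blockMu X r c n B j = 1 := by
  have hn := norm_ne_zero_iff.2 (haarBasisVector_ne_zero X r n)
  rw [hB.sum_image, ← div_self hsum.ne', Finset.sum_div]
  refine Finset.sum_congr rfl fun K hK => ?_
  have hne := norm_ne_zero_iff.2 (haarBasisVector_ne_zero X r (K - 1))
  rw [blockLam, blockMu, Nat.sub_add_cancel (hB.1 K hK)]
  field_simp

/-- Admissible blocks exist: all distance conditions hold for disjoint families of sufficiently fine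
intervals, because only finitely many functionals and vectors are involved in them. -/
theorem exists_isGoodBlock
    (hweak : ∀ φ : StrongDual ℝ (HardySpaceZero X r),
      Tendsto (fun n => φ (rademacherVector X r n)) atTop (𝓝 0))
    (hb : ∀ n, b n = ‖haarBasisVector X r n‖⁻¹ • haarBasisVector X r n) {M : Set ℕ}
    (hM : ∀ K ∈ M, 1 ≤ K) {c : ℝ} (hc : 0 < c) {Γ : Set ℝ} (hΓ : MeasurableSet Γ) {n₀ : ℕ}
    (hn₀ : ∀ K, n₀ < K → ∀ s ∈ Γ, haarSystem K s ≠ 0 → ∀ s', haarSystem K s' ≠ 0 → s' ∈ Γ)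
    {t' t : ℝ} (ht' : 0 < t') (htt' : t' < t) (ht : t < volume.real (Γ ∩ limsupSet M)) (n : ℕ)
    (o : Opening (HardySpaceZero X r)) : ∃ B, IsGoodBlock b M c t' t Γ n₀ n o B := by
  have hn : 0 < ‖haarBasisVector X r n‖ := norm_pos_iff.2 (haarBasisVector_ne_zero X r n)
  have := o.W_cofinite
  have := o.G_cofinite
  obtain ⟨Φ, γ, hγ, hΦ⟩ := exists_finset_infDist_lt o.W_closed o.tol_pos
  obtain ⟨F, ρ, hρ, hF⟩ := exists_finset_infDist_lt_of_weakStar_closed o.G_closed o.tol_pos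
  have h1 := (Filter.eventually_all_finset Φ).2 fun φ _ => eventually_sum_abs_lt hweak φ
    (δ := γ * ‖haarBasisVector X r n‖ / c) (by positivity)
  have h2 := (Filter.eventually_all_finset F).2 fun f _ => eventually_abs_sum_coord_lt hb f
    (δ := ρ * c * t' / ‖haarBasisVector X r n‖) (by positivity)
  obtain ⟨N, hN1, hN2, hN3⟩ := (h1.and (h2.and (eventually_gt_atTop n₀))).exists
  obtain ⟨B, hB, hBM, hBΓ, hlow, hup, hhalf⟩ :=
    exists_isDisjointFamily_of_limsupSet hM hΓ hn₀ ht' htt' ht N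
  refine ⟨B, hB, fun K hK => (hBM K hK).1, fun K hK => hN3.trans_le (hBM K hK).2, hBΓ, hlow, hup,
    hhalf, fun ε => hΦ _ fun φ hφ => ?_, fun ε => hF _ fun f hf => ?_⟩
  · rw [signedSum_blockLam hb hB, map_smul, smul_eq_mul, abs_mul, abs_of_pos (div_pos hc hn),
      div_mul_eq_mul_div, div_lt_iff₀ hn, ← lt_div_iff₀' hc]
    refine lt_of_le_of_lt ?_ (hN1 φ hφ B hB fun K hK => (hBM K hK).2)
    rw [map_sum]
    refine (Finset.abs_sum_le_sum_abs _ _).trans (Finset.sum_le_sum fun K _ => ?_)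
    rw [map_smul, smul_eq_mul, abs_mul, abs_intUnit, one_mul]
  · have h3 := hN2 f hf B hB (fun K hK => (hBM K hK).2) (fun K => ((ε (K - 1) : ℤ) : ℝ))
      fun K _ => abs_intUnit _
    rw [lt_div_iff₀ hn] at h3
    have hsum := ht'.trans hlow
    rw [signedSum_blockMu_apply hB, abs_mul, abs_of_pos (by positivity), div_mul_eq_mul_div,
      div_lt_iff₀ hsum, mul_assoc, inv_mul_lt_iff₀ hc]
    calc _ < ρ * c * t' := by rwa [mul_comm]
      _ ≤ ρ * c * ∑ K ∈ B, haarLength K := by gcongr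
      _ = c * (ρ * ∑ K ∈ B, haarLength K) := by ring

end

/-! ### The recursive choice of the blocks -/

/-- The signs `ε` of player (I), transferred to the numbering of the intervals and extended by the
trivial sign of `h_∅`. -/
def blockSign (ε : ℕ → ℕ → ℤˣ) (k K : ℕ) : ℝ :=
  if k = 0 then 1 else ((ε (k - 1) (K - 1) : ℤ) : ℝ)

theorem abs_blockSign (ε : ℕ → ℕ → ℤˣ) (k K : ℕ) : |blockSign ε k K| = 1 := by
  rw [blockSign]
  split_ifs
  · exact abs_one
  · exact abs_intUnit _

/-- The set that contains the intervals of block number `k`: here the block number `k / 2` has the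
value `childSign k`. -/
def blockRegion (B : ℕ → Finset ℕ) (ε : ℕ → ℕ → ℤˣ) (k : ℕ) : Set ℝ :=
  {s | blockFunction B (blockSign ε) (k / 2) s = childSign k}

/-- The largest number of an interval in the blocks with numbers up to `n`. -/
def blockBound (B : ℕ → Finset ℕ) (n : ℕ) : ℕ := (Finset.range (n + 1)).sup fun k => (B k).sup id

theorem le_blockBound {B : ℕ → Finset ℕ} {n k K : ℕ} (hk : k ≤ n) (hK : K ∈ B k) :
    K ≤ blockBound B n := by
  have h1 : K ≤ (B k).sup id := Finset.le_sup (f := id) hK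
  exact h1.trans (Finset.le_sup (f := fun k => (B k).sup id) (Finset.mem_range.2 (by omega)))

theorem measurableSet_blockRegion (B : ℕ → Finset ℕ) (ε : ℕ → ℕ → ℤˣ) (k : ℕ) :
    MeasurableSet (blockRegion B ε k) := by
  have : Measurable (blockFunction B (blockSign ε) (k / 2)) :=
    Finset.measurable_fun_sum _ fun K _ => (measurable_haarSystem K).const_mul _
  exact this (measurableSet_singleton _)

theorem mem_blockRegion_of_lt {B : ℕ → Finset ℕ} {ε : ℕ → ℕ → ℤˣ} {n K : ℕ}
    (hK : blockBound B n < K) {s : ℝ} (hs : s ∈ blockRegion B ε (n + 1))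
    (hsK : haarSystem K s ≠ 0) {s' : ℝ} (hs' : haarSystem K s' ≠ 0) :
    s' ∈ blockRegion B ε (n + 1) := by
  rw [blockRegion, Set.mem_ofPred_eq] at hs ⊢
  rw [← hs]
  refine Finset.sum_congr rfl fun K' hK' => ?_
  rw [haarSystem_eq_of_lt ((le_blockBound (by omega) hK').trans_lt hK) hs' hsK]

section

variable {X : HaarSystemNorm} {r : rademacherFamilies}

/-- The data that govern the choice of the blocks: the basis, the collection `M` of intervals that
may be used, the factor `c`, and the bounds `q k` for the total length of block number `k`, relative
to the length of the interval with number `k`. -/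
structure BlockChoice (X : HaarSystemNorm) (r : rademacherFamilies) where
  b : SchauderBasis ℝ (HardySpaceZero X r)
  M : Set ℕ
  c : ℝ
  q : ℕ → ℝ

namespace BlockChoice

variable (D : BlockChoice X r)

/-- Admissibility of `A` as block number `n + 1`, given the blocks `B` up to number `n`. -/
def Good (o : ℕ → Opening (HardySpaceZero X r)) (ε : ℕ → ℕ → ℤˣ) (B : ℕ → Finset ℕ) (n : ℕ)
    (A : Finset ℕ) : Prop :=
  IsGoodBlock D.b D.M D.c (D.q (n + 2) * haarLength (n + 1)) (D.q (n + 1) * haarLength (n + 1))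
    (blockRegion B ε (n + 1)) (blockBound B n) n (o n) A

/-- An admissible block with number `n + 1`, if there is one. -/
def next (o : ℕ → Opening (HardySpaceZero X r)) (ε : ℕ → ℕ → ℤˣ) (B : ℕ → Finset ℕ) (n : ℕ) :
    Finset ℕ :=
  Classical.epsilon (D.Good o ε B n)

/-- The blocks with numbers up to `n`, the remaining ones being empty. -/
def initial (o : ℕ → Opening (HardySpaceZero X r)) (ε : ℕ → ℕ → ℤˣ) : ℕ → ℕ → Finset ℕ
  | 0 => fun k => if k = 0 then {0} else ∅
  | n + 1 => Function.update (initial o ε n) (n + 1) (D.next o ε (initial o ε n) n)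

/-- The sequence of all blocks. -/
def blocks (o : ℕ → Opening (HardySpaceZero X r)) (ε : ℕ → ℕ → ℤˣ) (k : ℕ) : Finset ℕ :=
  D.initial o ε k k

variable {D}

theorem good_congr {o o' : ℕ → Opening (HardySpaceZero X r)} {ε ε' : ℕ → ℕ → ℤˣ}
    {B B' : ℕ → Finset ℕ} {n : ℕ} (ho : o n = o' n) (hε : ∀ i < n, ε i = ε' i)
    (hB : ∀ k ≤ n, B k = B' k) : D.Good o ε B n = D.Good o' ε' B' n := by
  have h1 : blockRegion B ε (n + 1) = blockRegion B' ε' (n + 1) := by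
    have : blockFunction B (blockSign ε) ((n + 1) / 2) =
        blockFunction B' (blockSign ε') ((n + 1) / 2) := by
      funext s
      rw [blockFunction, blockFunction, hB _ (by omega)]
      refine Finset.sum_congr rfl fun K _ => ?_
      rw [blockSign, blockSign]
      split_ifs with h
      · rfl
      · rw [hε _ (by omega)]
    rw [blockRegion, blockRegion, this]
  have h2 : blockBound B n = blockBound B' n :=
    Finset.sup_congr rfl fun k hk => by rw [hB k (by have := Finset.mem_range.1 hk; omega)]
  funext A
  rw [Good, Good, h1, h2, ho]

theorem next_congr {o o' : ℕ → Opening (HardySpaceZero X r)} {ε ε' : ℕ → ℕ → ℤˣ}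
    {B B' : ℕ → Finset ℕ} {n : ℕ} (ho : o n = o' n) (hε : ∀ i < n, ε i = ε' i)
    (hB : ∀ k ≤ n, B k = B' k) : D.next o ε B n = D.next o' ε' B' n := by
  rw [next, next, good_congr ho hε hB]

theorem initial_eq_blocks (o : ℕ → Opening (HardySpaceZero X r)) (ε : ℕ → ℕ → ℤˣ) {k n : ℕ}
    (hk : k ≤ n) : D.initial o ε n k = D.blocks o ε k := by
  induction n with
  | zero => rw [Nat.le_zero.1 hk]; rfl
  | succ n ih =>
    rcases Nat.lt_or_eq_of_le hk with h | rfl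
    · rw [initial, Function.update_of_ne (by omega), ih (by omega)]
    · rfl

theorem blocks_zero (o : ℕ → Opening (HardySpaceZero X r)) (ε : ℕ → ℕ → ℤˣ) :
    D.blocks o ε 0 = {0} := rfl

theorem blocks_succ (o : ℕ → Opening (HardySpaceZero X r)) (ε : ℕ → ℕ → ℤˣ) (n : ℕ) :
    D.blocks o ε (n + 1) = D.next o ε (D.blocks o ε) n := by
  rw [blocks, initial, Function.update_self]
  exact next_congr rfl (fun _ _ => rfl) fun k hk => initial_eq_blocks o ε hk

/-- Block number `n + 1` depends only on the first `n + 1` openings and on the first `n` choices of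
signs, so that the blocks define a strategy. -/
theorem blocks_congr {o o' : ℕ → Opening (HardySpaceZero X r)} {ε ε' : ℕ → ℕ → ℤˣ} {n : ℕ}
    (ho : ∀ i ≤ n, o i = o' i) (hε : ∀ i < n, ε i = ε' i) :
    ∀ k ≤ n + 1, D.blocks o ε k = D.blocks o' ε' k := by
  intro k
  induction k using Nat.strong_induction_on with
  | _ k ih =>
    intro hk
    rcases k with _ | k
    · rfl
    · rw [blocks_succ, blocks_succ]
      exact next_congr (ho k (by omega)) (fun i hi => hε i (by omega))
        fun l hl => ih l (by omega) (by omega)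

/-- The recursion never stops: the region of each block keeps enough measure inside the limes
superior of `M`, since the relative measures `q k` decrease. -/
theorem good_blocks
    (hweak : ∀ φ : StrongDual ℝ (HardySpaceZero X r),
      Tendsto (fun n => φ (rademacherVector X r n)) atTop (𝓝 0))
    (hb : ∀ n, D.b n = ‖haarBasisVector X r n‖⁻¹ • haarBasisVector X r n)
    (hM : ∀ K ∈ D.M, 1 ≤ K) (hlim : 1 / 2 ≤ volume.real (limsupSet D.M)) (hc : 0 < D.c)
    (hq0 : ∀ k, 0 < D.q k) (hq1 : ∀ k, D.q k < 1 / 2) (hq : StrictAnti D.q)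
    (o : ℕ → Opening (HardySpaceZero X r)) (ε : ℕ → ℕ → ℤˣ) (n : ℕ) :
    D.Good o ε (D.blocks o ε) n (D.blocks o ε (n + 1)) := by
  induction n using Nat.strong_induction_on with
  | _ n ih =>
    have hlen := haarLength_pos (n + 1)
    have hroom : D.q (n + 1) * haarLength (n + 1) <
        volume.real (blockRegion (D.blocks o ε) ε (n + 1) ∩ limsupSet D.M) := by
      rcases Nat.eq_zero_or_pos n with rfl | hn
      · have hsub : limsupSet D.M ⊆ blockRegion (D.blocks o ε) ε (0 + 1) := fun s hs => by
          have hs' := limsupSet_subset _ hs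
          simp [blockRegion, blockFunction, blocks_zero, blockSign, childSign,
            haarSystem_zero_apply hs']
        rw [Set.inter_eq_self_of_subset_right hsub]
        have : haarLength (0 + 1) = 1 := by simp [haarLength]
        rw [this, mul_one]
        exact (hq1 _).trans_le hlim
      · obtain ⟨p, hp⟩ : ∃ p, (n + 1) / 2 = p + 1 := ⟨(n + 1) / 2 - 1, by omega⟩
        have hchild : childSign (n + 1) = 1 ∨ childSign (n + 1) = -1 := by
          rw [childSign]; split_ifs <;> simp
        have h := (ih p (by omega)).half (blockSign ε (p + 1)) (fun K _ => abs_blockSign ε _ K)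
          (childSign (n + 1)) hchild
        have e : blockRegion (D.blocks o ε) ε (n + 1) = {s | ∑ K ∈ D.blocks o ε (p + 1),
            blockSign ε (p + 1) K * haarSystem K s = childSign (n + 1)} := by
          rw [blockRegion, hp]; rfl
        rw [e]
        refine lt_of_le_of_lt ?_ h
        rw [haarLength_div_two (by omega : 2 ≤ n + 1), hp, mul_div_assoc]
        exact mul_le_mul_of_nonneg_right (hq.antitone (by omega))
          (half_pos (haarLength_pos _)).le
    have hex : ∃ A, D.Good o ε (D.blocks o ε) n A :=
      exists_isGoodBlock hweak hb hM hc (measurableSet_blockRegion _ _ _)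
        (fun K hK s hs hsK s' hs' => mem_blockRegion_of_lt hK hs hsK hs')
        (mul_pos (hq0 _) hlen) (mul_lt_mul_of_pos_right (hq (Nat.lt_succ_self _)) hlen) hroom n (o n)
    rw [blocks_succ]
    exact Classical.epsilon_spec hex

theorem isHaarBlockSystem_of_good {o : ℕ → Opening (HardySpaceZero X r)} {ε : ℕ → ℕ → ℤˣ}
    (h : ∀ n, D.Good o ε (D.blocks o ε) n (D.blocks o ε (n + 1))) :
    IsHaarBlockSystem (D.blocks o ε) (blockSign ε) where
  zero_block := rfl
  zero_sign := by simp [blockSign]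
  abs_sign k K _ := abs_blockSign ε k K
  disjoint k := by
    rcases k with _ | n
    · intro K hK K' hK' _ _ _
      rw [blocks_zero, Finset.mem_singleton] at hK hK'
      rw [hK, hK']
    · exact (h n).isDisjointFamily.2
  injective k l K hk hl := by
    have key : ∀ k l, k < l → K ∈ D.blocks o ε k → K ∉ D.blocks o ε l := fun k l hkl hk hl => by
      obtain ⟨n, rfl⟩ : ∃ n, l = n + 1 := ⟨l - 1, by omega⟩
      exact absurd (le_blockBound (by omega) hk) (not_le.2 ((h n).lt_of_mem K hl))
    rcases Nat.lt_trichotomy k l with h' | h' | h'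
    · exact absurd hl (key k l h' hk)
    · exact h'
    · exact absurd hk (key l k h' hl)
  nested k hk K hK s hs := by
    obtain ⟨n, rfl⟩ : ∃ n, k = n + 1 := ⟨k - 1, by omega⟩
    exact (h n).subset K hK s hs

/-- The strategy that replies with the recursively chosen blocks. The moves of player (I) that are
not yet known are filled up arbitrarily. -/
def strategy (D : BlockChoice X r) (i : Fin 2) : Strategy (HardySpaceZero X r) := fun k o ε =>
  let A := D.blocks (fun j => if h : j < k + 1 then o ⟨j, h⟩ else o 0)
    (fun j => if h : j < k then ε ⟨j, h⟩ else 1) (k + 1)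
  ⟨i, A.image (· - 1), blockLam X r D.c k, blockMu X r D.c k A⟩

theorem reply_strategy (i : Fin 2) (o : ℕ → Opening (HardySpaceZero X r)) (ε : ℕ → ℕ → ℤˣ)
    (k : ℕ) : (D.strategy i).reply o ε k = ⟨i, (D.blocks o ε (k + 1)).image (· - 1),
      blockLam X r D.c k, blockMu X r D.c k (D.blocks o ε (k + 1))⟩ := by
  have := blocks_congr (D := D) (n := k) (o' := o) (ε' := ε)
    (o := fun j => if h : j < k + 1 then o j else o (0 : Fin (k + 1)))
    (ε := fun j => if h : j < k then ε j else 1)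
    (fun j hj => dif_pos (by omega)) (fun j hj => dif_pos hj) (k + 1) le_rfl
  rw [Strategy.reply, strategy]
  simp only [this]

end BlockChoice

end

/-! ### Projectional factors -/

/-- If `P ∘ U` is the identity, then `U b_k` and `b_k* ∘ P` inherit equivalence constants from the
norms of `U` and `P`. -/
theorem impartiallyEquivalent_of_leftInverse {E : Type*} [NormedAddCommGroup E] [NormedSpace ℝ E]
    (b : SchauderBasis ℝ E) {U P : E →L[ℝ] E} (hPU : ∀ y, P (U y) = y) {C : ℝ} (hC : 0 < C)
    (hU : ∀ y, ‖U y‖ ≤ √C * ‖y‖) (hP : ∀ y, ‖P y‖ ≤ √C * ‖y‖) :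
    ImpartiallyEquivalent C (fun k => U (b.basis k)) b.basis ∧
      ImpartiallyEquivalent C (fun k => (b.coord k).comp P) b.coord := by
  have hs : 0 < √C := Real.sqrt_pos.2 hC
  have hnorm : ∀ (V : E →L[ℝ] E), (∀ y, ‖V y‖ ≤ √C * ‖y‖) → ∀ f : StrongDual ℝ E,
      ‖f.comp V‖ ≤ √C * ‖f‖ := fun V hV f => by
    refine (f.opNorm_comp_le V).trans ?_
    rw [mul_comm]
    exact mul_le_mul_of_nonneg_right (V.opNorm_le_bound hs.le hV) (norm_nonneg f)
  refine ⟨fun a => ?_, fun a => ?_⟩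
  · have e : (a.sum fun j c => c • U (b.basis j)) = U (a.sum fun j c => c • b.basis j) := by
      simp [Finsupp.sum, map_sum]
    rw [e]
    refine ⟨?_, hU _⟩
    rw [one_div, inv_mul_le_iff₀ hs]
    conv_lhs => rw [← hPU (a.sum fun j c => c • b.basis j)]
    exact hP _
  · have e : (a.sum fun j c => c • (b.coord j).comp P) =
        (a.sum fun j c => c • b.coord j).comp P := by
      ext y
      simp [Finsupp.sum]
    have e' : (a.sum fun j c => c • b.coord j) =
        ((a.sum fun j c => c • b.coord j).comp P).comp U := by
      ext y
      simp only [ContinuousLinearMap.comp_apply, hPU]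
    rw [e]
    refine ⟨?_, hnorm P hP _⟩
    rw [one_div, inv_mul_le_iff₀ hs]
    conv_lhs => rw [e']
    exact hnorm U hU _

section

variable {X : HaarSystemNorm} {r : rademacherFamilies}

/-- A diagonal operator with increasing bounded entries. -/
theorem exists_multiplier {m : ℕ → ℝ} (hm : Monotone m) (hm0 : 0 ≤ m 0) {C : ℝ}
    (hC : ∀ n, m n ≤ C) : ∃ D : HardySpaceZero X r →L[ℝ] HardySpaceZero X r,
      (∀ j, D (haarBasisVector X r j) = m j • haarBasisVector X r j) ∧
        ∀ y, ‖D y‖ ≤ (2 * C - m 0) * ‖y‖ := by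
  have hbound := norm_linearCombination_multiplier_le
    (norm_linearCombination_haar_filter_le X r) hm hm0 hC
  have hd := denseRange_linearCombination_haar X r
  refine ⟨(Finsupp.linearCombination ℝ fun n => m n • haarBasisVector X r n).extendOfNorm
    (Finsupp.linearCombination ℝ (haarBasisVector X r)), fun j => ?_, fun y => ?_⟩
  · have := LinearMap.extendOfNorm_eq hd ⟨_, hbound⟩ (Finsupp.single j 1)
    simpa using this
  · exact LinearMap.norm_extendOfNorm_apply_le hd _ hbound y

/-- The blocks and the functionals of a block system whose relative lengths decrease are obtained
from the Haar basis through an operator `U` and a left inverse `P` of `U`. The operator `P` is the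
adjoint block operator, corrected by a multiplier that normalizes the blocks. -/
theorem IsHaarBlockSystem.exists_leftInverse {B : ℕ → Finset ℕ} {ε : ℕ → ℕ → ℤˣ}
    (h : IsHaarBlockSystem B (blockSign ε)) (hB : ∀ n, IsDisjointFamily (B (n + 1)))
    {b : SchauderBasis ℝ (HardySpaceZero X r)}
    (hb : ∀ n, b n = ‖haarBasisVector X r n‖⁻¹ • haarBasisVector X r n) {m : ℕ → ℝ}
    (hm : ∀ n, m n * ∑ K ∈ B (n + 1), haarLength K = haarLength (n + 1)) (hmono : Monotone m)
    (hm0 : 0 ≤ m 0) {C : ℝ} (hC : ∀ n, m n ≤ C) {c : ℝ} (hc : 0 < c) :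
    ∃ U P : HardySpaceZero X r →L[ℝ] HardySpaceZero X r, (∀ y, P (U y) = y) ∧
      (∀ y, ‖U y‖ ≤ c * ‖y‖) ∧ (∀ y, ‖P y‖ ≤ c⁻¹ * (2 * C - m 0) * ‖y‖) ∧
      (∀ n, signedSum ((B (n + 1)).image (· - 1)) (ε n) (blockLam X r c n) b.basis =
        U (b.basis n)) ∧
      ∀ n, signedSum ((B (n + 1)).image (· - 1)) (ε n) (blockMu X r c n (B (n + 1))) b.coord =
        (b.coord n).comp P := by
  obtain ⟨T, hT, hT'⟩ := h.exists_operator X r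
  obtain ⟨S, hS1, hS2, hS'⟩ := h.exists_adjoint X r
  obtain ⟨D, hD, hD'⟩ := exists_multiplier (X := X) (r := r) hmono hm0 hC
  have hne := fun j => norm_ne_zero_iff.2 (haarBasisVector_ne_zero X r j)
  have hlen : ∀ n, 0 < ∑ K ∈ B (n + 1), haarLength K := fun n => by
    refine (Finset.sum_nonneg fun K _ => (haarLength_pos K).le).lt_of_ne fun h0 => ?_
    have := hm n
    rw [← h0, mul_zero] at this
    exact (haarLength_pos (n + 1)).ne this
  have hC0 : 0 ≤ 2 * C - m 0 := by linarith [hC 0]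
  have hsign : ∀ n K, blockSign ε (n + 1) K = ((ε n (K - 1) : ℤ) : ℝ) := fun n K => by
    rw [blockSign, if_neg (Nat.succ_ne_zero n), Nat.add_sub_cancel]
  have hDS : ∀ n j, j + 1 ∈ B (n + 1) → D (S (haarBasisVector X r j)) =
      (((ε n j : ℤ) : ℝ) * (haarLength (j + 1) / ∑ K ∈ B (n + 1), haarLength K)) •
        haarBasisVector X r n := by
    intro n j hj
    rw [hS1 j n hj, map_smul, hD, smul_smul, hsign, Nat.add_sub_cancel, ← hm n]
    congr 1
    have h1 : m n ≠ 0 := fun h0 => (haarLength_pos (n + 1)).ne (by rw [← hm n, h0, zero_mul])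
    have h2 := (hlen n).ne'
    field_simp
  refine ⟨c • T, c⁻¹ • D.comp S, fun y => ?_, fun y => ?_, fun y => ?_, fun n => ?_, fun n => ?_⟩
  · suffices (c⁻¹ • D.comp S).comp (c • T) = ContinuousLinearMap.id ℝ (HardySpaceZero X r) from
      congrArg (fun V : HardySpaceZero X r →L[ℝ] HardySpaceZero X r => V y) this
    refine ext_haarBasisVector fun n => ?_
    have e : D (S (T (haarBasisVector X r n))) = haarBasisVector X r n := by
      rw [hT, map_sum, map_sum]
      have : ∀ K ∈ B (n + 1), D (S (blockSign ε (n + 1) K • haarBasisVector X r (K - 1))) =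
          (haarLength K / ∑ K ∈ B (n + 1), haarLength K) • haarBasisVector X r n := by
        intro K hK
        have hK1 : K - 1 + 1 = K := Nat.sub_add_cancel ((hB n).1 K hK)
        rw [map_smul, map_smul, hDS n (K - 1) (by rwa [hK1]), smul_smul, hK1, ← hsign, ← mul_assoc,
          h.sign_mul_self hK, one_mul]
      rw [Finset.sum_congr rfl this, ← Finset.sum_smul, ← Finset.sum_div, div_self (hlen n).ne',
        one_smul]
    simp [e, smul_smul, hc.ne']
  · rw [smul_apply, norm_smul, Real.norm_of_nonneg hc.le]
    exact mul_le_mul_of_nonneg_left (hT' y) hc.le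
  · rw [smul_apply, norm_smul, Real.norm_of_nonneg (inv_nonneg.2 hc.le), mul_assoc]
    refine mul_le_mul_of_nonneg_left ((hD' _).trans ?_) (inv_nonneg.2 hc.le)
    exact mul_le_mul_of_nonneg_left (hS' y) hC0
  · have hbn : b.basis n = ‖haarBasisVector X r n‖⁻¹ • haarBasisVector X r n := hb n
    rw [signedSum_blockLam hb (hB n), hbn, map_smul, smul_apply, hT, smul_smul, mul_comm,
      div_eq_mul_inv]
    simp only [hsign]
  · refine ext_haarBasisVector fun j => ?_
    rw [signedSum_blockMu_apply (hB n)]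
    simp only [coord_haarBasisVector hb, ContinuousLinearMap.comp_apply, smul_apply, map_smul,
      smul_eq_mul, mul_ite, mul_zero]
    have hother : j + 1 ∉ B (n + 1) → (∑ K ∈ B (n + 1), if K - 1 = j then ((ε n (K - 1) : ℤ) : ℝ) *
        (haarLength K / ‖haarBasisVector X r (K - 1)‖) * ‖haarBasisVector X r j‖ else 0) = 0 :=
      fun hj => Finset.sum_eq_zero fun K hK => if_neg fun hKj => hj (by
        rwa [← hKj, Nat.sub_add_cancel ((hB n).1 K hK)])
    by_cases hex : ∃ k, j + 1 ∈ B (k + 1)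
    · obtain ⟨k, hk⟩ := hex
      rw [hDS k j hk, map_smul, smul_eq_mul, coord_haarBasisVector hb]
      by_cases hnk : n = k
      · subst hnk
        have hself : (∑ K ∈ B (n + 1), if K - 1 = j then ((ε n (K - 1) : ℤ) : ℝ) *
            (haarLength K / ‖haarBasisVector X r (K - 1)‖) * ‖haarBasisVector X r j‖ else 0) =
              ((ε n j : ℤ) : ℝ) * haarLength (j + 1) := by
          rw [Finset.sum_eq_single_of_mem (j + 1) hk]
          · rw [if_pos (Nat.add_sub_cancel j 1), Nat.add_sub_cancel, mul_assoc,
              div_mul_cancel₀ _ (hne j)]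
          · intro K hK hKj
            rw [if_neg]
            have := (hB n).1 K hK
            omega
        rw [if_pos rfl, hself]
        ring
      · rw [if_neg hnk, hother fun hj => hnk (Nat.succ_injective (h.injective _ _ _ hj hk))]
        simp
    · push Not at hex
      rw [hother (hex n), hS2 j hex]
      simp

end

/-! ### Strategic reproducibility -/

theorem strategicallyReproducible_haarBasis {X : HaarSystemNorm} {r : rademacherFamilies}
    (hweak : ∀ φ : StrongDual ℝ (HardySpaceZero X r),
      Tendsto (fun n => φ (rademacherVector X r n)) atTop (𝓝 0))
    {b : SchauderBasis ℝ (HardySpaceZero X r)}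
    (hb : ∀ n, b n = ‖haarBasisVector X r n‖⁻¹ • haarBasisVector X r n) :
    StrategicallyReproducibleWithProjectionalFactors b 2 := by
  intro η hη N hN
  obtain ⟨i, hi⟩ := exists_half_le_volume_limsupSet hN
  have hs : 0 < √(2 + η) := Real.sqrt_pos.2 (by linarith)
  -- The relative lengths decrease from below `1 / 2` to `p`; since `2 / p - 2 = 2 + η`, the
  -- variation of the normalizing multiplier costs no more than the factor `2 + η`.
  set p : ℝ := 1 / (2 + η / 2) with hp
  have hp0 : 0 < p := by positivity
  have hp1 : p < 1 / 2 := one_div_lt_one_div_of_lt (by norm_num) (by linarith)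
  set q : ℕ → ℝ := fun k => p + (1 / 2 - p) / (k + 2) with hq
  have hqp : ∀ k, p < q k := fun k => by
    have : 0 < (1 / 2 - p) / ((k : ℝ) + 2) := div_pos (by linarith) (by positivity)
    simp only [hq]; linarith
  have hq0 : ∀ k, 0 < q k := fun k => hp0.trans (hqp k)
  have hq1 : ∀ k, q k < 1 / 2 := fun k => by
    have : (1 / 2 - p) / ((k : ℝ) + 2) < 1 / 2 - p :=
      div_lt_self (by linarith) (by linarith [(Nat.cast_nonneg k : (0 : ℝ) ≤ k)])
    simp only [hq]; linarith
  have hqanti : StrictAnti q := strictAnti_nat_of_succ_lt fun k => by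
    simp only [hq, Nat.cast_add, Nat.cast_one]
    gcongr
    · linarith
  let D : BlockChoice X r := ⟨b, {K | 1 ≤ K ∧ K - 1 ∈ N i}, √(2 + η), q⟩
  refine ⟨D.strategy i, fun o ε => ?_⟩
  have hgood := D.good_blocks hweak hb (fun K hK => hK.1) hi hs hq0 hq1 hqanti o ε
  have hsys := BlockChoice.isHaarBlockSystem_of_good hgood
  have hreply := fun k => BlockChoice.reply_strategy (D := D) i o ε k
  set B := D.blocks o ε with hB
  have hlen : ∀ n, 0 < ∑ K ∈ B (n + 1), haarLength K := fun n =>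
    (mul_pos (hq0 _) (haarLength_pos _)).trans (hgood n).lower
  set m : ℕ → ℝ := fun n => haarLength (n + 1) / ∑ K ∈ B (n + 1), haarLength K with hm
  have hm1 : ∀ n, 1 / q (n + 1) ≤ m n := fun n => by
    rw [hm, div_le_div_iff₀ (hq0 _) (hlen n), one_mul, mul_comm]
    exact (hgood n).upper
  have hm2 : ∀ n, m n ≤ 1 / q (n + 2) := fun n => by
    rw [hm, div_le_div_iff₀ (hlen n) (hq0 _), one_mul, mul_comm]
    exact (hgood n).lower.le
  have hm0 : 2 ≤ m 0 := by
    refine le_trans ?_ (hm1 0)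
    rw [le_div_iff₀ (hq0 _)]
    linarith [hq1 (0 + 1)]
  have hmC : ∀ n, m n ≤ 2 + η / 2 := fun n => by
    refine (hm2 n).trans ?_
    have := one_div_le_one_div_of_le hp0 (hqp (n + 2)).le
    rwa [hp, one_div_one_div] at this
  obtain ⟨U, P, hPU, hU, hP, hvec, hfunc⟩ := hsys.exists_leftInverse
    (fun n => (hgood n).isDisjointFamily) hb (m := m)
    (fun n => div_mul_cancel₀ _ (hlen n).ne')
    (monotone_nat_of_le_succ fun n => (hm2 n).trans (hm1 (n + 1))) (by linarith) hmC hs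
  have hP' : ∀ y, ‖P y‖ ≤ √(2 + η) * ‖y‖ := fun y => by
    refine (hP y).trans (mul_le_mul_of_nonneg_right ?_ (norm_nonneg y))
    rw [inv_mul_le_iff₀ hs, Real.mul_self_sqrt (by linarith)]
    linarith
  have hx : (D.strategy i).vec b o ε = fun k => U (b.basis k) := funext fun k => by
    rw [Strategy.vec, hreply]; exact hvec k
  have hx' : (D.strategy i).func b o ε = fun k => (b.coord k).comp P := funext fun k => by
    rw [Strategy.func, hreply]; exact hfunc k
  have hequiv := impartiallyEquivalent_of_leftInverse b hPU (by linarith : 0 < 2 + η) hU hP'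
  have hprod : ∀ k, ∑ j ∈ (B (k + 1)).image (· - 1), blockLam X r (√(2 + η)) k j *
      blockMu X r (√(2 + η)) k (B (k + 1)) j = 1 := fun k =>
    sum_blockLam_mul_blockMu (hgood k).isDisjointFamily hs.ne' k (hlen k)
  refine ⟨⟨fun k => ?_, ?_, ?_, fun k => ?_, fun k => ?_⟩, fun k l => ?_⟩
  · rw [hreply]
    refine ⟨fun j hj => ?_, fun j _ => ?_, fun j _ => ?_, ?_, ?_⟩
    · obtain ⟨K, hK, rfl⟩ := Finset.mem_image.1 (Finset.mem_coe.1 hj)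
      exact ((hgood k).mem K hK).2
    · exact div_nonneg (mul_nonneg hs.le (norm_nonneg _)) (norm_nonneg _)
    · exact mul_nonneg (mul_nonneg (inv_nonneg.2 hs.le) (div_nonneg (norm_nonneg _) (norm_nonneg _)))
        (div_nonneg (haarLength_pos _).le (hlen k).le)
    · exact (by linarith : 1 - η < 1).trans_eq (hprod k).symm
    · exact (hprod k).trans_lt (by linarith)
  · rw [hx]; exact hequiv.1
  · rw [hx']; exact hequiv.2
  · rw [Strategy.vec, hreply]; exact (hgood k).dist_W (ε k)
  · rw [Strategy.func, hreply]; exact (hgood k).dist_G (ε k)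
  · rw [hx, hx', ContinuousLinearMap.comp_apply, hPU]
    refine (b.ortho k l).trans ?_
    by_cases hkl : k = l
    · subst hkl; simp
    · simp [hkl]

theorem theorem10p4 (X : HaarSystemNorm) (r : rademacherFamilies)
    (hweak : ∀ φ : StrongDual ℝ (HardySpaceZero X r),
      Tendsto (fun n => φ (rademacherVector X r n)) atTop (𝓝 0)) :
    ∃ b : SchauderBasis ℝ (HardySpaceZero X r),
      (∀ n, b n = ‖haarBasisVector X r n‖⁻¹ • haarBasisVector X r n) ∧
      (∀ n, ‖b n‖ = 1) ∧
      StrategicallyReproducibleWithProjectionalFactors b 2 := by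
  obtain ⟨b, hb⟩ := exists_haarBasis X r
  refine ⟨b, hb, fun n => ?_, strategicallyReproducible_haarBasis hweak hb⟩
  rw [hb, norm_smul, norm_inv, norm_norm,
    inv_mul_cancel₀ (norm_ne_zero_iff.2 (haarBasisVector_ne_zero X r n))]

end
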